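/- Fix $m,\hbar,c>0$ and $Q\in\mathbb{R}\setminus\{0\}$. Let $H^1$ be the usual Sobolev space of order one on $\mathbb{R}^3$, and let $D^1$ be the space of locally integrable functions $f$ on $\mathbb{R}^3$ whose distributional first order derivatives lie in $L^2$ and for which $\{x : |f(x)|>t\}$ has finite Lebesgue measure for every $t>0$. For $\psi:\mathbb{R}^3\to\mathbb{C}^2$ and $A:\mathbb{R}^3\to\mathbb{R}^3$ put $$\nabla_{\mathrm S,A}\psi=i\hbar\nabla\psi+\tfrac{Q}{c}A\psi,\qquad \nabla_{\mathrm P,A}\psi=\sum_{k=1}^3\sigma^k(\nabla_{\mathrm S,A}\psi)_k ,$$ where $\sigma^1,\sigma^2,\sigma^3$ are the Pauli matrices, and let $\nabla\otimes A$ be the $9$-vector of the first derivatives of the components of $A$. For $\lambda>0$ let $$\mathcal S_\lambda=\{(\psi,A)\in H^1\times D^1 : \|\psi\|_{L^2}^2=\lambda,\ \operatorname{div}A=0\},$$ and for $v\in\mathbb{R}^3$, $j\in\{\mathrm S,\mathrm P\}$ and $(\psi,A)\in\mathcal S_\lambda$ let $$\mathscr E_j^v(\psi,A)=\frac1{2m}\|\nabla_{j,A}\psi\|_{L^2}^2+\frac1{8\pi}\Bigl(\|\nabla\otimes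 A\|_{L^2}^2-\bigl\|\bigl(\tfrac vc\cdot\nabla\bigr)A\bigr\|_{L^2}^2\Bigr)+(\psi,i\hbar\, v\cdot\nabla\psi)_{L^2}.$$ (1) For all $j\in\{\mathrm S,\mathrm P\}$ and $\lambda>0$ there is a $V\in\mathbb{R}$ such that for every $v\in\mathbb{R}^3$ with $|v|>V$ the functional $\mathscr E_j^v$ is unbounded from below on $\mathcal S_\lambda$, and there is a pair $(\psi_0,A_0)\in\mathcal S_\lambda$ with $\psi_0$ real-valued and $$c^2\|\nabla\otimes A_0\|_{L^2}^2-\|(v\cdot\nabla)A_0\|_{L^2}^2<0.\qquad(*)$$ Moreover, for all $j$, $\lambda>0$, $v\in\mathbb{R}^3$, every $(\psi_0,A_0)\in\mathcal S_\lambda$ with $\psi_0$ real-valued that satisfies $(*)$, and every $a>0$, the states $$\psi_R(x)=R^{-3/2}e^{i\frac{m}{\hbar}v\cdot x}\psi_0\bigl(\tfrac xR\bigr),\qquad A_R(x)=\frac{ac}{Q}A_0\bigl(\tfrac xR\bigr)\qquad(R>0)$$ belong to $\mathcal S_\lambda$, and $\mathscr E_j^v(\psi_R,A_R)\to-\infty$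 as $R\to\infty$. (2) There is a constant $K_S>0$ with $\|f\|_{L^6}\le K_S\|\nabla f\|_{L^2}$ for all real-valued $f\in D^1$. For any such constant put $\Theta_{\mathrm S,\pm}^\lambda=\pm c$ and $$\Theta_{\mathrm P,\pm}^\lambda=-\frac{8\pi K_S^3Q^2\lambda}{\hbar}\pm\sqrt{\frac{(8\pi)^2K_S^6Q^4\lambda^2}{\hbar^2}+c^2}.$$ Then for all $j\in\{\mathrm S,\mathrm P\}$, $\lambda>0$ and $v\in\mathbb{R}^3$ with $0<|v|<\Theta_{j,+}^\lambda$ the functional $\mathscr E_j^v$ is bounded from below on $\mathcal S_\lambda$. More precisely, let $(\psi,A)\in\mathcal S_\lambda$. If $$\|\nabla\otimes A\|_{L^2}<16\pi K_Sc|Q|\lambda^{3/4}\frac{|v|}{c^2-|v|^2}\|\psi\|_{L^6}^{1/2},\qquad(**)$$ then $$\mathscr E_j^v(\psi,A)\ge\frac{\hbar^2}{4mK_S^2}\frac{(\Theta_{j,+}^\lambda-|v|)(|v|-\Theta_{j,-}^\lambda)}{c^2-|v|^2}\|\psi\|_{L^6}^2+\frac1{16\pi}\Bigl(1-\frac{|v|^2}{c^2}\Bigr)\|\nabla\otimes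 A\|_{L^2}^2$$ $$\qquad-\frac{(4\pi)^2K_S^6Q^4m\lambda^3}{\hbar^2}\frac{|v|^4}{(c^2-|v|^2)(\Theta_{j,+}^\lambda-|v|)(|v|-\Theta_{j,-}^\lambda)}-\frac{m|v|^2}{2}\lambda,$$ and if $(**)$ fails, then $$\mathscr E_j^v(\psi,A)\ge\frac1{16\pi}\Bigl(1-\frac{|v|^2}{c^2}\Bigr)\|\nabla\otimes A\|_{L^2}^2-\frac{m|v|^2}{2}\lambda .$$ -/

import Mathlib

open MeasureTheory Filter
open scoped ContDiff ENNReal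

noncomputable section

namespace TravellingWave

/-- Physical space `ℝ³` with its Euclidean norm and Lebesgue measure. -/
abbrev R3 : Type := EuclideanSpace ℝ (Fin 3)

/-- The spinor space `ℂ²` with its Hermitian inner product. -/
abbrev Spinor : Type := EuclideanSpace ℂ (Fin 2)

/-- The mass, the charge, the reduced Planck constant and the speed of light. -/
structure Constants where
  m : ℝ
  Q : ℝ
  hbar : ℝ
  c : ℝ
  m_pos : 0 < m
  Q_ne_zero : Q ≠ 0
  hbar_pos : 0 < hbar
  c_pos : 0 < c

/-- The two models: Schrödinger (no spin-field interaction) and Pauli. -/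
inductive Model where
  | S
  | P

section WeakDerivatives

variable {F : Type*} [NormedAddCommGroup F] [NormedSpace ℝ F]

/-- `g` is the distributional derivative `∂ₖ f`; both are locally integrable functions. -/
def HasWeakPartial (k : Fin 3) (f g : R3 → F) : Prop :=
  LocallyIntegrable f volume ∧ LocallyIntegrable g volume ∧
    ∀ φ : R3 → ℝ, ContDiff ℝ ∞ φ → HasCompactSupport φ →
      ∫ x, (fderiv ℝ φ x (EuclideanSpace.single k 1)) • f x = - ∫ x, φ x • g x

open Classical in
/-- A representative of the distributional derivative `∂ₖ f`, which is unique up to equality almost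
everywhere; the value is `0` if there is no locally integrable one. -/
def weakPartial (k : Fin 3) (f : R3 → F) : R3 → F :=
  if h : ∃ g, HasWeakPartial k f g then h.choose else 0

/-- The Sobolev space `H¹`. -/
def MemH1 (f : R3 → F) : Prop :=
  MemLp f 2 volume ∧ ∀ k, ∃ g, HasWeakPartial k f g ∧ MemLp g 2 volume

/-- The space `D¹`: locally integrable functions with distributional first derivatives in `L²`
that vanish at infinity, in the sense that every set `{|f| > t}`, `t > 0`, has finite measure. -/
def MemD1 (f : R3 → F) : Prop :=
  LocallyIntegrable f volume ∧ (∀ k, ∃ g, HasWeakPartial k f g ∧ MemLp g 2 volume) ∧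
    ∀ t : ℝ, 0 < t → volume {x | t < ‖f x‖} < ⊤

/-- The `Lᵖ` norm over `ℝ³` as a real number. -/
def normL (p : ℝ≥0∞) (f : R3 → F) : ℝ := (eLpNorm f p volume).toReal

end WeakDerivatives

/-- The gradient of a scalar function. -/
def grad (f : R3 → ℝ) (x : R3) : R3 := WithLp.toLp 2 fun k => weakPartial k f x

/-- `K` is a constant in the Sobolev inequality `‖f‖_{L⁶} ≤ K ‖∇f‖_{L²}` on `D¹`. -/
def IsSobolevConstant (K : ℝ) : Prop :=
  0 < K ∧ ∀ f : R3 → ℝ, MemD1 f →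
    eLpNorm f 6 volume ≤ ENNReal.ofReal K * eLpNorm (grad f) 2 volume

/-- The `9`-vector `∇ ⊗ A` of all first derivatives of the components of `A`. -/
def gradTensor (A : R3 → R3) (x : R3) : EuclideanSpace ℝ (Fin 3 × Fin 3) :=
  WithLp.toLp 2 fun p => weakPartial p.1 A x p.2

/-- The directional derivative `(w · ∇) f`. -/
def dirDeriv {F : Type*} [NormedAddCommGroup F] [NormedSpace ℝ F] (w : R3) (f : R3 → F)
    (x : R3) : F :=
  ∑ k, w k • weakPartial k f x

/-- The divergence of a vector field. -/
def divergence (A : R3 → R3) (x : R3) : ℝ := ∑ k, weakPartial k A x k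

/-- The Pauli matrices. -/
def pauli : Fin 3 → Matrix (Fin 2) (Fin 2) ℂ :=
  ![!![0, 1; 1, 0], !![0, -Complex.I; Complex.I, 0], !![1, 0; 0, -1]]

/-- The `k`-th component of the covariant derivative `∇_{S,A} ψ = iħ∇ψ + (Q/c) A ψ`. -/
def covDeriv (C : Constants) (A : R3 → R3) (ψ : R3 → Spinor) (k : Fin 3) (x : R3) : Spinor :=
  (Complex.I * (C.hbar : ℂ)) • weakPartial k ψ x + ((C.Q / C.c * A x k : ℝ) : ℂ) • ψ x

/-- `∇_{P,A} ψ = σ · ∇_{S,A} ψ`. -/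
def pauliDeriv (C : Constants) (A : R3 → R3) (ψ : R3 → Spinor) (x : R3) : Spinor :=
  ∑ k, WithLp.toLp 2 ((pauli k).mulVec (covDeriv C A ψ k x).ofLp)

/-- `‖∇_{j,A} ψ‖²_{L²}`. -/
def kinetic (C : Constants) (j : Model) (A : R3 → R3) (ψ : R3 → Spinor) : ℝ :=
  match j with
  | Model.S => ∑ k, normL 2 (covDeriv C A ψ k) ^ 2
  | Model.P => normL 2 (pauliDeriv C A ψ) ^ 2

/-- The functional `𝓔ⱼᵛ`. The real part in the last term only serves to make the value a real
number: the operator `iħ v · ∇` is symmetric on `H¹`. -/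
def energy (C : Constants) (j : Model) (v : R3) (ψ : R3 → Spinor) (A : R3 → R3) : ℝ :=
  1 / (2 * C.m) * kinetic C j A ψ
    + 1 / (8 * Real.pi) * (normL 2 (gradTensor A) ^ 2 - normL 2 (dirDeriv (C.c⁻¹ • v) A) ^ 2)
    + (∫ x, inner ℂ (ψ x) ((Complex.I * (C.hbar : ℂ)) • dirDeriv v ψ x)).re

/-- The set `𝓢_λ`. -/
def admissible (lam : ℝ) : Set ((R3 → Spinor) × (R3 → R3)) :=
  {q | MemH1 q.1 ∧ MemD1 q.2 ∧ normL 2 q.1 ^ 2 = lam ∧ divergence q.2 =ᵐ[volume] 0}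

/-- `Θ_{j,+}^λ`, for the Sobolev constant `K`. -/
def thetaPlus (C : Constants) (K : ℝ) (j : Model) (lam : ℝ) : ℝ :=
  match j with
  | Model.S => C.c
  | Model.P => -(8 * Real.pi * K ^ 3 * C.Q ^ 2 * lam / C.hbar)
      + √((8 * Real.pi) ^ 2 * K ^ 6 * C.Q ^ 4 * lam ^ 2 / C.hbar ^ 2 + C.c ^ 2)

/-- `Θ_{j,-}^λ`, for the Sobolev constant `K`. -/
def thetaMinus (C : Constants) (K : ℝ) (j : Model) (lam : ℝ) : ℝ :=
  match j with
  | Model.S => -C.c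
  | Model.P => -(8 * Real.pi * K ^ 3 * C.Q ^ 2 * lam / C.hbar)
      - √((8 * Real.pi) ^ 2 * K ^ 6 * C.Q ^ 4 * lam ^ 2 / C.hbar ^ 2 + C.c ^ 2)

/-- The scaled trial wave function `R^{-3/2} exp(i m v·x / ħ) ψ₀(x/R)`. -/
def trialPsi (C : Constants) (v : R3) (ψ₀ : R3 → Spinor) (R : ℝ) (x : R3) : Spinor :=
  (((R ^ (-(3 / 2) : ℝ) : ℝ) : ℂ) *
    Complex.exp (Complex.I * ((C.m / C.hbar * inner ℝ v x : ℝ) : ℂ))) • ψ₀ (R⁻¹ • x)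

/-- The scaled trial vector potential `(a c / Q) A₀(x/R)`. -/
def trialA (C : Constants) (A₀ : R3 → R3) (a R : ℝ) (x : R3) : R3 :=
  (a * C.c / C.Q) • A₀ (R⁻¹ • x)

/-- All components of the wave function are real-valued. -/
def IsRealValued (ψ : R3 → Spinor) : Prop := ∀ x i, (ψ x i).im = 0

end TravellingWave

end

noncomputable section

namespace TravellingWave

open Topology
open scoped Convolution

/-! ### Calculus of weak partial derivatives: uniqueness, Leibniz rule, dilations. -/

section WeakCalculus

variable {F G : Type*} [NormedAddCommGroup F] [NormedSpace ℝ F]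
  [NormedAddCommGroup G] [NormedSpace ℝ G]

/-! Large speeds. Dilating the state by R leaves the norm of `ψ` fixed, and the phase `exp(i m
v·x/ħ)` only adds bounded terms to the kinetic and coupling energies. These two stay bounded for R ≥
1, because the L²-normalised dilation is an isometry and each derivative of the profile gains a
factor 1/R. The field energy, by contrast, is exactly R times a quantity that (*) makes negative, so
the energy tends to -∞ (`tendsto_energy_trial`). To satisfy (*), fix one smooth compactly supported
solenoidal field. A directional Poincaré inequality bounds its derivative along v below by a
constant times |v|, uniformly in the direction (`exists_poincare`, `exists_speed`).

Small speeds. Completing the square turns the transport term into a constant shift mv of the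
covariant derivative, at the price of -m|v|²λ/2 and the current term -(Q/c)∫ v·A|ψ|² (`energy_eq`).
Write X = ‖∇⊗A‖, s = |v|, D = c² - s². The field energy is at least D X²/(8πc²). Hölder, Sobolev and
interpolation bound the current by a multiple of s X λ^{3/4}‖ψ‖₆^{1/2}. The diamagnetic inequality,
which is blind to real shifts, bounds the Schrödinger kinetic energy below by ħ²‖ψ‖₆²/K²
(`diamagnetic`). The Pauli energy differs from it by the Zeeman term, which is also independent of
the shift and is at most (ħ|Q|/c) X ‖ψ‖₃‖ψ‖₆ (`pauli_sub_schroedinger`).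

If (**) fails, half of the field energy pays for the current. If (**) holds, inserting it into the
Zeeman term lowers the kinetic coefficient by exactly the factor (Θ₊ - s)(s - Θ₋)/D, and completing
two more squares gives the bound (`quadratic_lower_bound`).

The analytic work is to justify this for rough functions. H¹ is reached from smooth compactly
supported functions by mollification and cut-off. A scalar function in D¹ need not be in L²; bounded
C¹ truncations vanishing near zero bring it into H¹. This yields the Sobolev inequality on D¹ and
the vanishing of ∫(∂ⱼf ∂ᵢg - ∂ᵢf ∂ⱼg), hence ‖curl A‖ ≤ ‖∇⊗A‖ with constant one (`normL_curl_le`),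
which the sharp Zeeman bound needs. -/

theorem integrable_test_smul {φ : R3 → ℝ} (hφ : Continuous φ) (hc : HasCompactSupport φ)
    {f : R3 → F} (hf : LocallyIntegrable f volume) : Integrable (fun x => φ x • f x) volume :=
  hf.integrable_smul_left_of_hasCompactSupport hφ hc

theorem continuous_fderiv_apply_of_contDiff {φ : R3 → F} (hφ : ContDiff ℝ 1 φ) (e : R3) :
    Continuous fun x => fderiv ℝ φ x e :=
  (hφ.continuous_fderiv one_ne_zero).clm_apply continuous_const

theorem integrable_fderiv_test_smul {φ : R3 → ℝ} (hφ : ContDiff ℝ 1 φ)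
    (hc : HasCompactSupport φ) {f : R3 → F} (hf : LocallyIntegrable f volume) (e : R3) :
    Integrable (fun x => fderiv ℝ φ x e • f x) volume :=
  integrable_test_smul (continuous_fderiv_apply_of_contDiff hφ e)
    (hc.fderiv_apply (𝕜 := ℝ) e) hf

/-- The weak derivative of a function is unique up to equality almost everywhere. -/
theorem HasWeakPartial.ae_eq [CompleteSpace F] {k : Fin 3} {f g h : R3 → F}
    (hg : HasWeakPartial k f g) (hh : HasWeakPartial k f h) : g =ᵐ[volume] h := by
  refine ae_eq_of_integral_contDiff_smul_eq hg.2.1 hh.2.1 fun φ hφ hc => ?_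
  exact neg_injective ((hg.2.2 φ hφ hc).symm.trans (hh.2.2 φ hφ hc))

/-- Together with uniqueness this lets every computation run on an explicit derivative and be
transferred almost everywhere to the representative picked by choice. -/
theorem HasWeakPartial.weakPartial {k : Fin 3} {f g : R3 → F}
    (hg : HasWeakPartial k f g) : HasWeakPartial k f (weakPartial k f) := by
  have h : ∃ g, HasWeakPartial k f g := ⟨g, hg⟩
  rw [TravellingWave.weakPartial, dif_pos h]
  exact h.choose_spec

theorem HasWeakPartial.weakPartial_ae_eq [CompleteSpace F] {k : Fin 3} {f g : R3 → F}
    (hg : HasWeakPartial k f g) : TravellingWave.weakPartial k f =ᵐ[volume] g :=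
  hg.weakPartial.ae_eq hg

theorem LocallyIntegrable.congr_ae {E : Type*} [NormedAddCommGroup E] {f g : R3 → E}
    (hf : LocallyIntegrable f volume) (h : f =ᵐ[volume] g) : LocallyIntegrable g volume := fun x => by
  obtain ⟨s, hs, hi⟩ := hf x
  exact ⟨s, hs, hi.congr_fun_ae (ae_restrict_of_ae h)⟩

theorem HasWeakPartial.congr {k : Fin 3} {f f' g g' : R3 → F} (h : HasWeakPartial k f g)
    (hf : f =ᵐ[volume] f') (hg : g =ᵐ[volume] g') : HasWeakPartial k f' g' := by
  refine ⟨LocallyIntegrable.congr_ae h.1 hf, LocallyIntegrable.congr_ae h.2.1 hg,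
    fun φ hφ hc => ?_⟩
  have e1 : (fun x => fderiv ℝ φ x (EuclideanSpace.single k 1) • f x) =ᵐ[volume]
      fun x => fderiv ℝ φ x (EuclideanSpace.single k 1) • f' x := hf.mono fun x hx => by
    simp only [hx]
  have e2 : (fun x => φ x • g x) =ᵐ[volume] fun x => φ x • g' x := hg.mono fun x hx => by
    simp only [hx]
  rw [← integral_congr_ae e1, ← integral_congr_ae e2]
  exact h.2.2 φ hφ hc

theorem HasWeakPartial.clm [CompleteSpace F] [CompleteSpace G] {k : Fin 3} {f g : R3 → F}
    (h : HasWeakPartial k f g) (L : F →L[ℝ] G) :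
    HasWeakPartial k (fun x => L (f x)) (fun x => L (g x)) := by
  have loc : ∀ {u : R3 → F}, LocallyIntegrable u volume →
      LocallyIntegrable (fun x => L (u x)) volume := fun hu x => by
    obtain ⟨s, hs, hi⟩ := hu x
    exact ⟨s, hs, L.integrable_comp hi⟩
  refine ⟨loc h.1, loc h.2.1, fun φ hφ hc => ?_⟩
  have h1 : ∀ (a : R3 → ℝ) (u : R3 → F), Integrable (fun x => a x • u x) volume →
      ∫ x, a x • L (u x) = L (∫ x, a x • u x) := fun a u hi => by
    rw [← L.integral_comp_comm hi]; simp
  rw [h1 _ _ (integrable_fderiv_test_smul (hφ.of_le (by simp)) hc h.1 _),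
    h1 _ _ (integrable_test_smul hφ.continuous hc h.2.1), h.2.2 φ hφ hc, map_neg]

theorem HasWeakPartial.add {k : Fin 3} {f g f' g' : R3 → F} (h : HasWeakPartial k f g)
    (h' : HasWeakPartial k f' g') :
    HasWeakPartial k (fun x => f x + f' x) (fun x => g x + g' x) := by
  refine ⟨h.1.add h'.1, h.2.1.add h'.2.1, fun φ hφ hc => ?_⟩
  simp only [smul_add]
  have h1 : ContDiff ℝ 1 φ := hφ.of_le (by simp)
  rw [integral_add (integrable_fderiv_test_smul h1 hc h.1 _)
      (integrable_fderiv_test_smul h1 hc h'.1 _),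
    integral_add (integrable_test_smul hφ.continuous hc h.2.1)
      (integrable_test_smul hφ.continuous hc h'.2.1), h.2.2 φ hφ hc, h'.2.2 φ hφ hc, neg_add]

theorem HasWeakPartial.const_smul {k : Fin 3} {f g : R3 → F} (h : HasWeakPartial k f g)
    {𝕜 : Type*} [NormedField 𝕜] [NormedAlgebra ℝ 𝕜] [NormedSpace 𝕜 F] [IsScalarTower ℝ 𝕜 F]
    [SMulCommClass ℝ 𝕜 F] (a : 𝕜) :
    HasWeakPartial k (fun x => a • f x) (fun x => a • g x) := by
  refine ⟨h.1.smul a, h.2.1.smul a, fun φ hφ hc => ?_⟩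
  simp only [smul_comm _ a, integral_smul, h.2.2 φ hφ hc, smul_neg]

theorem HasWeakPartial.sub {k : Fin 3} {f g f' g' : R3 → F} (h : HasWeakPartial k f g)
    (h' : HasWeakPartial k f' g') :
    HasWeakPartial k (fun x => f x - f' x) (fun x => g x - g' x) := by
  simpa [sub_eq_add_neg] using h.add (h'.const_smul (-1 : ℝ))

/-- Classical derivatives are weak derivatives. -/
theorem hasWeakPartial_of_contDiff {f : R3 → F} (hf : ContDiff ℝ 1 f) (k : Fin 3) :
    HasWeakPartial k f (fun x => fderiv ℝ f x (EuclideanSpace.single k 1)) := by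
  have hloc := (continuous_fderiv_apply_of_contDiff hf
    (EuclideanSpace.single k 1)).locallyIntegrable (μ := volume)
  refine ⟨hf.continuous.locallyIntegrable, hloc, fun φ hφ hc => ?_⟩
  rw [integral_smul_fderiv_eq_neg_fderiv_smul_of_integrable, neg_neg]
  · exact integrable_fderiv_test_smul (hφ.of_le (by simp)) hc hf.continuous.locallyIntegrable _
  · exact integrable_test_smul hφ.continuous hc hloc
  · exact integrable_test_smul hφ.continuous hc hf.continuous.locallyIntegrable
  · exact fun x _ => (hφ.differentiable (by simp)) x
  · exact fun x _ => (hf.differentiable one_ne_zero) x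

/-- The Leibniz rule for a smooth real multiplier. -/
theorem HasWeakPartial.smooth_smul {k : Fin 3} {f g : R3 → F} (h : HasWeakPartial k f g)
    {θ : R3 → ℝ} (hθ : ContDiff ℝ ∞ θ) :
    HasWeakPartial k (fun x => θ x • f x)
      (fun x => fderiv ℝ θ x (EuclideanSpace.single k 1) • f x + θ x • g x) := by
  have h1 : ContDiff ℝ 1 θ := hθ.of_le (by simp)
  have hD := continuous_fderiv_apply_of_contDiff h1 (EuclideanSpace.single k 1)
  have loc : ∀ {a : R3 → ℝ} {u : R3 → F}, Continuous a → LocallyIntegrable u volume →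
      LocallyIntegrable (fun x => a x • u x) volume := fun ha hu => hu.continuous_smul ha
  refine ⟨loc hθ.continuous h.1, (loc hD h.1).add (loc hθ.continuous h.2.1), fun φ hφ hc => ?_⟩
  have hprod : ContDiff ℝ ∞ fun x => φ x * θ x := hφ.mul hθ
  have hcp : HasCompactSupport fun x => φ x * θ x := hc.mul_right
  have key := h.2.2 _ hprod hcp
  have hφ1 : ContDiff ℝ 1 φ := hφ.of_le (by simp)
  have hfd : ∀ x, fderiv ℝ (fun x => φ x * θ x) x (EuclideanSpace.single k 1) • f x
      = fderiv ℝ φ x (EuclideanSpace.single k 1) • θ x • f x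
        + φ x • fderiv ℝ θ x (EuclideanSpace.single k 1) • f x := fun x => by
    rw [fderiv_fun_mul (hφ1.differentiable one_ne_zero x) (h1.differentiable one_ne_zero x)]
    simp only [add_apply, smul_apply, smul_eq_mul, add_smul, smul_smul]
    rw [add_comm, mul_comm (θ x)]
  simp only [hfd] at key
  rw [integral_add (integrable_fderiv_test_smul hφ1 hc (loc hθ.continuous h.1) _)
    (integrable_test_smul hφ.continuous hc (loc hD h.1))] at key
  simp only [smul_add]
  rw [integral_add (integrable_test_smul hφ.continuous hc (loc hD h.1))
    (integrable_test_smul hφ.continuous hc (loc hθ.continuous h.2.1))]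
  simp only [mul_smul] at key
  rw [eq_sub_of_add_eq key]
  abel

theorem locallyIntegrable_comp_inv_smul {E : Type*} [NormedAddCommGroup E] {f : R3 → E}
    (hf : LocallyIntegrable f volume) {R : ℝ}
    (hR : 0 < R) : LocallyIntegrable (fun x => f (R⁻¹ • x)) volume := by
  have h := (locallyIntegrable_map_homeomorph (μ := (volume : Measure R3))
    (Homeomorph.smulOfNeZero R⁻¹ (inv_ne_zero hR.ne') : R3 ≃ₜ R3) (f := f)).1 ?_
  · exact h
  · have : Measure.map (Homeomorph.smulOfNeZero R⁻¹ (inv_ne_zero hR.ne') : R3 ≃ₜ R3) volume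
      = ENNReal.ofReal |(R⁻¹ ^ 3)⁻¹| • (volume : Measure R3) := by
      have := Measure.map_addHaar_smul (volume : Measure R3) (inv_ne_zero hR.ne')
      simpa using this
    rw [this]
    intro x
    obtain ⟨s, hs, hi⟩ := hf x
    refine ⟨s, hs, ?_⟩
    rw [IntegrableOn, Measure.restrict_smul]
    exact hi.smul_measure ENNReal.ofReal_ne_top

/-- Weak derivatives and dilations. -/
theorem HasWeakPartial.comp_inv_smul {k : Fin 3} {f g : R3 → F}
    (h : HasWeakPartial k f g) {R : ℝ} (hR : 0 < R) :
    HasWeakPartial k (fun x => f (R⁻¹ • x)) (fun x => R⁻¹ • g (R⁻¹ • x)) := by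
  refine ⟨locallyIntegrable_comp_inv_smul h.1 hR,
    (locallyIntegrable_comp_inv_smul h.2.1 hR).smul _, fun φ hφ hc => ?_⟩
  have hφR : ContDiff ℝ ∞ fun y : R3 => φ (R • y) := hφ.comp (contDiff_const_smul R)
  have hcR : HasCompactSupport fun y : R3 => φ (R • y) := hc.comp_smul hR.ne'
  have key := h.2.2 _ hφR hcR
  have hd : ∀ y : R3, fderiv ℝ (fun y : R3 => φ (R • y)) y (EuclideanSpace.single k 1)
      = R * fderiv ℝ φ (R • y) (EuclideanSpace.single k 1) := fun y => by
    rw [fderiv_comp_smul]; simp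
  simp only [hd, mul_smul, integral_smul] at key
  have e1 : ∀ u : R3 → F, ∫ x, u x = R ^ 3 • ∫ y, u (R • y) := fun u => by
    rw [Measure.integral_comp_smul_of_nonneg volume u R (hR := hR.le), smul_smul]
    simp [hR.ne']
  rw [e1, e1 fun x => φ x • R⁻¹ • g (R⁻¹ • x)]
  simp only [smul_smul, inv_mul_cancel₀ hR.ne', one_smul]
  rw [← smul_neg]
  congr 1
  have : ∀ y, (φ (R • y) * R⁻¹) • g y = R⁻¹ • φ (R • y) • g y := fun y => by
    rw [smul_smul, mul_comm]
  simp only [this, integral_smul]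
  rw [← smul_neg, ← key, smul_smul, inv_mul_cancel₀ hR.ne', one_smul]

end WeakCalculus

/-! ### Strong L² convergence from almost everywhere convergence and a norm bound. -/

theorem eLpNorm_two_eq {α E : Type*} {mα : MeasurableSpace α} {μ : Measure α}
    [NormedAddCommGroup E] (f : α → E) :
    eLpNorm f 2 μ = (∫⁻ x, ‖f x‖ₑ ^ 2 ∂μ) ^ (1 / 2 : ℝ) := by
  rw [eLpNorm_eq_lintegral_rpow_enorm_toReal (by simp) (by simp)]
  simp

theorem eLpNorm_two_sq {α E : Type*} {mα : MeasurableSpace α} {μ : Measure α}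
    [NormedAddCommGroup E] (f : α → E) :
    eLpNorm f 2 μ ^ 2 = ∫⁻ x, ‖f x‖ₑ ^ 2 ∂μ := by
  rw [eLpNorm_two_eq, ← ENNReal.rpow_natCast, ← ENNReal.rpow_mul]
  simp

/-- If `uₙ → f` almost everywhere and `‖uₙ‖₂ ≤ ‖f‖₂ < ∞`, then `uₙ → f` in `L²`. -/
theorem tendsto_eLpNorm_two_of_ae {α E : Type*} {mα : MeasurableSpace α} {μ : Measure α}
    [NormedAddCommGroup E] {u : ℕ → α → E} {f : α → E}
    (hu : ∀ n, AEStronglyMeasurable (u n) μ) (hf : MemLp f 2 μ)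
    (hlim : ∀ᵐ x ∂μ, Tendsto (fun n => u n x) atTop (𝓝 (f x)))
    (hle : ∀ n, eLpNorm (u n) 2 μ ≤ eLpNorm f 2 μ) :
    Tendsto (fun n => eLpNorm (u n - f) 2 μ) atTop (𝓝 0) := by
  set b := ∫⁻ x, ‖f x‖ₑ ^ 2 ∂μ with hb
  have hbtop : b ≠ ⊤ := by
    rw [hb, ← eLpNorm_two_sq]; exact ENNReal.pow_ne_top hf.2.ne
  -- By the parallelogram bound this is a nonnegative function with limit 4|f|². Fatou for it,
  -- combined with ‖uₙ‖ ≤ ‖f‖, forces the integral of |uₙ - f|² to vanish in the limit.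
  set h : ℕ → α → ℝ≥0∞ := fun n x => 2 * ‖u n x‖ₑ ^ 2 + 2 * ‖f x‖ₑ ^ 2 - ‖u n x - f x‖ₑ ^ 2
    with hh
  have hsub : ∀ n x, ‖u n x - f x‖ₑ ^ 2 ≤ 2 * ‖u n x‖ₑ ^ 2 + 2 * ‖f x‖ₑ ^ 2 := fun n x => by
    have h1 : ‖u n x - f x‖ ^ 2 ≤ 2 * ‖u n x‖ ^ 2 + 2 * ‖f x‖ ^ 2 := by
      have := norm_sub_le (u n x) (f x)
      nlinarith [sq_nonneg (‖u n x‖ - ‖f x‖), norm_nonneg (u n x - f x),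
        norm_nonneg (u n x), norm_nonneg (f x)]
    simp only [← ofReal_norm]
    rw [← ENNReal.ofReal_pow (norm_nonneg _), ← ENNReal.ofReal_pow (norm_nonneg _),
      ← ENNReal.ofReal_pow (norm_nonneg _), ← ENNReal.ofReal_ofNat 2,
      ← ENNReal.ofReal_mul (by norm_num), ← ENNReal.ofReal_mul (by norm_num),
      ← ENNReal.ofReal_add (by positivity) (by positivity)]
    exact ENNReal.ofReal_le_ofReal h1
  have mu : ∀ n, AEMeasurable (fun x => ‖u n x‖ₑ ^ 2) μ := fun n => (hu n).enorm.pow_const 2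
  have mf : AEMeasurable (fun x => ‖f x‖ₑ ^ 2) μ := hf.1.enorm.pow_const 2
  have md : ∀ n, AEMeasurable (fun x => ‖u n x - f x‖ₑ ^ 2) μ := fun n =>
    ((hu n).sub hf.1).enorm.pow_const 2
  have mh : ∀ n, AEMeasurable (h n) μ := fun n =>
    (((mu n).const_mul 2).add (mf.const_mul 2)).sub (md n)
  have hsum : ∀ n, ∫⁻ x, h n x ∂μ + ∫⁻ x, ‖u n x - f x‖ₑ ^ 2 ∂μ ≤ 4 * b := fun n => by
    rw [← lintegral_add_right' _ (md n)]
    have : ∀ x, h n x + ‖u n x - f x‖ₑ ^ 2 = 2 * ‖u n x‖ₑ ^ 2 + 2 * ‖f x‖ₑ ^ 2 := fun x =>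
      tsub_add_cancel_of_le (hsub n x)
    simp only [this]
    rw [lintegral_add_right' _ (mf.const_mul 2), lintegral_const_mul'' _ (mu n),
      lintegral_const_mul'' _ mf, ← eLpNorm_two_sq, ← hb]
    have h2 : eLpNorm (u n) 2 μ ^ 2 ≤ b := by
      rw [hb, ← eLpNorm_two_sq]; gcongr; exact hle n
    calc 2 * eLpNorm (u n) 2 μ ^ 2 + 2 * b ≤ 2 * b + 2 * b := by gcongr
      _ = 4 * b := by ring
  have hlimh : ∀ᵐ x ∂μ, liminf (fun n => h n x) atTop = 4 * ‖f x‖ₑ ^ 2 := by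
    filter_upwards [hlim] with x hx
    refine Tendsto.liminf_eq ?_
    have t1 : Tendsto (fun n => ‖u n x‖ₑ ^ 2) atTop (𝓝 (‖f x‖ₑ ^ 2)) :=
      (ENNReal.continuous_pow 2).continuousAt.tendsto.comp hx.enorm
    have t2 : Tendsto (fun n => ‖u n x - f x‖ₑ ^ 2) atTop (𝓝 0) := by
      have : Tendsto (fun n => u n x - f x) atTop (𝓝 0) := by
        simpa using hx.sub_const (f x)
      simpa [Function.comp_def] using
        (ENNReal.continuous_pow 2).continuousAt.tendsto.comp this.enorm
    have t3 := (ENNReal.Tendsto.const_mul (a := 2) t1 (Or.inr (by simp))).add_const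
      (2 * ‖f x‖ₑ ^ 2)
    have t4 := ENNReal.Tendsto.sub t3 t2 (Or.inr (by simp))
    convert t4 using 2
    rw [tsub_zero, ← two_mul, ← mul_assoc]; norm_num
  have hfatou : 4 * b ≤ liminf (fun n => ∫⁻ x, h n x ∂μ) atTop := by
    calc 4 * b = ∫⁻ x, liminf (fun n => h n x) atTop ∂μ := by
          rw [lintegral_congr_ae hlimh, lintegral_const_mul'' _ mf]
      _ ≤ _ := lintegral_liminf_le' mh
  have hI : Tendsto (fun n => ∫⁻ x, h n x ∂μ) atTop (𝓝 (4 * b)) := by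
    refine tendsto_of_le_liminf_of_limsup_le hfatou ?_
    refine limsup_le_of_le (by isBoundedDefault) (Eventually.of_forall fun n => ?_)
    exact le_self_add.trans (hsum n)
  have h4b : 4 * b ≠ ⊤ := ENNReal.mul_ne_top (by simp) hbtop
  have hd : Tendsto (fun n => ∫⁻ x, ‖u n x - f x‖ₑ ^ 2 ∂μ) atTop (𝓝 0) := by
    have t : Tendsto (fun n => 4 * b - ∫⁻ x, h n x ∂μ) atTop (𝓝 0) := by
      simpa using ENNReal.Tendsto.sub (tendsto_const_nhds (x := 4 * b)) hI (Or.inl h4b)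
    refine tendsto_of_tendsto_of_tendsto_of_le_of_le tendsto_const_nhds t (fun _ => zero_le) ?_
    intro n
    have hfin : ∫⁻ x, h n x ∂μ ≠ ⊤ := ne_top_of_le_ne_top h4b (le_self_add.trans (hsum n))
    exact ENNReal.le_sub_of_add_le_left hfin (hsum n)
  have := (ENNReal.continuous_rpow_const (y := (1 / 2 : ℝ))).continuousAt.tendsto.comp hd
  simpa [eLpNorm_two_eq, Function.comp_def] using this

/-! ### Mollification in L². -/

section Mollification

variable {F : Type*} [NormedAddCommGroup F] [NormedSpace ℝ F]

/-- A sequence of bump functions at the origin with radii tending to zero. -/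
def mollBump (n : ℕ) : ContDiffBump (0 : R3) where
  rIn := 1 / (n + 1)
  rOut := 2 / (n + 1)
  rIn_pos := by positivity
  rIn_lt_rOut := by gcongr; norm_num

/-- The convolution of `f` with the normalised bump function. -/
def mollify (n : ℕ) (f : R3 → F) : R3 → F :=
  (mollBump n).normed volume ⋆[ContinuousLinearMap.lsmul ℝ ℝ, volume] f

theorem mollify_apply (n : ℕ) (f : R3 → F) (x : R3) :
    mollify n f x = ∫ t, (mollBump n).normed volume (x - t) • f t := by
  simp [mollify, convolution_eq_swap]

theorem contDiff_mollify (n : ℕ) {f : R3 → F} (hf : LocallyIntegrable f volume) :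
    ContDiff ℝ ∞ (mollify n f) :=
  (mollBump n).hasCompactSupport_normed.contDiff_convolution_left _
    (mollBump n).contDiff_normed hf

theorem ae_tendsto_mollify [CompleteSpace F] {f : R3 → F} (hf : LocallyIntegrable f volume) :
    ∀ᵐ x, Tendsto (fun n => mollify n f x) atTop (𝓝 (f x)) := by
  -- The ratio of outer to inner radius is constantly 2, as the Lebesgue differentiation argument
  -- requires.
  refine ContDiffBump.ae_convolution_tendsto_right_of_locallyIntegrable (K := 2) ?_ ?_ hf
  · have := tendsto_one_div_add_atTop_nhds_zero_nat (𝕜 := ℝ)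
    have := this.const_mul 2
    simpa [mollBump, div_eq_mul_inv] using this
  · refine Eventually.of_forall fun n => le_of_eq ?_
    simp [mollBump, div_eq_mul_inv]

/-- The classical derivative falls on the kernel. Since `t ↦ ρ (x - t)` is a test function with the
opposite derivative in t, the definition of the weak derivative moves it onto `f`. -/
theorem fderiv_mollify (n : ℕ) {k : Fin 3} {f g : R3 → F} (h : HasWeakPartial k f g) (x : R3) :
    fderiv ℝ (mollify n f) x (EuclideanSpace.single k 1) = mollify n g x := by
  set ρ := (mollBump n).normed (volume : Measure R3) with hρ
  have hρs : ContDiff ℝ ∞ ρ := (mollBump n).contDiff_normed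
  have hρc : HasCompactSupport ρ := (mollBump n).hasCompactSupport_normed
  have hd := hρc.hasFDerivAt_convolution_left (ContinuousLinearMap.lsmul ℝ ℝ)
    (hρs.of_le (by simp)) h.1 x
  rw [mollify, hd.fderiv, convolution_eq_swap]
  have hdc : HasCompactSupport (fderiv ℝ ρ) := hρc.fderiv ℝ
  have hcont : Continuous (fderiv ℝ ρ) := hρs.continuous_fderiv (by simp)
  have hcint : Integrable (fun t => ((ContinuousLinearMap.lsmul ℝ ℝ : ℝ →L[ℝ] F →L[ℝ] F).precompL R3
      (fderiv ℝ ρ (x - t))) (f t)) volume := by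
    have := (hdc.convolutionExists_left
      ((ContinuousLinearMap.lsmul ℝ ℝ : ℝ →L[ℝ] F →L[ℝ] F).precompL R3) hcont h.1) x
    exact (convolutionExistsAt_iff_integrable_swap).1 this
  rw [ContinuousLinearMap.integral_apply hcint]
  simp only [ContinuousLinearMap.precompL_apply, ContinuousLinearMap.lsmul_apply]
  have hφ : ContDiff ℝ ∞ fun t => ρ (x - t) := hρs.comp (contDiff_const.sub contDiff_id)
  have hφc : HasCompactSupport fun t => ρ (x - t) :=
    hρc.comp_homeomorph (Homeomorph.subLeft x)
  have key := h.2.2 _ hφ hφc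
  have hfd : ∀ t, fderiv ℝ (fun t => ρ (x - t)) t (EuclideanSpace.single k 1)
      = - fderiv ℝ ρ (x - t) (EuclideanSpace.single k 1) := fun t => by
    have h1 : HasFDerivAt (fun t : R3 => x - t) (-ContinuousLinearMap.id ℝ R3) t :=
      (hasFDerivAt_id t).const_sub x
    have h2 := ((hρs.differentiable (by simp) (x - t)).hasFDerivAt).comp t h1
    rw [show (fun t => ρ (x - t)) = ρ ∘ fun t => x - t from rfl, h2.fderiv]
    simp
  simp only [hfd, neg_smul, integral_neg, neg_inj] at key
  rw [mollify_apply]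
  exact key

/-- Young's inequality for a kernel of unit mass: Cauchy–Schwarz against the probability density `ρ
(x - t)`, then Tonelli. -/
theorem eLpNorm_mollify_le (n : ℕ) {f : R3 → F} (hf : AEStronglyMeasurable f volume) :
    eLpNorm (mollify n f) 2 volume ≤ eLpNorm f 2 volume := by
  set ρ := (mollBump n).normed (volume : Measure R3) with hρ
  have hρcont : Continuous ρ := (mollBump n).continuous_normed
  have hmass : ∫⁻ t, ‖ρ t‖ₑ = 1 := by
    rw [← ofReal_integral_norm_eq_lintegral_enorm (mollBump n).integrable_normed]
    have : ∀ t, ‖(mollBump n).normed volume t‖ = (mollBump n).normed volume t := fun t =>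
      Real.norm_of_nonneg ((mollBump n).nonneg_normed t)
    simp only [this]
    rw [(mollBump n).integral_normed, ENNReal.ofReal_one]
  have hpt : ∀ x, ‖mollify n f x‖ₑ ^ 2 ≤ ∫⁻ t, ‖ρ (x - t)‖ₑ * ‖f t‖ₑ ^ 2 := fun x => by
    have hm : ∫⁻ t, ‖ρ (x - t)‖ₑ = 1 := by
      rw [lintegral_sub_left_eq_self (fun t => ‖ρ t‖ₑ) x, hmass]
    have mρ : AEMeasurable (fun t => ‖ρ (x - t)‖ₑ) volume :=
      (hρcont.comp (continuous_const.sub continuous_id)).enorm.measurable.aemeasurable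
    -- The kernel is split into two square roots; in Cauchy–Schwarz one of them integrates to the
    -- unit mass.
    have h1 : ‖mollify n f x‖ₑ ≤ ∫⁻ t, ‖ρ (x - t)‖ₑ ^ (1 / 2 : ℝ) *
        (‖ρ (x - t)‖ₑ ^ (1 / 2 : ℝ) * ‖f t‖ₑ) := by
      rw [mollify_apply]
      refine (enorm_integral_le_lintegral_enorm _).trans (le_of_eq (lintegral_congr fun t => ?_))
      rw [enorm_smul, ← mul_assoc, ← ENNReal.rpow_add_of_nonneg _ _ (by norm_num) (by norm_num)]
      norm_num [hρ]
    have h2 := ENNReal.lintegral_mul_le_Lp_mul_Lq volume Real.HolderConjugate.two_two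
      (mρ.pow_const (1 / 2 : ℝ)) ((mρ.pow_const (1 / 2 : ℝ)).mul hf.enorm)
    have h3 := h1.trans h2
    have e1 : ∀ t, (‖ρ (x - t)‖ₑ ^ (1 / 2 : ℝ)) ^ (2 : ℝ) = ‖ρ (x - t)‖ₑ := fun t => by
      rw [← ENNReal.rpow_mul]; norm_num
    simp only [Pi.mul_apply, ENNReal.mul_rpow_of_nonneg _ _ (by norm_num : (0 : ℝ) ≤ 2), e1, hm,
      ENNReal.one_rpow, one_mul] at h3
    calc ‖mollify n f x‖ₑ ^ 2 ≤ ((∫⁻ t, ‖ρ (x - t)‖ₑ * ‖f t‖ₑ ^ (2 : ℝ)) ^ (1 / 2 : ℝ)) ^ 2 := by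
          gcongr
      _ = ∫⁻ t, ‖ρ (x - t)‖ₑ * ‖f t‖ₑ ^ 2 := by
          rw [← ENNReal.rpow_natCast, ← ENNReal.rpow_mul]; norm_num
  rw [eLpNorm_two_eq, eLpNorm_two_eq]
  refine ENNReal.rpow_le_rpow ?_ (by norm_num)
  calc ∫⁻ x, ‖mollify n f x‖ₑ ^ 2 ≤ ∫⁻ x, ∫⁻ t, ‖ρ (x - t)‖ₑ * ‖f t‖ₑ ^ 2 := lintegral_mono hpt
    _ = ∫⁻ t, ∫⁻ x, ‖ρ (x - t)‖ₑ * ‖f t‖ₑ ^ 2 := by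
        refine lintegral_lintegral_swap ?_
        have m1 : AEMeasurable (fun z : R3 × R3 => ‖ρ (z.1 - z.2)‖ₑ) (volume.prod volume) :=
          (hρcont.comp (continuous_fst.sub continuous_snd)).enorm.measurable.aemeasurable
        have m2 : AEMeasurable (fun z : R3 × R3 => ‖f z.2‖ₑ ^ 2) (volume.prod volume) :=
          hf.comp_snd.enorm.pow_const 2
        exact m1.mul m2
    _ = ∫⁻ t, ‖f t‖ₑ ^ 2 := by
        refine lintegral_congr fun t => ?_
        have m : Measurable fun x => ‖ρ (x - t)‖ₑ :=
          (hρcont.comp (continuous_id.sub continuous_const)).enorm.measurable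
        rw [lintegral_mul_const _ m, lintegral_sub_right_eq_self (fun x => ‖ρ x‖ₑ) t, hmass, one_mul]

theorem memLp_mollify (n : ℕ) {f : R3 → F} (hf : MemLp f 2 volume) :
    MemLp (mollify n f) 2 volume :=
  ⟨(contDiff_mollify n (hf.locallyIntegrable (by norm_num))).continuous.aestronglyMeasurable,
    (eLpNorm_mollify_le n hf.1).trans_lt hf.2⟩

theorem tendsto_mollify [CompleteSpace F] {f : R3 → F} (hf : MemLp f 2 volume) :
    Tendsto (fun n => eLpNorm (mollify n f - f) 2 volume) atTop (𝓝 0) :=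
  tendsto_eLpNorm_two_of_ae (fun n => (memLp_mollify n hf).1) hf
    (ae_tendsto_mollify (hf.locallyIntegrable (by norm_num)))
    fun n => eLpNorm_mollify_le n hf.1

end Mollification

/-! ### Smooth compactly supported functions in H¹ and the Sobolev inequality. -/

section Density

variable {F : Type*} [NormedAddCommGroup F] [NormedSpace ℝ F]

/-- The bump function equal to one on the unit ball and supported in the ball of radius two. -/
def unitBump : ContDiffBump (0 : R3) where
  rIn := 1
  rOut := 2
  rIn_pos := one_pos
  rIn_lt_rOut := one_lt_two

/-- Smooth cut-off functions exhausting `ℝ³`. -/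
def cutoff (n : ℕ) (x : R3) : ℝ := unitBump ((n + 1 : ℝ)⁻¹ • x)

theorem contDiff_cutoff (n : ℕ) : ContDiff ℝ ∞ (cutoff n) :=
  unitBump.contDiff.comp (contDiff_const_smul _)

theorem hasCompactSupport_cutoff (n : ℕ) : HasCompactSupport (cutoff n) :=
  unitBump.hasCompactSupport.comp_smul (by positivity)

theorem cutoff_nonneg (n : ℕ) (x : R3) : 0 ≤ cutoff n x := unitBump.nonneg

theorem cutoff_le_one (n : ℕ) (x : R3) : cutoff n x ≤ 1 := unitBump.le_one

theorem tendsto_cutoff (x : R3) : Tendsto (fun n => cutoff n x) atTop (𝓝 1) := by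
  obtain ⟨N, hN⟩ := exists_nat_ge ‖x‖
  refine tendsto_const_nhds.congr' ?_
  filter_upwards [eventually_ge_atTop N] with n hn
  symm
  refine unitBump.one_of_mem_closedBall ?_
  rw [mem_closedBall_zero_iff, norm_smul, norm_inv, Real.norm_of_nonneg (by positivity)]
  change _ ≤ (1 : ℝ)
  rw [inv_mul_le_one₀ (by positivity)]
  have : (N : ℝ) ≤ n := by exact_mod_cast hn
  linarith

theorem exists_fderiv_cutoff_bound : ∃ B : ℝ, 0 ≤ B ∧ ∀ (n : ℕ) (x : R3) (k : Fin 3),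
    ‖fderiv ℝ (cutoff n) x (EuclideanSpace.single k 1)‖ ≤ B * (1 / (n + 1)) := by
  have hs : ContDiff ℝ ∞ (unitBump : R3 → ℝ) := unitBump.contDiff
  obtain ⟨B, hB⟩ := (unitBump.hasCompactSupport.fderiv ℝ).exists_bound_of_continuous
    (hs.continuous_fderiv (by simp))
  refine ⟨B, (norm_nonneg _).trans (hB 0), fun n x k => ?_⟩
  have : fderiv ℝ (cutoff n) x = (n + 1 : ℝ)⁻¹ • fderiv ℝ unitBump ((n + 1 : ℝ)⁻¹ • x) := by
    unfold cutoff
    rw [fderiv_comp_smul]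
  rw [this, smul_apply, norm_smul, norm_inv, Real.norm_of_nonneg (by positivity), mul_comm,
    one_div]
  gcongr
  calc ‖fderiv ℝ unitBump ((n + 1 : ℝ)⁻¹ • x) (EuclideanSpace.single k 1)‖
      ≤ ‖fderiv ℝ unitBump ((n + 1 : ℝ)⁻¹ • x)‖ * ‖(EuclideanSpace.single k 1 : R3)‖ :=
        ContinuousLinearMap.le_opNorm _ _
    _ ≤ B := by simpa using hB _

theorem tendsto_cutoff_smul {f : R3 → F} (hf : MemLp f 2 volume) :
    Tendsto (fun n => eLpNorm ((fun x => cutoff n x • f x) - f) 2 volume) atTop (𝓝 0) := by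
  refine tendsto_eLpNorm_two_of_ae (fun n => ?_) hf ?_ fun n => ?_
  · exact (contDiff_cutoff n).continuous.aestronglyMeasurable.smul hf.1
  · refine Eventually.of_forall fun x => ?_
    simpa using (tendsto_cutoff x).smul_const (f x)
  · refine eLpNorm_mono fun x => ?_
    rw [norm_smul, Real.norm_of_nonneg (cutoff_nonneg n x)]
    exact mul_le_of_le_one_left (norm_nonneg _) (cutoff_le_one n x)

/-- A smooth function in `H¹` is approximated by its products with cut-off functions. -/
theorem tendsto_fderiv_cutoff_smul {f : R3 → F} (hs : ContDiff ℝ ∞ f) (hf : MemLp f 2 volume)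
    (k : Fin 3)
    (hk : MemLp (fun x => fderiv ℝ f x (EuclideanSpace.single k 1)) 2 volume) :
    Tendsto (fun n => eLpNorm ((fun x => fderiv ℝ (fun y => cutoff n y • f y) x
      (EuclideanSpace.single k 1)) - fun x => fderiv ℝ f x (EuclideanSpace.single k 1)) 2 volume)
      atTop (𝓝 0) := by
  obtain ⟨B, hB0, hB⟩ := exists_fderiv_cutoff_bound
  have h1 := tendsto_cutoff_smul hk
  -- A bound for the Leibniz error: the n-th cut-off varies on the length scale n + 1, so its
  -- derivative is of order 1/(n + 1).
  have h2 : Tendsto (fun n : ℕ => ENNReal.ofReal (B * (1 / ((n : ℝ) + 1))) * eLpNorm f 2 volume)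
      atTop (𝓝 0) := by
    have := (tendsto_one_div_add_atTop_nhds_zero_nat (𝕜 := ℝ)).const_mul B
    rw [mul_zero] at this
    have := ENNReal.Tendsto.mul_const (ENNReal.tendsto_ofReal this)
      (Or.inr hf.2.ne : (ENNReal.ofReal 0 ≠ 0 ∨ eLpNorm f 2 volume ≠ ⊤))
    simpa using this
  have h3 := h1.add h2
  rw [add_zero] at h3
  refine tendsto_of_tendsto_of_tendsto_of_le_of_le tendsto_const_nhds h3 (fun _ => zero_le) ?_
  intro n
  have hcd := contDiff_cutoff n
  have m1 : AEStronglyMeasurable ((fun x => cutoff n x •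
      fderiv ℝ f x (EuclideanSpace.single k 1)) -
      fun x => fderiv ℝ f x (EuclideanSpace.single k 1)) volume :=
    (hcd.continuous.aestronglyMeasurable.smul hk.1).sub hk.1
  have m2 : AEStronglyMeasurable (fun x => fderiv ℝ (cutoff n) x (EuclideanSpace.single k 1)
      • f x) volume :=
    (continuous_fderiv_apply_of_contDiff (hcd.of_le (by simp)) _).aestronglyMeasurable.smul hf.1
  have heq : ((fun x => fderiv ℝ (fun y => cutoff n y • f y) x
      (EuclideanSpace.single k 1)) - fun x => fderiv ℝ f x (EuclideanSpace.single k 1))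
      = ((fun x => cutoff n x • fderiv ℝ f x (EuclideanSpace.single k 1)) -
        fun x => fderiv ℝ f x (EuclideanSpace.single k 1)) +
        fun x => fderiv ℝ (cutoff n) x (EuclideanSpace.single k 1) • f x := by
    funext x
    have := fderiv_fun_smul (hcd.differentiable (by simp) x) (hs.differentiable (by simp) x)
    simp only [Pi.sub_apply, Pi.add_apply, this, add_apply, smul_apply,
      ContinuousLinearMap.smulRight_apply]
    abel
  dsimp only
  rw [heq]
  refine (eLpNorm_add_le m1 m2 (by norm_num)).trans ?_
  gcongr
  refine (eLpNorm_le_mul_eLpNorm_of_ae_le_mul (Eventually.of_forall fun x => ?_) 2)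
  rw [norm_smul]
  gcongr
  exact hB n x k

/-- Smooth compactly supported functions are dense in `H¹`. -/
theorem exists_smooth_near [CompleteSpace F] {f : R3 → F} {g : Fin 3 → R3 → F}
    (hf : MemLp f 2 volume) (hg : ∀ k, HasWeakPartial k f (g k))
    (hgL : ∀ k, MemLp (g k) 2 volume) {ε : ℝ≥0∞} (hε : 0 < ε) :
    ∃ u : R3 → F, ContDiff ℝ ∞ u ∧ HasCompactSupport u ∧ eLpNorm (u - f) 2 volume < ε ∧
      ∀ k, eLpNorm ((fun x => fderiv ℝ u x (EuclideanSpace.single k 1)) - g k) 2 volume < ε := by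
  have hε2 : 0 < ε / 2 := ENNReal.half_pos hε.ne'
  obtain ⟨n, hn, hnk⟩ : ∃ n, eLpNorm (mollify n f - f) 2 volume < ε / 2 ∧
      ∀ k, eLpNorm (mollify n (g k) - g k) 2 volume < ε / 2 := by
    have h1 := (tendsto_mollify hf).eventually (gt_mem_nhds hε2)
    have h2 : ∀ᶠ n in atTop, ∀ k, eLpNorm (mollify n (g k) - g k) 2 volume < ε / 2 :=
      eventually_all.2 fun k => (tendsto_mollify (hgL k)).eventually (gt_mem_nhds hε2)
    exact (h1.and h2).exists
  set w := mollify n f with hw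
  have hws : ContDiff ℝ ∞ w := contDiff_mollify n (hg 0).1
  have hwL : MemLp w 2 volume := memLp_mollify n hf
  have hwd : ∀ k, (fun x => fderiv ℝ w x (EuclideanSpace.single k 1)) = mollify n (g k) :=
    fun k => funext fun x => fderiv_mollify n (hg k) x
  have hwdL : ∀ k, MemLp (fun x => fderiv ℝ w x (EuclideanSpace.single k 1)) 2 volume :=
    fun k => by rw [hwd k]; exact memLp_mollify n (hgL k)
  obtain ⟨N, hN, hNk⟩ : ∃ N, eLpNorm ((fun x => cutoff N x • w x) - w) 2 volume < ε / 2 ∧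
      ∀ k, eLpNorm ((fun x => fderiv ℝ (fun y => cutoff N y • w y) x
        (EuclideanSpace.single k 1)) - fun x => fderiv ℝ w x (EuclideanSpace.single k 1)) 2 volume
        < ε / 2 := by
    have h1 := (tendsto_cutoff_smul hwL).eventually (gt_mem_nhds hε2)
    have h2 := eventually_all.2 fun k =>
      (tendsto_fderiv_cutoff_smul hws hwL k (hwdL k)).eventually (gt_mem_nhds hε2)
    exact (h1.and h2).exists
  have hus : ContDiff ℝ ∞ fun x => cutoff N x • w x := (contDiff_cutoff N).smul hws
  have tri : ∀ a b c : R3 → F, AEStronglyMeasurable a volume → AEStronglyMeasurable b volume →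
      AEStronglyMeasurable c volume → eLpNorm (a - b) 2 volume < ε / 2 →
      eLpNorm (b - c) 2 volume < ε / 2 → eLpNorm (a - c) 2 volume < ε := by
    intro a b c ha hb hc h1 h2
    rw [← sub_add_sub_cancel a b c, ← ENNReal.add_halves ε]
    exact (eLpNorm_add_le (ha.sub hb) (hb.sub hc) (by norm_num)).trans_lt
      (ENNReal.add_lt_add h1 h2)
  refine ⟨fun x => cutoff N x • w x, hus, (hasCompactSupport_cutoff N).smul_right,
    tri _ w _ hus.continuous.aestronglyMeasurable hwL.1 hf.1 hN hn, fun k => ?_⟩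
  refine tri _ _ _ ?_ (hwdL k).1 (hgL k).1 (hNk k) ?_
  · exact (continuous_fderiv_apply_of_contDiff (hus.of_le (by simp)) _).aestronglyMeasurable
  · rw [hwd k]; exact hnk k

theorem exists_smooth_seq [CompleteSpace F] {f : R3 → F} {g : Fin 3 → R3 → F}
    (hf : MemLp f 2 volume) (hg : ∀ k, HasWeakPartial k f (g k))
    (hgL : ∀ k, MemLp (g k) 2 volume) :
    ∃ u : ℕ → R3 → F, (∀ n, ContDiff ℝ ∞ (u n)) ∧ (∀ n, HasCompactSupport (u n)) ∧
      Tendsto (fun n => eLpNorm (u n - f) 2 volume) atTop (𝓝 0) ∧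
      ∀ k, Tendsto (fun n => eLpNorm ((fun x => fderiv ℝ (u n) x (EuclideanSpace.single k 1))
        - g k) 2 volume) atTop (𝓝 0) := by
  have h0 : ∀ n : ℕ, (0 : ℝ≥0∞) < (n + 1 : ℝ≥0∞)⁻¹ := fun n => by
    rw [ENNReal.inv_pos]; finiteness
  choose u hu1 hu2 hu3 hu4 using fun n => exists_smooth_near hf hg hgL (h0 n)
  have hlim : Tendsto (fun n : ℕ => (n + 1 : ℝ≥0∞)⁻¹) atTop (𝓝 0) := by
    have := ENNReal.tendsto_inv_nat_nhds_zero.comp (tendsto_add_atTop_nat 1)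
    simpa [Function.comp_def] using this
  exact ⟨u, hu1, hu2,
    tendsto_of_tendsto_of_tendsto_of_le_of_le tendsto_const_nhds hlim (fun _ => zero_le)
      fun n => (hu3 n).le,
    fun k => tendsto_of_tendsto_of_tendsto_of_le_of_le tendsto_const_nhds hlim
      (fun _ => zero_le) fun n => (hu4 n k).le⟩

theorem norm_clm_le_sum (L : R3 →L[ℝ] F) :
    ‖L‖ ≤ ∑ k, ‖L (EuclideanSpace.single k 1)‖ := by
  refine L.opNorm_le_bound (Finset.sum_nonneg fun _ _ => norm_nonneg _) fun x => ?_
  have hx : x = ∑ k, x k • (EuclideanSpace.single k 1 : R3) := by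
    ext i; simp [Finset.sum_apply, Pi.single_apply]
  calc ‖L x‖ = ‖∑ k, x k • L (EuclideanSpace.single k 1)‖ := by
        conv_lhs => rw [hx]
        simp only [map_sum, map_smul]
    _ ≤ ∑ k, ‖x k • L (EuclideanSpace.single k 1)‖ := norm_sum_le _ _
    _ ≤ ∑ k, ‖L (EuclideanSpace.single k 1)‖ * ‖x‖ := by
        refine Finset.sum_le_sum fun k _ => ?_
        rw [norm_smul, mul_comm]
        gcongr
        exact PiLp.norm_apply_le x k
    _ = _ := by rw [Finset.sum_mul]

/-- The Sobolev inequality for smooth compactly supported functions, with partial derivatives. -/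
theorem exists_sobolev_smooth (F : Type*) [NormedAddCommGroup F] [NormedSpace ℝ F]
    [FiniteDimensional ℝ F] : ∃ K : NNReal, ∀ u : R3 → F, ContDiff ℝ ∞ u → HasCompactSupport u →
      eLpNorm u 6 volume ≤ K * ∑ k, eLpNorm (fun x => fderiv ℝ u x (EuclideanSpace.single k 1)) 2
        volume := by
  refine ⟨_, fun u hu hc => (eLpNorm_le_eLpNorm_fderiv_of_eq (p := 2) (p' := 6) volume
    (hu.of_le (by simp)) hc (by norm_num) (by simp) (by norm_num)).trans
    (mul_le_mul_right ?_ _)⟩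
  have m : ∀ k, AEStronglyMeasurable (fun x => ‖fderiv ℝ u x (EuclideanSpace.single k 1)‖)
      volume := fun k => (continuous_fderiv_apply_of_contDiff (hu.of_le (by simp))
        _).norm.aestronglyMeasurable
  calc eLpNorm (fderiv ℝ u) 2 volume
      ≤ eLpNorm (∑ k, fun x => ‖fderiv ℝ u x (EuclideanSpace.single k 1)‖) 2 volume := by
        refine eLpNorm_mono_real fun x => ?_
        rw [Finset.sum_apply]
        exact norm_clm_le_sum _
    _ ≤ ∑ k, eLpNorm (fun x => ‖fderiv ℝ u x (EuclideanSpace.single k 1)‖) 2 volume :=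
        eLpNorm_sum_le (fun k _ => m k) (by norm_num)
    _ = _ := by simp only [eLpNorm_norm]

/-- The Sobolev inequality on `H¹`. -/
theorem exists_sobolev_H1 (F : Type*) [NormedAddCommGroup F] [NormedSpace ℝ F]
    [FiniteDimensional ℝ F] : ∃ K : NNReal, ∀ (f : R3 → F) (g : Fin 3 → R3 → F),
      MemLp f 2 volume → (∀ k, HasWeakPartial k f (g k)) → (∀ k, MemLp (g k) 2 volume) →
      eLpNorm f 6 volume ≤ K * ∑ k, eLpNorm (g k) 2 volume := by
  have : CompleteSpace F := FiniteDimensional.complete ℝ F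
  obtain ⟨K, hK⟩ := exists_sobolev_smooth F
  refine ⟨K, fun f g hf hg hgL => ?_⟩
  obtain ⟨u, hus, huc, hu, huk⟩ := exists_smooth_seq hf hg hgL
  have hm : ∀ n, AEStronglyMeasurable (u n) volume :=
    fun n => (hus n).continuous.aestronglyMeasurable
  -- L² convergence gives a subsequence converging almost everywhere, along which the L⁶ norm is
  -- lower semicontinuous.
  obtain ⟨ns, hns, hae⟩ := (tendstoInMeasure_of_tendsto_eLpNorm (by norm_num) hm hf.1
    hu).exists_seq_tendsto_ae
  refine (Lp.eLpNorm_lim_le_liminf_eLpNorm (fun n => hm (ns n)) f hae).trans ?_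
  have hlim : Tendsto (fun n => K * ∑ k, (eLpNorm ((fun x => fderiv ℝ (u (ns n)) x
      (EuclideanSpace.single k 1)) - g k) 2 volume + eLpNorm (g k) 2 volume)) atTop
      (𝓝 (K * ∑ k, (0 + eLpNorm (g k) 2 volume))) := by
    refine ENNReal.Tendsto.const_mul ?_ (Or.inr (by simp))
    exact tendsto_finsetSum _ fun k _ => ((huk k).comp hns.tendsto_atTop).add_const _
  simp only [zero_add] at hlim
  rw [← hlim.liminf_eq]
  refine liminf_le_liminf (Eventually.of_forall fun n => (hK _ (hus _) (huc _)).trans ?_)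
  gcongr with k
  have md := (continuous_fderiv_apply_of_contDiff ((hus (ns n)).of_le (by simp))
    (EuclideanSpace.single k 1)).aestronglyMeasurable (μ := volume)
  calc eLpNorm (fun x => fderiv ℝ (u (ns n)) x (EuclideanSpace.single k 1)) 2 volume
      = eLpNorm (((fun x => fderiv ℝ (u (ns n)) x (EuclideanSpace.single k 1)) - g k) + g k) 2
        volume := by rw [sub_add_cancel]
    _ ≤ _ := eLpNorm_add_le (md.sub (hgL k).1) (hgL k).1 (by norm_num)

end Density

/-! ### Bounded truncations of the real line that vanish near zero. -/

section Truncation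

/-- A smooth function vanishing on `[-1, 1]` and equal to the identity away from it. -/
def shrink (s : ℝ) : ℝ := s * Real.smoothTransition (s ^ 2 - 1)

theorem contDiff_shrink : ContDiff ℝ ∞ shrink :=
  contDiff_id.mul (Real.smoothTransition.contDiff.comp ((contDiff_id.pow 2).sub contDiff_const))

theorem shrink_eq_zero {s : ℝ} (hs : s ^ 2 ≤ 1) : shrink s = 0 := by
  rw [shrink, Real.smoothTransition.zero_of_nonpos (by linarith), mul_zero]

theorem shrink_eq_self {s : ℝ} (hs : 2 ≤ s ^ 2) : shrink s = s := by
  rw [shrink, Real.smoothTransition.one_of_one_le (by linarith), mul_one]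

theorem abs_shrink_le (s : ℝ) : |shrink s| ≤ |s| := by
  rw [shrink, abs_mul, abs_of_nonneg (Real.smoothTransition.nonneg _)]
  exact mul_le_of_le_one_right (abs_nonneg _) (Real.smoothTransition.le_one _)

theorem deriv_shrink_eq_one {s : ℝ} (hs : 2 < s ^ 2) : deriv shrink s = 1 := by
  have : shrink =ᶠ[𝓝 s] id := by
    have : ∀ᶠ t in 𝓝 s, 2 < t ^ 2 :=
      (continuous_id.pow 2).continuousAt.eventually (lt_mem_nhds hs)
    exact this.mono fun t ht => shrink_eq_self ht.le
  rw [this.deriv_eq, deriv_id]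

theorem exists_deriv_shrink_bound : ∃ L : ℝ, 0 ≤ L ∧ ∀ s, |deriv shrink s| ≤ L := by
  have hc : Continuous (deriv shrink) := contDiff_shrink.continuous_deriv (by simp)
  obtain ⟨L, hL⟩ := isCompact_Icc.exists_bound_of_continuousOn (s := Set.Icc (-2 : ℝ) 2)
    hc.continuousOn
  refine ⟨max L 1, by positivity, fun s => ?_⟩
  by_cases h : 2 < s ^ 2
  · rw [deriv_shrink_eq_one h, abs_one]; exact le_max_right _ _
  · exact (hL s ⟨by nlinarith, by nlinarith⟩).trans (le_max_left _ _)

/-- Smooth truncations of the identity at small and at large values. -/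
def trunc (n : ℕ) (s : ℝ) : ℝ :=
  (n + 1 : ℝ)⁻¹ * shrink ((n + 1) ^ 2 * Real.arctan (s / (n + 1)))

theorem contDiff_trunc (n : ℕ) : ContDiff ℝ 1 (trunc n) := by
  refine contDiff_const.mul ((contDiff_shrink.of_le (by simp)).comp
    (contDiff_const.mul (Real.contDiff_arctan.comp (contDiff_id.div_const _))))

/-- The three scales (n+1)⁻¹, (n+1)² and (n+1)⁻¹ cancel, so the derivative of `trunc n` is bounded
independently of n. This is what allows dominated convergence later. -/
theorem deriv_trunc (n : ℕ) (s : ℝ) :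
    deriv (trunc n) s = deriv shrink ((n + 1) ^ 2 * Real.arctan (s / (n + 1)))
      * (1 / (1 + (s / (n + 1)) ^ 2)) := by
  have h0 : (n + 1 : ℝ) ≠ 0 := by positivity
  have h1 : HasDerivAt (fun s : ℝ => s / (n + 1)) (1 / (n + 1)) s := (hasDerivAt_id s).div_const _
  have h2 := (h1.arctan).const_mul ((n + 1 : ℝ) ^ 2)
  have h3 := ((contDiff_shrink.differentiable (by simp)
    ((n + 1) ^ 2 * Real.arctan (s / (n + 1)))).hasDerivAt.comp s h2).const_mul (n + 1 : ℝ)⁻¹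
  refine (h3.deriv).trans ?_
  field_simp

theorem abs_deriv_trunc_le {L : ℝ} (hL : ∀ s, |deriv shrink s| ≤ L) (n : ℕ) (s : ℝ) :
    |deriv (trunc n) s| ≤ L := by
  rw [deriv_trunc, abs_mul]
  refine (mul_le_of_le_one_right (abs_nonneg _) ?_).trans (hL _)
  rw [abs_of_nonneg (by positivity), div_le_one (by positivity)]
  nlinarith [sq_nonneg (s / (n + 1))]

theorem abs_arctan_le (x : ℝ) : |Real.arctan x| ≤ |x| := by
  have := Convex.norm_image_sub_le_of_norm_deriv_le (f := Real.arctan) (C := 1) (s := Set.univ)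
    (x := 0) (y := x) (fun _ _ => Real.differentiable_arctan _) (fun y _ => ?_) convex_univ
    trivial trivial
  · simpa using this
  · rw [Real.deriv_arctan, Real.norm_of_nonneg (by positivity), div_le_one (by positivity)]
    nlinarith [sq_nonneg y]

theorem abs_trunc_le_self (n : ℕ) (s : ℝ) : |trunc n s| ≤ |s| := by
  have h0 : (0 : ℝ) < n + 1 := by positivity
  rw [trunc, abs_mul, abs_of_pos (inv_pos.2 h0)]
  calc (n + 1 : ℝ)⁻¹ * |shrink ((n + 1) ^ 2 * Real.arctan (s / (n + 1)))|
      ≤ (n + 1 : ℝ)⁻¹ * ((n + 1) ^ 2 * |s / (n + 1)|) := by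
        gcongr
        refine (abs_shrink_le _).trans ?_
        rw [abs_mul, abs_of_pos (by positivity : (0 : ℝ) < (n + 1) ^ 2)]
        exact mul_le_mul_of_nonneg_left (abs_arctan_le _) (by positivity)
    _ = |s| := by
        rw [abs_div, abs_of_pos h0]; field_simp

/-- Boundedness comes from the arctangent. It is required by the chain rule and, together with the
vanishing near zero, puts the truncation of a D¹ function into L². -/
theorem abs_trunc_le (n : ℕ) (s : ℝ) : |trunc n s| ≤ (n + 1) * (Real.pi / 2) := by
  have h0 : (0 : ℝ) < n + 1 := by positivity
  rw [trunc, abs_mul, abs_of_pos (inv_pos.2 h0)]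
  calc (n + 1 : ℝ)⁻¹ * |shrink ((n + 1) ^ 2 * Real.arctan (s / (n + 1)))|
      ≤ (n + 1 : ℝ)⁻¹ * ((n + 1) ^ 2 * (Real.pi / 2)) := by
        gcongr
        refine (abs_shrink_le _).trans ?_
        rw [abs_mul, abs_of_pos (by positivity : (0 : ℝ) < (n + 1) ^ 2)]
        gcongr
        exact abs_le.2 ⟨(Real.neg_pi_div_two_lt_arctan _).le, (Real.arctan_lt_pi_div_two _).le⟩
    _ = _ := by field_simp

theorem trunc_eq_zero (n : ℕ) {s : ℝ} (hs : |s| ≤ (n + 1 : ℝ)⁻¹) : trunc n s = 0 := by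
  have h0 : (0 : ℝ) < n + 1 := by positivity
  rw [trunc, shrink_eq_zero, mul_zero]
  rw [sq_le_one_iff_abs_le_one, abs_mul, abs_of_pos (by positivity : (0 : ℝ) < (n + 1) ^ 2)]
  calc (n + 1 : ℝ) ^ 2 * |Real.arctan (s / (n + 1))| ≤ (n + 1 : ℝ) ^ 2 * |s / (n + 1)| := by
        exact mul_le_mul_of_nonneg_left (abs_arctan_le _) (by positivity)
    _ = (n + 1) * |s| := by rw [abs_div, abs_of_pos h0]; field_simp
    _ ≤ (n + 1) * (n + 1 : ℝ)⁻¹ := by gcongr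
    _ = 1 := by field_simp

theorem tendsto_mul_arctan (s : ℝ) :
    Tendsto (fun n : ℕ => (n + 1 : ℝ) * Real.arctan (s / (n + 1))) atTop (𝓝 s) := by
  have h := (Real.hasDerivAt_arctan 0).hasFDerivAt.lim s
    (c := fun n : ℕ => (n + 1 : ℝ)) (l := atTop) ?_
  · simpa [div_eq_inv_mul] using h
  · exact tendsto_norm_atTop_atTop.comp
      (tendsto_atTop_add_const_right _ _ tendsto_natCast_atTop_atTop)

/-- The argument passed to `shrink` grows like (n+1)s, so at each nonzero s it eventually lies where
`shrink` is the identity. -/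
theorem eventually_two_lt_sq {s : ℝ} (hs : s ≠ 0) :
    ∀ᶠ n : ℕ in atTop, 2 < ((n + 1 : ℝ) ^ 2 * Real.arctan (s / (n + 1))) ^ 2 := by
  have h1 : Tendsto (fun n : ℕ => |(n + 1 : ℝ) * Real.arctan (s / (n + 1))|) atTop (𝓝 |s|) :=
    (tendsto_mul_arctan s).abs
  have h2 : Tendsto (fun n : ℕ => (n + 1 : ℝ)) atTop atTop :=
    tendsto_atTop_add_const_right _ _ tendsto_natCast_atTop_atTop
  have h3 := h2.atTop_mul_pos (abs_pos.2 hs) h1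
  filter_upwards [h3.eventually_gt_atTop 2] with n hn
  have : |(n + 1 : ℝ) ^ 2 * Real.arctan (s / (n + 1))|
      = (n + 1) * |(n + 1 : ℝ) * Real.arctan (s / (n + 1))| := by
    rw [abs_mul, abs_mul, abs_of_pos (by positivity : (0 : ℝ) < (n + 1) ^ 2),
      abs_of_pos (by positivity : (0 : ℝ) < n + 1)]
    ring
  rw [← sq_abs, this]
  nlinarith

theorem tendsto_trunc (s : ℝ) : Tendsto (fun n => trunc n s) atTop (𝓝 s) := by
  by_cases hs : s = 0
  · subst hs
    refine tendsto_const_nhds.congr fun n => ?_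
    rw [trunc_eq_zero n (by simp; positivity)]
  · refine (tendsto_mul_arctan s).congr' ?_
    filter_upwards [eventually_two_lt_sq hs] with n hn
    rw [trunc, shrink_eq_self hn.le]
    have : (n + 1 : ℝ) ≠ 0 := by positivity
    field_simp

/-- The point zero is a genuine exception: every `trunc n` is flat there. The limits below therefore
need the weak derivative to vanish on the zero set. -/
theorem tendsto_deriv_trunc {s : ℝ} (hs : s ≠ 0) :
    Tendsto (fun n => deriv (trunc n) s) atTop (𝓝 1) := by
  have h1 : Tendsto (fun n : ℕ => s / ((n : ℝ) + 1)) atTop (𝓝 0) := by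
    have := (tendsto_one_div_add_atTop_nhds_zero_nat (𝕜 := ℝ)).const_mul s
    simpa [div_eq_mul_inv] using this
  have h2 : Tendsto (fun n : ℕ => 1 / (1 + (s / ((n : ℝ) + 1)) ^ 2)) atTop (𝓝 1) := by
    have h3 := (h1.pow 2).const_add 1
    have := h3.inv₀ (by norm_num)
    simpa [one_div] using this
  refine h2.congr' ?_
  filter_upwards [eventually_two_lt_sq hs] with n hn
  rw [deriv_trunc, deriv_shrink_eq_one hn, one_mul]

end Truncation

/-! ### L² pairings and the chain rule for weak derivatives. -/

theorem enorm_integral_mul_le {f g : R3 → ℝ} (hf : AEStronglyMeasurable f volume)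
    (hg : AEStronglyMeasurable g volume) :
    ‖∫ x, f x * g x‖ₑ ≤ eLpNorm f 2 volume * eLpNorm g 2 volume := by
  calc ‖∫ x, f x * g x‖ₑ ≤ ∫⁻ x, ‖f x * g x‖ₑ := enorm_integral_le_lintegral_enorm _
    _ = eLpNorm (f • g) 1 volume := by rw [eLpNorm_one_eq_lintegral_enorm]; rfl
    _ ≤ _ := eLpNorm_smul_le_mul_eLpNorm hg hf

theorem integrable_mul_of_two {f g : R3 → ℝ} (hf : MemLp f 2 volume) (hg : MemLp g 2 volume) :
    Integrable (fun x => f x * g x) volume :=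
  hf.integrable_mul hg

theorem tendsto_integral_mul_of_tendsto_two {a : R3 → ℝ} (ha : MemLp a 2 volume)
    {u : ℕ → R3 → ℝ} (hu : ∀ n, MemLp (u n) 2 volume) {b : R3 → ℝ} (hb : MemLp b 2 volume)
    (h : Tendsto (fun n => eLpNorm (u n - b) 2 volume) atTop (𝓝 0)) :
    Tendsto (fun n => ∫ x, a x * u n x) atTop (𝓝 (∫ x, a x * b x)) := by
  rw [tendsto_iff_edist_tendsto_0]
  have h2 := ENNReal.Tendsto.const_mul h (Or.inr ha.2.ne : ((0 : ℝ≥0∞) ≠ 0 ∨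
    eLpNorm a 2 volume ≠ ⊤))
  rw [mul_zero] at h2
  refine tendsto_of_tendsto_of_tendsto_of_le_of_le tendsto_const_nhds h2 (fun _ => zero_le) ?_
  intro n
  dsimp only
  rw [edist_eq_enorm_sub, ← integral_sub (integrable_mul_of_two ha (hu n)) (integrable_mul_of_two ha hb)]
  simp only [← mul_sub]
  exact enorm_integral_mul_le ha.1 ((hu n).1.sub hb.1)

/-- The chain rule for weak derivatives in `L²`. -/
theorem HasWeakPartial.chain {k : Fin 3} {f g : R3 → ℝ} (h : HasWeakPartial k f g)
    (hg : MemLp g 2 volume) {G : ℝ → ℝ} (hG : ContDiff ℝ 1 G) {M L : ℝ}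
    (hM : ∀ s, |G s| ≤ M) (hL : ∀ s, |deriv G s| ≤ L) :
    HasWeakPartial k (fun x => G (f x)) (fun x => deriv G (f x) * g x) := by
  have hGd : Continuous (deriv G) := hG.continuous_deriv le_rfl
  have hfm : AEStronglyMeasurable f volume := h.1.aestronglyMeasurable
  have m1 : AEStronglyMeasurable (fun x => G (f x)) volume :=
    hG.continuous.comp_aestronglyMeasurable hfm
  have m2 : AEStronglyMeasurable (fun x => deriv G (f x)) volume :=
    hGd.comp_aestronglyMeasurable hfm
  have hL0 : 0 ≤ L := (abs_nonneg _).trans (hL 0)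
  have hprod : MemLp (fun x => deriv G (f x) * g x) 2 volume :=
    hg.of_le_mul (c := L) (m2.mul hg.1) (Eventually.of_forall fun x => by
      rw [norm_mul]; gcongr; exact hL _)
  refine ⟨?_, hprod.locallyIntegrable (by norm_num), fun φ hφ hc => ?_⟩
  · exact (memLp_top_of_bound m1 M (Eventually.of_forall fun x => hM _)).locallyIntegrable
      (by simp)
  have hus : ∀ n, ContDiff ℝ ∞ (mollify n f) := fun n => contDiff_mollify n h.1
  have hGu : ∀ n, ContDiff ℝ 1 fun x => G (mollify n f x) := fun n =>
    hG.comp ((hus n).of_le (by simp))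
  have hlim := ae_tendsto_mollify h.1
  have hφ1 : ContDiff ℝ 1 φ := hφ.of_le (by simp)
  have hDφ := continuous_fderiv_apply_of_contDiff hφ1 (EuclideanSpace.single k 1)
  have hφ2 : MemLp φ 2 volume := hφ.continuous.memLp_of_hasCompactSupport hc
  -- The identity is classical for the mollified function. In the limit the left side converges by
  -- dominated convergence with bound M. The right side is split so that `g` is fixed in one part
  -- (dominated convergence again) and the L² error of `mollify n g` controls the other.
  have key : ∀ n, ∫ x, fderiv ℝ φ x (EuclideanSpace.single k 1) * G (mollify n f x)
      = - ∫ x, φ x * deriv G (mollify n f x) * mollify n g x := fun n => by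
    have := (hasWeakPartial_of_contDiff (hGu n) k).2.2 φ hφ hc
    simp only [smul_eq_mul] at this
    rw [this]
    congr 1
    refine integral_congr_ae (Eventually.of_forall fun x => ?_)
    have hd := ((hG.differentiable one_ne_zero (mollify n f x)).hasDerivAt.comp_hasFDerivAt x
      ((hus n).differentiable (by simp) x).hasFDerivAt).fderiv
    have hd' : fderiv ℝ (fun x => G (mollify n f x)) x =
      deriv G (mollify n f x) • fderiv ℝ (mollify n f) x := hd
    simp only [hd', smul_apply, fderiv_mollify n h x, smul_eq_mul]
    ring
  have t1 : Tendsto (fun n => ∫ x, fderiv ℝ φ x (EuclideanSpace.single k 1) * G (mollify n f x))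
      atTop (𝓝 (∫ x, fderiv ℝ φ x (EuclideanSpace.single k 1) * G (f x))) := by
    refine tendsto_integral_of_dominated_convergence
      (fun x => ‖fderiv ℝ φ x (EuclideanSpace.single k 1)‖ * M) (fun n => ?_) ?_ (fun n => ?_) ?_
    · exact hDφ.aestronglyMeasurable.mul (hGu n).continuous.aestronglyMeasurable
    · exact (hDφ.integrable_of_hasCompactSupport (hc.fderiv_apply (𝕜 := ℝ) _)).norm.mul_const M
    · refine Eventually.of_forall fun x => ?_
      rw [norm_mul]; gcongr; exact hM _
    · filter_upwards [hlim] with x hx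
      exact ((hG.continuous.tendsto _).comp hx).const_mul _
  have t2 : Tendsto (fun n => ∫ x, φ x * deriv G (mollify n f x) * g x)
      atTop (𝓝 (∫ x, φ x * deriv G (f x) * g x)) := by
    refine tendsto_integral_of_dominated_convergence
      (fun x => L * ‖φ x * g x‖) (fun n => ?_) ?_ (fun n => ?_) ?_
    · exact (hφ.continuous.mul (hGd.comp (hus n).continuous)).aestronglyMeasurable.mul hg.1
    · exact (hφ2.integrable_mul hg).norm.const_mul L
    · refine Eventually.of_forall fun x => ?_
      rw [norm_mul, norm_mul, norm_mul]
      have := hL (mollify n f x)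
      rw [← Real.norm_eq_abs] at this
      calc ‖φ x‖ * ‖deriv G (mollify n f x)‖ * ‖g x‖ ≤ ‖φ x‖ * L * ‖g x‖ := by gcongr
        _ = _ := by ring
    · filter_upwards [hlim] with x hx
      exact (((hGd.tendsto _).comp hx).const_mul _).mul_const _
  have ha : ∀ n, MemLp (fun x => φ x * deriv G (mollify n f x)) 2 volume := fun n =>
    hφ2.of_le_mul (c := L) (hφ.continuous.mul (hGd.comp (hus n).continuous)).aestronglyMeasurable
      (Eventually.of_forall fun x => by
        rw [norm_mul, mul_comm]; gcongr; exact hL _)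
  have t3 : Tendsto (fun n => ∫ x, φ x * deriv G (mollify n f x) * (mollify n g x - g x))
      atTop (𝓝 0) := by
    rw [tendsto_zero_iff_enorm_tendsto_zero]
    have h2 := ENNReal.Tendsto.const_mul (a := ENNReal.ofReal L * eLpNorm φ 2 volume)
      (tendsto_mollify hg) (Or.inr (ENNReal.mul_ne_top (by simp) hφ2.2.ne))
    rw [mul_zero] at h2
    refine tendsto_of_tendsto_of_tendsto_of_le_of_le tendsto_const_nhds h2 (fun _ => zero_le) ?_
    intro n
    refine (enorm_integral_mul_le (ha n).1 ((memLp_mollify n hg).1.sub hg.1)).trans ?_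
    refine mul_le_mul_left (eLpNorm_le_mul_eLpNorm_of_ae_le_mul
      (Eventually.of_forall fun x => ?_) 2) _
    rw [norm_mul, mul_comm]; gcongr; exact hL _
  have t4 := t2.add t3
  have e4 : ∀ n, (∫ x, φ x * deriv G (mollify n f x) * g x)
      + ∫ x, φ x * deriv G (mollify n f x) * (mollify n g x - g x)
      = ∫ x, φ x * deriv G (mollify n f x) * mollify n g x := fun n => by
    rw [← integral_add (integrable_mul_of_two (ha n) hg)]
    · refine integral_congr_ae (Eventually.of_forall fun x => ?_)
      dsimp only; ring
    · exact integrable_mul_of_two (ha n) ((memLp_mollify n hg).sub hg)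
  simp only [e4, add_zero] at t4
  have t5 := t4.neg
  simp only [← key] at t5
  have := tendsto_nhds_unique t1 t5
  simpa [smul_eq_mul, mul_assoc] using this

/-! ### Functions vanishing at infinity: truncation into H¹ and the Sobolev inequality on D¹. -/

section VanishingAtInfinity

theorem MemD1.hasWeakPartial {F : Type*} [NormedAddCommGroup F] [NormedSpace ℝ F] {f : R3 → F}
    (hf : MemD1 f) (k : Fin 3) : HasWeakPartial k f (weakPartial k f) := by
  obtain ⟨g, hg, -⟩ := hf.2.1 k
  exact hg.weakPartial

theorem MemD1.memLp_weakPartial {F : Type*} [NormedAddCommGroup F] [NormedSpace ℝ F]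
    [CompleteSpace F] {f : R3 → F} (hf : MemD1 f) (k : Fin 3) :
    MemLp (weakPartial k f) 2 volume := by
  obtain ⟨g, hg, hL⟩ := hf.2.1 k
  exact hL.ae_eq hg.weakPartial_ae_eq.symm

/-- A bounded function supported in {|f| > 1/(n+1)}, which has finite measure by the definition of
D¹. This is where vanishing at infinity enters. -/
theorem memLp_trunc_comp {f : R3 → ℝ} (hf : MemD1 f) (n : ℕ) :
    MemLp (fun x => trunc n (f x)) 2 volume := by
  have hm : AEStronglyMeasurable (fun x => trunc n (f x)) volume :=
    (contDiff_trunc n).continuous.comp_aestronglyMeasurable hf.1.aestronglyMeasurable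
  refine (memLp_top_of_bound hm ((n + 1) * (Real.pi / 2)) (Eventually.of_forall fun x =>
    abs_trunc_le n _)).mono_exponent_of_measure_support_ne_top (s := {x | (n + 1 : ℝ)⁻¹ < ‖f x‖})
    (fun x hx => ?_) (hf.2.2 _ (by positivity)).ne le_top
  exact trunc_eq_zero n (not_lt.1 hx)

theorem memLp_deriv_trunc_mul {f g : R3 → ℝ} (hf : AEStronglyMeasurable f volume)
    (hg : MemLp g 2 volume) (n : ℕ) :
    MemLp (fun x => deriv (trunc n) (f x) * g x) 2 volume := by
  obtain ⟨L, hL0, hL⟩ := exists_deriv_shrink_bound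
  have m := ((contDiff_trunc n).continuous_deriv le_rfl).comp_aestronglyMeasurable hf
  exact hg.of_le_mul (c := L) (m.mul hg.1) (Eventually.of_forall fun x => by
    rw [norm_mul]; gcongr; exact abs_deriv_trunc_le hL n _)

theorem HasWeakPartial.trunc {k : Fin 3} {f g : R3 → ℝ} (h : HasWeakPartial k f g)
    (hg : MemLp g 2 volume) (n : ℕ) :
    HasWeakPartial k (fun x => trunc n (f x)) (fun x => deriv (TravellingWave.trunc n) (f x) * g x)
    := by
  obtain ⟨L, hL0, hL⟩ := exists_deriv_shrink_bound
  exact h.chain hg (contDiff_trunc n) (abs_trunc_le n) (abs_deriv_trunc_le hL n)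

/-- The Sobolev inequality holds on `D¹`. -/
theorem exists_isSobolevConstant : ∃ K : ℝ, IsSobolevConstant K := by
  obtain ⟨K, hK⟩ := exists_sobolev_H1 ℝ
  obtain ⟨L, hL0, hL⟩ := exists_deriv_shrink_bound
  -- The 3 comes from bounding each partial derivative by the full gradient, L from the derivatives
  -- of the truncations; adding 1 makes the constant strictly positive.
  refine ⟨K * (3 * L) + 1, by positivity, fun f hf => ?_⟩
  have hm := hf.1.aestronglyMeasurable
  refine (Lp.eLpNorm_lim_le_liminf_eLpNorm (f := fun n x => trunc n (f x))
    (fun n => (contDiff_trunc n).continuous.comp_aestronglyMeasurable hm) f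
    (Eventually.of_forall fun x => tendsto_trunc _)).trans ?_
  refine liminf_le_of_le (by isBoundedDefault) fun b hb => ?_
  obtain ⟨n, hn⟩ := hb.exists
  refine hn.trans ?_
  refine (hK _ _ (memLp_trunc_comp hf n)
    (fun k => (hf.hasWeakPartial k).trunc (hf.memLp_weakPartial k) n)
    (fun k => memLp_deriv_trunc_mul hm (hf.memLp_weakPartial k) n)).trans ?_
  have h1 : ∀ k, eLpNorm (fun x => deriv (trunc n) (f x) * weakPartial k f x) 2 volume
      ≤ ENNReal.ofReal L * eLpNorm (grad f) 2 volume := fun k => by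
    refine eLpNorm_le_mul_eLpNorm_of_ae_le_mul (Eventually.of_forall fun x => ?_) 2
    rw [norm_mul]
    gcongr
    · exact abs_deriv_trunc_le hL n _
    · exact PiLp.norm_apply_le (grad f x) k
  calc (K : ℝ≥0∞) * ∑ k, eLpNorm (fun x => deriv (trunc n) (f x) * weakPartial k f x) 2 volume
      ≤ K * ∑ _k : Fin 3, ENNReal.ofReal L * eLpNorm (grad f) 2 volume := by
        gcongr with k; exact h1 k
    _ = ENNReal.ofReal (K * (3 * L)) * eLpNorm (grad f) 2 volume := by
        rw [ENNReal.ofReal_mul (by positivity), ENNReal.ofReal_mul (by positivity)]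
        simp [mul_assoc]
    _ ≤ _ := by
        gcongr; linarith

/-- The weak derivative of a function vanishes almost everywhere on its zero set. -/
theorem weakPartial_eq_zero_of_eq_zero {k : Fin 3} {f g : R3 → ℝ} (h : HasWeakPartial k f g)
    (hg : MemLp g 2 volume) : ∀ᵐ x, f x = 0 → g x = 0 := by
  obtain ⟨L, hL0, hL⟩ := exists_deriv_shrink_bound
  have hm := h.1.aestronglyMeasurable
  -- The truncations converge to `f`, while their derivatives converge to `g` off {f = 0} and to 0
  -- on it. Hence `g'` is also a weak derivative of `f`, and uniqueness gives `g = g'`.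
  set g' : R3 → ℝ := fun x => Set.indicator {x | f x ≠ 0} g x with hg'
  have hlim : ∀ x, Tendsto (fun n => deriv (trunc n) (f x) * g x) atTop (𝓝 (g' x)) := fun x => by
    by_cases hx : f x = 0
    · have h0 : ∀ n, deriv (trunc n) (f x) = 0 := fun n => by
        rw [hx, deriv_trunc]
        have : shrink =ᶠ[𝓝 0] fun _ => 0 := by
          have : ∀ᶠ t : ℝ in 𝓝 0, t ^ 2 < 1 :=
            (continuous_id.pow 2).continuousAt.eventually (gt_mem_nhds (by simp))
          exact this.mono fun t ht => shrink_eq_zero ht.le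
        simp [this.deriv_eq]
      have h1 : g' x = 0 := by simp [hg', hx]
      simp only [h0, zero_mul, h1]
      exact tendsto_const_nhds
    · simpa [hg', hx] using (tendsto_deriv_trunc hx).mul_const (g x)
  have hm' : AEStronglyMeasurable g' volume :=
    aestronglyMeasurable_of_tendsto_ae atTop (fun n => (memLp_deriv_trunc_mul hm hg n).1)
      (Eventually.of_forall hlim)
  have hgL : MemLp g' 2 volume := hg.of_le hm' (Eventually.of_forall fun x => by
    simp only [hg', Set.indicator]; split_ifs <;> simp)
  have hw : HasWeakPartial k f g' := by
    refine ⟨h.1, hgL.locallyIntegrable (by norm_num), fun φ hφ hc => ?_⟩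
    have hφ2 : MemLp φ 2 volume := hφ.continuous.memLp_of_hasCompactSupport hc
    have hφ1 : ContDiff ℝ 1 φ := hφ.of_le (by simp)
    have key := fun n => (h.trunc hg n).2.2 φ hφ hc
    have t1 : Tendsto (fun n => ∫ x, fderiv ℝ φ x (EuclideanSpace.single k 1) • trunc n (f x))
        atTop (𝓝 (∫ x, fderiv ℝ φ x (EuclideanSpace.single k 1) • f x)) := by
      refine tendsto_integral_of_dominated_convergence
        (fun x => ‖fderiv ℝ φ x (EuclideanSpace.single k 1) • f x‖) (fun n => ?_)
        (integrable_fderiv_test_smul hφ1 hc h.1 _).norm (fun n => ?_) ?_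
      · exact (continuous_fderiv_apply_of_contDiff hφ1 _).aestronglyMeasurable.smul
          ((contDiff_trunc n).continuous.comp_aestronglyMeasurable hm)
      · refine Eventually.of_forall fun x => ?_
        rw [norm_smul, norm_smul]; gcongr; exact abs_trunc_le_self _ _
      · exact Eventually.of_forall fun x => (tendsto_trunc _).const_smul _
    have t2 : Tendsto (fun n => ∫ x, φ x • (deriv (trunc n) (f x) * g x))
        atTop (𝓝 (∫ x, φ x • g' x)) := by
      refine tendsto_integral_of_dominated_convergence
        (fun x => L * ‖φ x * g x‖) (fun n => ?_)
        ((integrable_mul_of_two hφ2 hg).norm.const_mul L) (fun n => ?_) ?_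
      · exact hφ.continuous.aestronglyMeasurable.smul (memLp_deriv_trunc_mul hm hg n).1
      · refine Eventually.of_forall fun x => ?_
        rw [norm_smul, norm_mul, norm_mul]
        have := abs_deriv_trunc_le hL n (f x)
        rw [← Real.norm_eq_abs] at this
        calc ‖φ x‖ * (‖deriv (trunc n) (f x)‖ * ‖g x‖) ≤ ‖φ x‖ * (L * ‖g x‖) := by gcongr
          _ = _ := by ring
      · exact Eventually.of_forall fun x => (hlim x).const_smul _
    simp only [key] at t1
    exact tendsto_nhds_unique t1 t2.neg
  filter_upwards [h.ae_eq hw] with x hx h0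
  simpa [hg', h0] using hx

end VanishingAtInfinity

/-! ### Two-by-two minors of gradients integrate to zero. -/

section NullLagrangian

/-- Both sides equal minus the integral of `f` against the mixed second derivative of `g`, which is
symmetric. The derivatives of `g` serve as test functions for `f`. -/
theorem integral_mul_fderiv_swap_of_contDiff {i j : Fin 3} {f a b : R3 → ℝ}
    (ha : HasWeakPartial i f a) (hb : HasWeakPartial j f b) {g : R3 → ℝ} (hg : ContDiff ℝ ∞ g)
    (hc : HasCompactSupport g) :
    ∫ x, b x * fderiv ℝ g x (EuclideanSpace.single i 1)
      = ∫ x, a x * fderiv ℝ g x (EuclideanSpace.single j 1) := by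
  have hs : ∀ e : R3, ContDiff ℝ ∞ fun x => fderiv ℝ g x e := fun e =>
    (hg.fderiv_right (m := ∞) (by simp)).clm_apply contDiff_const
  have h1 := ha.2.2 _ (hs (EuclideanSpace.single j 1)) (hc.fderiv_apply (𝕜 := ℝ) _)
  have h2 := hb.2.2 _ (hs (EuclideanSpace.single i 1)) (hc.fderiv_apply (𝕜 := ℝ) _)
  have hsymm : ∀ (x e e' : R3), fderiv ℝ (fun y => fderiv ℝ g y e) x e'
      = fderiv ℝ (fun y => fderiv ℝ g y e') x e := fun x e e' => by
    have hd : DifferentiableAt ℝ (fderiv ℝ g) x :=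
      (hg.fderiv_right (m := ∞) (by simp)).differentiable (by simp) x
    have := (hg.contDiffAt (x := x)).isSymmSndFDerivAt
      (by simpa using WithTop.coe_le_coe.2 (le_top : (2 : ℕ∞) ≤ ⊤))
    rw [fderiv_clm_apply hd (differentiableAt_const _),
      fderiv_clm_apply hd (differentiableAt_const _)]
    simpa using this e' e
  simp only [hsymm _ (EuclideanSpace.single j 1) (EuclideanSpace.single i 1)] at h1
  rw [h1] at h2
  simpa [smul_eq_mul, mul_comm] using (neg_injective h2).symm

/-- Density is needed only in `g`: for fixed derivatives of `f` in L² both sides are continuous in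
the gradient of `g`. -/
theorem integral_mul_swap_of_memLp {f : R3 → ℝ} {a : Fin 3 → R3 → ℝ}
    (ha : ∀ k, HasWeakPartial k f (a k)) (haL : ∀ k, MemLp (a k) 2 volume) {g : R3 → ℝ}
    {b : Fin 3 → R3 → ℝ} (hg : MemLp g 2 volume) (hb : ∀ k, HasWeakPartial k g (b k))
    (hbL : ∀ k, MemLp (b k) 2 volume) (i j : Fin 3) :
    ∫ x, a j x * b i x = ∫ x, a i x * b j x := by
  obtain ⟨u, hus, huc, -, huk⟩ := exists_smooth_seq hg hb hbL
  have hL : ∀ n k, MemLp (fun x => fderiv ℝ (u n) x (EuclideanSpace.single k 1)) 2 volume :=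
    fun n k => (continuous_fderiv_apply_of_contDiff ((hus n).of_le (by simp))
      _).memLp_of_hasCompactSupport ((huc n).fderiv_apply (𝕜 := ℝ) _)
  have t1 := tendsto_integral_mul_of_tendsto_two (haL j) (fun n => hL n i) (hbL i) (huk i)
  have t2 := tendsto_integral_mul_of_tendsto_two (haL i) (fun n => hL n j) (hbL j) (huk j)
  simp only [fun n => integral_mul_fderiv_swap_of_contDiff (ha i) (ha j) (hus n) (huc n)] at t1
  exact tendsto_nhds_unique t1 t2

/-- The bilinear form `∂ⱼf ∂ᵢg - ∂ᵢf ∂ⱼg` integrates to zero on `D¹`. -/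
theorem integral_mul_swap {f g : R3 → ℝ} (hf : MemD1 f) (hg : MemD1 g) (i j : Fin 3) :
    ∫ x, weakPartial j f x * weakPartial i g x = ∫ x, weakPartial i f x * weakPartial j g x := by
  obtain ⟨L, hL0, hL⟩ := exists_deriv_shrink_bound
  have hm := hg.1.aestronglyMeasurable
  have key := fun n => integral_mul_swap_of_memLp hf.hasWeakPartial hf.memLp_weakPartial
    (memLp_trunc_comp hg n) (fun k => (hg.hasWeakPartial k).trunc (hg.memLp_weakPartial k) n)
    (fun k => memLp_deriv_trunc_mul hm (hg.memLp_weakPartial k) n) i j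
  have lim : ∀ i j, Tendsto (fun n => ∫ x, weakPartial j f x *
      (deriv (trunc n) (g x) * weakPartial i g x)) atTop
      (𝓝 (∫ x, weakPartial j f x * weakPartial i g x)) := fun i j => by
    -- The derivatives of the truncations do not tend to 1 where `g` vanishes, but there the weak
    -- derivative of `g` is zero as well.
    have hz := weakPartial_eq_zero_of_eq_zero (hg.hasWeakPartial i) (hg.memLp_weakPartial i)
    refine tendsto_integral_of_dominated_convergence
      (fun x => L * ‖weakPartial j f x * weakPartial i g x‖) (fun n => ?_)
      ((integrable_mul_of_two (hf.memLp_weakPartial j)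
        (hg.memLp_weakPartial i)).norm.const_mul L) (fun n => ?_) ?_
    · exact (hf.memLp_weakPartial j).1.mul
        (memLp_deriv_trunc_mul hm (hg.memLp_weakPartial i) n).1
    · refine Eventually.of_forall fun x => ?_
      rw [norm_mul, norm_mul, norm_mul]
      have := abs_deriv_trunc_le hL n (g x)
      rw [← Real.norm_eq_abs] at this
      calc ‖weakPartial j f x‖ * (‖deriv (trunc n) (g x)‖ * ‖weakPartial i g x‖)
          ≤ ‖weakPartial j f x‖ * (L * ‖weakPartial i g x‖) := by gcongr
        _ = _ := by ring
    · filter_upwards [hz] with x hx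
      by_cases h0 : g x = 0
      · simp [hx h0]
      · simpa using ((tendsto_deriv_trunc h0).mul_const (weakPartial i g x)).const_mul
          (weakPartial j f x)
  have t1 := lim i j
  simp only [key] at t1
  exact tendsto_nhds_unique t1 (lim j i)

end NullLagrangian

/-! ### Real-valued norms and their integral form. -/

section Norms

variable {F : Type*} [NormedAddCommGroup F]

theorem normL_nonneg (p : ℝ≥0∞) (f : R3 → F) [NormedSpace ℝ F] : 0 ≤ normL p f :=
  ENNReal.toReal_nonneg

theorem normL_two_sq [NormedSpace ℝ F] {f : R3 → F} (hf : AEStronglyMeasurable f volume) :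
    normL 2 f ^ 2 = ∫ x, ‖f x‖ ^ 2 := by
  have hm : AEStronglyMeasurable (fun x => ‖f x‖ ^ 2) volume := hf.norm.pow 2
  rw [normL, ← ENNReal.toReal_pow, eLpNorm_two_sq, integral_eq_lintegral_of_nonneg_ae
    (Eventually.of_forall fun x => by positivity) hm]
  congr 1
  refine lintegral_congr fun x => ?_
  rw [ENNReal.ofReal_pow (norm_nonneg _), ofReal_norm]

theorem integrable_norm_sq {f : R3 → F} (hf : MemLp f 2 volume) :
    Integrable (fun x => ‖f x‖ ^ 2) volume :=
  hf.integrable_norm_pow two_ne_zero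

theorem normL_congr [NormedSpace ℝ F] {p : ℝ≥0∞} {f g : R3 → F} (h : f =ᵐ[volume] g) :
    normL p f = normL p g := by
  rw [normL, normL, eLpNorm_congr_ae h]

end Norms

/-! ### Vector potentials: Sobolev with the scalar constant, and the curl. -/

section VectorPotential

variable {A : R3 → R3}

theorem HasWeakPartial.apply {k : Fin 3} {B : R3 → R3} (h : HasWeakPartial k A B) (l : Fin 3) :
    HasWeakPartial k (fun x => A x l) (fun x => B x l) :=
  h.clm (EuclideanSpace.proj l : R3 →L[ℝ] ℝ)

theorem memLp_apply {p : ℝ≥0∞} (hA : MemLp A p volume) (l : Fin 3) :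
    MemLp (fun x => A x l) p volume :=
  (EuclideanSpace.proj l : R3 →L[ℝ] ℝ).comp_memLp' hA

theorem MemD1.apply (hA : MemD1 A) (l : Fin 3) : MemD1 fun x => A x l := by
  refine ⟨((hA.hasWeakPartial 0).apply l).1, fun k => ⟨_, (hA.hasWeakPartial k).apply l,
    memLp_apply (hA.memLp_weakPartial k) l⟩, fun t ht => ?_⟩
  refine (measure_mono fun x hx => ?_).trans_lt (hA.2.2 t ht)
  exact lt_of_lt_of_le (hx : t < ‖A x l‖) (PiLp.norm_apply_le (A x) l)

theorem MemD1.weakPartial_apply (hA : MemD1 A) (k l : Fin 3) :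
    weakPartial k (fun x => A x l) =ᵐ[volume] fun x => weakPartial k A x l :=
  ((hA.hasWeakPartial k).apply l).weakPartial_ae_eq

theorem norm_gradTensor_sq (A : R3 → R3) (x : R3) :
    ‖gradTensor A x‖ ^ 2 = ∑ k, ‖weakPartial k A x‖ ^ 2 := by
  simp [EuclideanSpace.norm_sq_eq, gradTensor, Fintype.sum_prod_type]

theorem aestronglyMeasurable_gradTensor (hA : MemD1 A) :
    AEStronglyMeasurable (gradTensor A) volume := by
  refine (PiLp.continuous_toLp 2 _).comp_aestronglyMeasurable ?_
  refine (aemeasurable_pi_lambda _ fun p => ?_).aestronglyMeasurable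
  exact (memLp_apply (hA.memLp_weakPartial p.1) p.2).1.aemeasurable

theorem memLp_gradTensor (hA : MemD1 A) : MemLp (gradTensor A) 2 volume := by
  have hs : MemLp (fun x => ∑ k, ‖weakPartial k A x‖) 2 volume :=
    memLp_finsetSum _ fun k _ => (hA.memLp_weakPartial k).norm
  refine hs.of_le (aestronglyMeasurable_gradTensor hA) (Eventually.of_forall fun x => ?_)
  have h0 : 0 ≤ ∑ k, ‖weakPartial k A x‖ := Finset.sum_nonneg fun _ _ => norm_nonneg _
  rw [Real.norm_of_nonneg h0]
  refine abs_le_of_sq_le_sq' ?_ h0 |>.2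
  rw [norm_gradTensor_sq]
  exact Finset.sum_sq_le_sq_sum_of_nonneg fun _ _ => norm_nonneg _

theorem sum_eLpNorm_grad_sq (hA : MemD1 A) :
    ∑ l, eLpNorm (grad fun x => A x l) 2 volume ^ 2 = eLpNorm (gradTensor A) 2 volume ^ 2 := by
  simp only [eLpNorm_two_sq]
  have e : ∀ l, ∫⁻ x, ‖grad (fun x => A x l) x‖ₑ ^ 2
      = ∫⁻ x, ∑ k, ‖weakPartial k A x l‖ₑ ^ 2 := fun l => by
    refine lintegral_congr_ae ?_
    have : ∀ᵐ x, ∀ k, weakPartial k (fun x => A x l) x = weakPartial k A x l :=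
      ae_all_iff.2 fun k => hA.weakPartial_apply k l
    filter_upwards [this] with x hx
    have h1 : ‖grad (fun x => A x l) x‖ ^ 2 = ∑ k, ‖weakPartial k A x l‖ ^ 2 := by
      simp [EuclideanSpace.norm_sq_eq, grad, hx]
    simp only [← ofReal_norm, ← ENNReal.ofReal_pow (norm_nonneg _)]
    rw [h1, ENNReal.ofReal_sum_of_nonneg fun _ _ => by positivity]
  have m : ∀ k l, AEMeasurable (fun x => ‖weakPartial k A x l‖ₑ ^ 2) volume := fun k l =>
    (memLp_apply (hA.memLp_weakPartial k) l).1.enorm.pow_const 2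
  simp only [e]
  rw [← lintegral_finsetSum' _ fun l _ => Finset.aemeasurable_fun_sum _ fun k _ => m k l]
  refine lintegral_congr fun x => ?_
  simp only [← ofReal_norm, ← ENNReal.ofReal_pow (norm_nonneg _)]
  rw [norm_gradTensor_sq, Finset.sum_comm]
  simp only [EuclideanSpace.norm_sq_eq]
  rw [ENNReal.ofReal_sum_of_nonneg fun _ _ => by positivity]
  refine Finset.sum_congr rfl fun k _ => ?_
  rw [ENNReal.ofReal_sum_of_nonneg fun _ _ => by positivity]

/-- The square of the L⁶ norm is the L³ norm of |A|² = ∑ Aₗ², so Minkowski in L³ applies. Summing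
squares instead of norms is what carries the scalar Sobolev constant over to vector fields
unchanged. -/
theorem eLpNorm_six_sq_le (hA : AEStronglyMeasurable A volume) :
    eLpNorm A 6 volume ^ 2 ≤ ∑ l, eLpNorm (fun x => A x l) 6 volume ^ 2 := by
  have e : ∀ {E : Type} [NormedAddCommGroup E] (f : R3 → E), eLpNorm f 6 volume ^ 2
      = eLpNorm (fun x => ‖f x‖ ^ 2) 3 volume := fun f => by
    have := eLpNorm_norm_rpow (μ := (volume : Measure R3)) (p := 3) f (by norm_num : (0 : ℝ) < 2)
    have h6 : (3 : ℝ≥0∞) * ENNReal.ofReal 2 = 6 := by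
      rw [ENNReal.ofReal_ofNat]; norm_num
    rw [h6] at this
    simp only [Real.rpow_ofNat, ENNReal.rpow_ofNat] at this
    exact this.symm
  simp only [e]
  have hsum : (fun x => ‖A x‖ ^ 2) = ∑ l, fun x => ‖A x l‖ ^ 2 := by
    funext x; simp [EuclideanSpace.norm_sq_eq]
  rw [hsum]
  refine eLpNorm_sum_le (fun l _ => ?_) (by norm_num)
  exact ((EuclideanSpace.proj l : R3 →L[ℝ] ℝ).continuous.comp_aestronglyMeasurable hA).norm.pow 2

/-- The Sobolev inequality for vector fields, with the same constant. -/
theorem IsSobolevConstant.eLpNorm_le {K : ℝ} (hK : IsSobolevConstant K) (hA : MemD1 A) :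
    eLpNorm A 6 volume ≤ ENNReal.ofReal K * eLpNorm (gradTensor A) 2 volume := by
  have h : eLpNorm A 6 volume ^ 2 ≤ (ENNReal.ofReal K * eLpNorm (gradTensor A) 2 volume) ^ 2 := by
    rw [mul_pow, ← sum_eLpNorm_grad_sq hA, Finset.mul_sum]
    refine (eLpNorm_six_sq_le hA.1.aestronglyMeasurable).trans
      (Finset.sum_le_sum fun l _ => ?_)
    rw [← mul_pow]
    gcongr
    exact hK.2 _ (hA.apply l)
  exact (ENNReal.pow_le_pow_left_iff two_ne_zero).1 h

theorem MemD1.memLp_six (hA : MemD1 A) : MemLp A 6 volume := by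
  obtain ⟨K, hK⟩ := exists_isSobolevConstant
  exact ⟨hA.1.aestronglyMeasurable, (hK.eLpNorm_le hA).trans_lt
    (ENNReal.mul_lt_top (by simp) (memLp_gradTensor hA).2)⟩

theorem IsSobolevConstant.normL_le {K : ℝ} (hK : IsSobolevConstant K) (hA : MemD1 A) :
    normL 6 A ≤ K * normL 2 (gradTensor A) := by
  have := ENNReal.toReal_mono (ENNReal.mul_ne_top (by simp) (memLp_gradTensor hA).2.ne)
    (hK.eLpNorm_le hA)
  rwa [ENNReal.toReal_mul, ENNReal.toReal_ofReal hK.1.le] at this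

theorem memLp_dirDeriv {F : Type*} [NormedAddCommGroup F] [NormedSpace ℝ F] {f : R3 → F}
    (hf : ∀ k, MemLp (weakPartial k f) 2 volume) (w : R3) : MemLp (dirDeriv w f) 2 volume := by
  unfold dirDeriv
  exact memLp_finsetSum _ fun k _ => (hf k).const_smul (w k)

theorem normL_dirDeriv_sq_le (hA : MemD1 A) (w : R3) :
    normL 2 (dirDeriv w A) ^ 2 ≤ ‖w‖ ^ 2 * normL 2 (gradTensor A) ^ 2 := by
  have hD := memLp_dirDeriv hA.memLp_weakPartial w
  rw [normL_two_sq hD.1, normL_two_sq (aestronglyMeasurable_gradTensor hA), ← integral_const_mul]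
  refine integral_mono (integrable_norm_sq hD)
    ((integrable_norm_sq (memLp_gradTensor hA)).const_mul _) fun x => ?_
  simp only [norm_gradTensor_sq]
  have h1 : ‖dirDeriv w A x‖ ≤ ∑ k, |w k| * ‖weakPartial k A x‖ := by
    refine (norm_sum_le _ _).trans (le_of_eq ?_)
    simp [norm_smul]
  calc ‖dirDeriv w A x‖ ^ 2 ≤ (∑ k, |w k| * ‖weakPartial k A x‖) ^ 2 := by gcongr
    _ ≤ (∑ k, |w k| ^ 2) * ∑ k, ‖weakPartial k A x‖ ^ 2 :=
        Finset.sum_mul_sq_le_sq_mul_sq _ _ _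
    _ = _ := by simp [EuclideanSpace.norm_sq_eq]

/-- The curl of a vector field. -/
def curl (A : R3 → R3) (x : R3) : R3 :=
  WithLp.toLp 2 ![weakPartial 1 A x 2 - weakPartial 2 A x 1,
    weakPartial 2 A x 0 - weakPartial 0 A x 2, weakPartial 0 A x 1 - weakPartial 1 A x 0]

/-- The last bracket is the sum of the principal two-by-two minors of the derivative matrix, each of
which integrates to zero. -/
theorem norm_curl_sq (A : R3 → R3) (x : R3) :
    ‖curl A x‖ ^ 2 = ‖gradTensor A x‖ ^ 2 - (∑ k, weakPartial k A x k) ^ 2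
      + 2 * ((weakPartial 0 A x 0 * weakPartial 1 A x 1 - weakPartial 1 A x 0 * weakPartial 0 A x 1)
        + (weakPartial 0 A x 0 * weakPartial 2 A x 2 - weakPartial 2 A x 0 * weakPartial 0 A x 2)
        + (weakPartial 1 A x 1 * weakPartial 2 A x 2
          - weakPartial 2 A x 1 * weakPartial 1 A x 2)) := by
  rw [norm_gradTensor_sq]
  simp [EuclideanSpace.norm_sq_eq, curl, Fin.sum_univ_three]
  ring

theorem memLp_curl (hA : MemD1 A) : MemLp (curl A) 2 volume := by
  have hc : ∀ k l, MemLp (fun x => weakPartial k A x l) 2 volume := fun k l =>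
    memLp_apply (hA.memLp_weakPartial k) l
  have hm : AEStronglyMeasurable (curl A) volume := by
    refine (PiLp.continuous_toLp 2 _).comp_aestronglyMeasurable ?_
    refine (aemeasurable_pi_lambda _ fun p => ?_).aestronglyMeasurable
    fin_cases p
    · exact ((hc 1 2).sub (hc 2 1)).1.aemeasurable
    · exact ((hc 2 0).sub (hc 0 2)).1.aemeasurable
    · exact ((hc 0 1).sub (hc 1 0)).1.aemeasurable
  -- The pointwise constant 2 is crude and serves only for integrability; the constant 1 appears
  -- after integration.
  refine (memLp_gradTensor hA).of_le_mul (c := 2) hm (Eventually.of_forall fun x => ?_)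
  refine abs_le_of_sq_le_sq' ?_ (by positivity) |>.2
  rw [mul_pow, norm_gradTensor_sq]
  simp only [EuclideanSpace.norm_sq_eq, curl, Fin.sum_univ_three, Real.norm_eq_abs, sq_abs,
    Matrix.cons_val_zero, Matrix.cons_val_one, Matrix.cons_val]
  nlinarith [sq_nonneg (weakPartial 1 A x 2 + weakPartial 2 A x 1),
    sq_nonneg (weakPartial 2 A x 0 + weakPartial 0 A x 2),
    sq_nonneg (weakPartial 0 A x 1 + weakPartial 1 A x 0), sq_nonneg (weakPartial 0 A x 0),
    sq_nonneg (weakPartial 1 A x 1), sq_nonneg (weakPartial 2 A x 2),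
    sq_nonneg (weakPartial 1 A x 2), sq_nonneg (weakPartial 2 A x 1),
    sq_nonneg (weakPartial 2 A x 0), sq_nonneg (weakPartial 0 A x 2),
    sq_nonneg (weakPartial 0 A x 1), sq_nonneg (weakPartial 1 A x 0)]

/-- After integration the minors disappear and the squared divergence enters with a favourable sign.
-/
theorem normL_curl_le (hA : MemD1 A) : normL 2 (curl A) ≤ normL 2 (gradTensor A) := by
  have hc : ∀ k l, MemLp (fun x => weakPartial k A x l) 2 volume := fun k l =>
    memLp_apply (hA.memLp_weakPartial k) l
  have hi : ∀ k l k' l', Integrable (fun x => weakPartial k A x l * weakPartial k' A x l')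
      volume := fun k l k' l' => integrable_mul_of_two (hc k l) (hc k' l')
  have hnull : ∀ k l, ∫ x, (weakPartial k A x k * weakPartial l A x l
      - weakPartial l A x k * weakPartial k A x l) = 0 := fun k l => by
    have h1 := integral_mul_swap (hA.apply k) (hA.apply l) l k
    have e : ∀ i j, (∫ x, weakPartial i (fun x => A x k) x * weakPartial j (fun x => A x l) x)
        = ∫ x, weakPartial i A x k * weakPartial j A x l := fun i j =>
      integral_congr_ae ((hA.weakPartial_apply i k).mul (hA.weakPartial_apply j l))
    rw [e, e] at h1
    rw [integral_sub (hi _ _ _ _) (hi _ _ _ _), h1, sub_self]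
  refine abs_le_of_sq_le_sq' ?_ (normL_nonneg _ _) |>.2
  have hg := integrable_norm_sq (memLp_gradTensor hA)
  have hdiv : Integrable (fun x => (∑ k, weakPartial k A x k) ^ 2) volume := by
    have : MemLp (fun x => ∑ k, weakPartial k A x k) 2 volume :=
      memLp_finsetSum _ fun k _ => hc k k
    simpa [sq] using integrable_mul_of_two this this
  rw [normL_two_sq (memLp_curl hA).1, normL_two_sq (memLp_gradTensor hA).1]
  set N : Fin 3 → Fin 3 → R3 → ℝ := fun k l x => weakPartial k A x k * weakPartial l A x l
      - weakPartial l A x k * weakPartial k A x l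
  have hN : ∀ k l, Integrable (N k l) volume := fun k l => (hi _ _ _ _).sub (hi _ _ _ _)
  have hN2 : Integrable (fun x => N 0 1 x + N 0 2 x) volume := (hN 0 1).add (hN 0 2)
  have hN3 : Integrable (fun x => N 0 1 x + N 0 2 x + N 1 2 x) volume := hN2.add (hN 1 2)
  have hgd : Integrable (fun x => ‖gradTensor A x‖ ^ 2 - (∑ k, weakPartial k A x k) ^ 2) volume :=
    hg.sub hdiv
  have hcurl : ∀ x, ‖curl A x‖ ^ 2 = ‖gradTensor A x‖ ^ 2 - (∑ k, weakPartial k A x k) ^ 2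
      + 2 * (N 0 1 x + N 0 2 x + N 1 2 x) := norm_curl_sq A
  simp only [hcurl]
  rw [integral_add hgd (hN3.const_mul 2), integral_sub hg hdiv, integral_const_mul,
    integral_add hN2 (hN 1 2), integral_add (hN 0 1) (hN 0 2), hnull, hnull, hnull]
  have : 0 ≤ ∫ x, (∑ k, weakPartial k A x k) ^ 2 := integral_nonneg fun x => sq_nonneg _
  linarith

end VectorPotential

/-! ### Pauli matrix algebra and the spin density. -/

section Spinors

/-- `∑ₖ σᵏ dₖ`. -/
def sigmaSum (d : Fin 3 → Spinor) : Spinor :=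
  ∑ k, WithLp.toLp 2 ((pauli k).mulVec (d k).ofLp)

theorem sigmaSum_apply_zero (d : Fin 3 → Spinor) :
    sigmaSum d 0 = d 0 1 - Complex.I * d 1 1 + d 2 0 := by
  simp [sigmaSum, pauli, Fin.sum_univ_three]
  ring

theorem sigmaSum_apply_one (d : Fin 3 → Spinor) :
    sigmaSum d 1 = d 0 0 + Complex.I * d 1 0 - d 2 1 := by
  simp [sigmaSum, pauli, Fin.sum_univ_three]
  ring

theorem norm_spinor_sq (z : Spinor) :
    ‖z‖ ^ 2 = (z 0).re ^ 2 + (z 0).im ^ 2 + ((z 1).re ^ 2 + (z 1).im ^ 2) := by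
  simp only [EuclideanSpace.norm_sq_eq, Fin.sum_univ_two, Complex.sq_norm, Complex.normSq_apply]
  ring

/-- The Pauli matrices are unitary. -/
theorem norm_pauli_mulVec (k : Fin 3) (z : Spinor) :
    ‖(WithLp.toLp 2 ((pauli k).mulVec z.ofLp) : Spinor)‖ = ‖z‖ := by
  rw [← sq_eq_sq₀ (norm_nonneg _) (norm_nonneg _), norm_spinor_sq, norm_spinor_sq]
  fin_cases k <;>
    simp [pauli, Matrix.mulVec, dotProduct, Fin.sum_univ_two] <;> ring

theorem norm_sigmaSum_le (d : Fin 3 → Spinor) : ‖sigmaSum d‖ ≤ ∑ k, ‖d k‖ :=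
  (norm_sum_le _ _).trans (le_of_eq (Finset.sum_congr rfl fun k _ => norm_pauli_mulVec k _))

theorem sigmaSum_sub (d d' : Fin 3 → Spinor) :
    sigmaSum (fun k => d k - d' k) = sigmaSum d - sigmaSum d' := by
  simp only [sigmaSum, WithLp.ofLp_sub, Matrix.mulVec_sub, WithLp.toLp_sub,
    Finset.sum_sub_distrib]

theorem continuous_sigmaSum : Continuous sigmaSum := by
  unfold sigmaSum
  refine continuous_finsetSum _ fun k _ => (PiLp.continuous_toLp 2 _).comp ?_
  exact Continuous.matrix_mulVec continuous_const
    ((PiLp.continuous_ofLp 2 _).comp (continuous_apply k))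

/-- The spin density `⟨z, σ z⟩`. -/
def spin (z : Spinor) : R3 :=
  WithLp.toLp 2 ![2 * ((z 0).re * (z 1).re + (z 0).im * (z 1).im),
    2 * ((z 0).re * (z 1).im - (z 0).im * (z 1).re),
    (z 0).re ^ 2 + (z 0).im ^ 2 - ((z 1).re ^ 2 + (z 1).im ^ 2)]

theorem norm_spin (z : Spinor) : ‖spin z‖ = ‖z‖ ^ 2 := by
  rw [← sq_eq_sq₀ (norm_nonneg _) (by positivity), norm_spinor_sq, EuclideanSpace.norm_sq_eq]
  simp [spin, Fin.sum_univ_three]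
  ring

/-- The polarisation `2 Re ⟨p, σ z⟩` of the spin density. -/
def spinPolar (p z : Spinor) : Fin 3 → ℝ :=
  ![2 * ((p 0).re * (z 1).re + (z 0).re * (p 1).re + (p 0).im * (z 1).im + (z 0).im * (p 1).im),
    2 * ((p 0).re * (z 1).im + (z 0).re * (p 1).im - (p 0).im * (z 1).re - (z 0).im * (p 1).re),
    2 * ((p 0).re * (z 0).re + (p 0).im * (z 0).im - (p 1).re * (z 1).re - (p 1).im * (z 1).im)]

/-- The antisymmetric forms `2 Re ⟨p, i σ q⟩`. -/
def spinArea (p q : Spinor) : Fin 3 → ℝ :=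
  ![2 * (((p 0).im * (q 1).re - (p 1).re * (q 0).im)
      + ((p 1).im * (q 0).re - (p 0).re * (q 1).im)),
    2 * (((p 0).re * (q 1).re - (p 1).re * (q 0).re)
      + ((p 0).im * (q 1).im - (p 1).im * (q 0).im)),
    2 * (((p 0).im * (q 0).re - (p 0).re * (q 0).im)
      - ((p 1).im * (q 1).re - (p 1).re * (q 1).im))]

/-- Since σᵏσˡ = δ + iεσ, only antisymmetric cross terms survive. Those between two components of
`a` cancel because they are real scalars. Those between `a` and `p` will become derivatives of the
spin density, and those between two `p` will integrate to zero. -/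
theorem norm_sigmaSum_sq (h : ℝ) (a : Fin 3 → ℝ) (z : Spinor) (p : Fin 3 → Spinor) :
    ‖sigmaSum fun k => (Complex.I * (h : ℂ)) • p k + ((a k : ℝ) : ℂ) • z‖ ^ 2
      = ∑ k, ‖(Complex.I * (h : ℂ)) • p k + ((a k : ℝ) : ℂ) • z‖ ^ 2
        + h * ((a 2 * spinPolar (p 1) z 0 - a 1 * spinPolar (p 2) z 0)
          + (a 0 * spinPolar (p 2) z 1 - a 2 * spinPolar (p 0) z 1)
          + (a 1 * spinPolar (p 0) z 2 - a 0 * spinPolar (p 1) z 2))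
        + h ^ 2 * (spinArea (p 1) (p 2) 0 + spinArea (p 2) (p 0) 1 + spinArea (p 0) (p 1) 2) := by
  simp only [norm_spinor_sq, sigmaSum_apply_zero, sigmaSum_apply_one, Fin.sum_univ_three]
  simp [spinPolar, spinArea]
  ring

end Spinors

/-! ### Interpolation between L² and L⁶, and approximation in H¹. -/

section Sobolev

theorem holderTriple_of_toReal {p q r : ℝ≥0∞} (hp : p ≠ 0) (hq : q ≠ 0) (hr : r ≠ 0)
    (h : p.toReal⁻¹ + q.toReal⁻¹ = r.toReal⁻¹) : ENNReal.HolderTriple p q r := by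
  constructor
  have h1 : p⁻¹ ≠ ⊤ := ENNReal.inv_ne_top.2 hp
  have h2 : q⁻¹ ≠ ⊤ := ENNReal.inv_ne_top.2 hq
  have h3 : r⁻¹ ≠ ⊤ := ENNReal.inv_ne_top.2 hr
  rw [← ENNReal.toReal_eq_toReal_iff' (ENNReal.add_ne_top.2 ⟨h1, h2⟩) h3, ENNReal.toReal_add h1 h2,
    ENNReal.toReal_inv, ENNReal.toReal_inv, ENNReal.toReal_inv, h]

instance holderTriple_six_three_two : ENNReal.HolderTriple 6 3 2 :=
  holderTriple_of_toReal (by norm_num) (by norm_num) (by norm_num) (by norm_num)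

instance holderTriple_three_six_two : ENNReal.HolderTriple 3 6 2 :=
  holderTriple_of_toReal (by norm_num) (by norm_num) (by norm_num) (by norm_num)

instance holderTriple_two_six : ENNReal.HolderTriple 2 6 (3 / 2) :=
  holderTriple_of_toReal (by norm_num) (by norm_num) (by norm_num) (by norm_num)

variable {F : Type*} [NormedAddCommGroup F]

/-- Interpolation of `L³` between `L²` and `L⁶`. -/
theorem eLpNorm_three_sq_le {f : R3 → F} (hf : AEStronglyMeasurable f volume) :
    eLpNorm f 3 volume ^ 2 ≤ eLpNorm f 2 volume * eLpNorm f 6 volume := by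
  have h1 := eLpNorm_norm_rpow (μ := (volume : Measure R3)) (p := 3 / 2) f
    (by norm_num : (0 : ℝ) < 2)
  have h3 : (3 / 2 : ℝ≥0∞) * ENNReal.ofReal 2 = 3 := by
    rw [ENNReal.ofReal_ofNat]; exact ENNReal.div_mul_cancel (by norm_num) (by norm_num)
  rw [h3] at h1
  simp only [Real.rpow_ofNat, ENNReal.rpow_ofNat] at h1
  rw [← h1]
  have h2 := eLpNorm_smul_le_mul_eLpNorm (p := 2) (q := 6) (r := 3 / 2) hf.norm hf.norm
  rw [eLpNorm_norm, eLpNorm_norm] at h2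
  refine le_trans (le_of_eq ?_) h2
  congr 1
  funext x
  simp [sq]

theorem memLp_three {f : R3 → F} (h2 : MemLp f 2 volume) (h6 : MemLp f 6 volume) :
    MemLp f 3 volume := by
  refine ⟨h2.1, ?_⟩
  have := (eLpNorm_three_sq_le h2.1).trans_lt (ENNReal.mul_lt_top h2.2 h6.2)
  exact ENNReal.pow_lt_top_iff.1 this |>.resolve_right two_ne_zero

theorem tendsto_eLpNorm_three {u : ℕ → R3 → F} (hu : ∀ n, AEStronglyMeasurable (u n) volume)
    (h2 : Tendsto (fun n => eLpNorm (u n) 2 volume) atTop (𝓝 0))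
    (h6 : Tendsto (fun n => eLpNorm (u n) 6 volume) atTop (𝓝 0)) :
    Tendsto (fun n => eLpNorm (u n) 3 volume) atTop (𝓝 0) := by
  have h := ENNReal.Tendsto.mul h2 (Or.inr (by simp)) h6 (Or.inr (by simp))
  rw [mul_zero] at h
  have h' : Tendsto (fun n => eLpNorm (u n) 3 volume ^ 2) atTop (𝓝 0) :=
    tendsto_of_tendsto_of_tendsto_of_le_of_le tendsto_const_nhds h (fun _ => zero_le)
      fun n => eLpNorm_three_sq_le (hu n)
  have := (ENNReal.continuous_rpow_const (y := (1 / 2 : ℝ))).continuousAt.tendsto.comp h'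
  refine (this.congr fun n => ?_).trans (by simp)
  simp only [Function.comp_apply]
  rw [← ENNReal.rpow_natCast, ← ENNReal.rpow_mul]; norm_num

theorem tendsto_normL [NormedSpace ℝ F] {p : ℝ≥0∞} (hp : 1 ≤ p) {u : ℕ → R3 → F} {f : R3 → F}
    (hu : ∀ n, MemLp (u n) p volume) (hf : MemLp f p volume)
    (h : Tendsto (fun n => eLpNorm (u n - f) p volume) atTop (𝓝 0)) :
    Tendsto (fun n => normL p (u n)) atTop (𝓝 (normL p f)) := by
  have : Fact (1 ≤ p) := ⟨hp⟩
  have h1 := ((Lp.tendsto_Lp_iff_tendsto_eLpNorm'' u hu f hf).2 h).norm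
  simpa only [Lp.norm_toLp, normL] using h1

variable [NormedSpace ℝ F]

theorem MemH1.hasWeakPartial {f : R3 → F} (hf : MemH1 f) (k : Fin 3) :
    HasWeakPartial k f (weakPartial k f) := by
  obtain ⟨g, hg, -⟩ := hf.2 k
  exact hg.weakPartial

theorem MemH1.memLp_weakPartial [CompleteSpace F] {f : R3 → F} (hf : MemH1 f) (k : Fin 3) :
    MemLp (weakPartial k f) 2 volume := by
  obtain ⟨g, hg, hL⟩ := hf.2 k
  exact hL.ae_eq hg.weakPartial_ae_eq.symm

theorem MemH1.memLp_six [FiniteDimensional ℝ F] {f : R3 → F} (hf : MemH1 f) :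
    MemLp f 6 volume := by
  have : CompleteSpace F := FiniteDimensional.complete ℝ F
  obtain ⟨K, hK⟩ := exists_sobolev_H1 F
  refine ⟨hf.1.1, (hK f _ hf.1 hf.hasWeakPartial hf.memLp_weakPartial).trans_lt ?_⟩
  exact ENNReal.mul_lt_top (by simp) (ENNReal.sum_lt_top.2 fun k _ => (hf.memLp_weakPartial k).2)

theorem MemH1.memLp_three [FiniteDimensional ℝ F] {f : R3 → F} (hf : MemH1 f) :
    MemLp f 3 volume :=
  TravellingWave.memLp_three hf.1 hf.memLp_six

theorem memLp_fderiv_of_smooth {u : R3 → F} (hu : ContDiff ℝ ∞ u) (hc : HasCompactSupport u)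
    (k : Fin 3) : MemLp (fun x => fderiv ℝ u x (EuclideanSpace.single k 1)) 2 volume :=
  (continuous_fderiv_apply_of_contDiff (hu.of_le (by simp)) _).memLp_of_hasCompactSupport
    (hc.fderiv_apply (𝕜 := ℝ) _)

theorem hasWeakPartial_of_smooth {u : R3 → F} (hu : ContDiff ℝ ∞ u) (k : Fin 3) :
    HasWeakPartial k u (fun x => fderiv ℝ u x (EuclideanSpace.single k 1)) :=
  hasWeakPartial_of_contDiff (hu.of_le (by simp)) k

theorem memH1_of_smooth {u : R3 → F} (hu : ContDiff ℝ ∞ u) (hc : HasCompactSupport u) :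
    MemH1 u :=
  ⟨hu.continuous.memLp_of_hasCompactSupport hc, fun k =>
    ⟨_, hasWeakPartial_of_smooth hu k, memLp_fderiv_of_smooth hu hc k⟩⟩

theorem memD1_of_smooth {u : R3 → F} (hu : ContDiff ℝ ∞ u) (hc : HasCompactSupport u) :
    MemD1 u := by
  refine ⟨hu.continuous.locallyIntegrable, (memH1_of_smooth hu hc).2, fun t ht => ?_⟩
  refine (measure_mono fun x hx => ?_).trans_lt (hc.isCompact.measure_lt_top (μ := volume))
  refine subset_tsupport u fun h0 => ?_
  have hx' : t < ‖u x‖ := hx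
  rw [h0, norm_zero] at hx'
  exact lt_asymm ht hx'

theorem weakPartial_of_smooth [CompleteSpace F] {u : R3 → F} (hu : ContDiff ℝ ∞ u) (k : Fin 3) :
    weakPartial k u =ᵐ[volume] fun x => fderiv ℝ u x (EuclideanSpace.single k 1) :=
  (hasWeakPartial_of_smooth hu k).weakPartial_ae_eq

theorem MemH1.sub {f g : R3 → F} (hf : MemH1 f) (hg : MemH1 g) : MemH1 (f - g) := by
  refine ⟨hf.1.sub hg.1, fun k => ?_⟩
  obtain ⟨a, ha, haL⟩ := hf.2 k
  obtain ⟨b, hb, hbL⟩ := hg.2 k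
  exact ⟨_, ha.sub hb, haL.sub hbL⟩

/-- Approximation in `H¹`, with convergence in `L²`, `L³` and `L⁶`. -/
theorem MemH1.exists_smooth_seq [FiniteDimensional ℝ F] {f : R3 → F} (hf : MemH1 f) :
    ∃ u : ℕ → R3 → F, (∀ n, ContDiff ℝ ∞ (u n)) ∧ (∀ n, HasCompactSupport (u n)) ∧
      Tendsto (fun n => eLpNorm (u n - f) 2 volume) atTop (𝓝 0) ∧
      Tendsto (fun n => eLpNorm (u n - f) 3 volume) atTop (𝓝 0) ∧
      Tendsto (fun n => eLpNorm (u n - f) 6 volume) atTop (𝓝 0) ∧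
      ∀ k, Tendsto (fun n => eLpNorm (weakPartial k (u n - f)) 2 volume) atTop (𝓝 0) := by
  have : CompleteSpace F := FiniteDimensional.complete ℝ F
  obtain ⟨K, hK⟩ := exists_sobolev_H1 F
  obtain ⟨u, hus, huc, hu, huk⟩ :=
    TravellingWave.exists_smooth_seq hf.1 hf.hasWeakPartial hf.memLp_weakPartial
  have hH : ∀ n, MemH1 (u n - f) := fun n => (memH1_of_smooth (hus n) (huc n)).sub hf
  have hk : ∀ k, Tendsto (fun n => eLpNorm (weakPartial k (u n - f)) 2 volume) atTop (𝓝 0) :=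
    fun k => (huk k).congr fun n => eLpNorm_congr_ae
      (((hasWeakPartial_of_smooth (hus n) k).sub (hf.hasWeakPartial k)).weakPartial_ae_eq).symm
  have h6 : Tendsto (fun n => eLpNorm (u n - f) 6 volume) atTop (𝓝 0) := by
    have hs := ENNReal.Tendsto.const_mul (a := (K : ℝ≥0∞))
      (tendsto_finsetSum Finset.univ fun k _ => hk k) (Or.inr (by simp))
    simp only [Finset.sum_const_zero, mul_zero] at hs
    exact tendsto_of_tendsto_of_tendsto_of_le_of_le tendsto_const_nhds hs (fun _ => zero_le)
      fun n => hK _ _ (hH n).1 (hH n).hasWeakPartial (hH n).memLp_weakPartial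
  exact ⟨u, hus, huc, hu, tendsto_eLpNorm_three (fun n => (hH n).1.1) hu h6, h6, hk⟩

end Sobolev

/-! ### Covariant derivatives shifted by a constant vector: bounds and continuity on H¹. -/

section CovariantDerivative

variable (C : Constants)

/-- The covariant derivative shifted by a constant vector: `∇_{S,A} ψ + w ψ`. -/
def covShift (w : R3) (A : R3 → R3) (ψ : R3 → Spinor) (k : Fin 3) (x : R3) : Spinor :=
  covDeriv C A ψ k x + ((w k : ℝ) : ℂ) • ψ x

/-- `σ · (∇_{S,A} ψ + w ψ)`. -/
def pauliShift (w : R3) (A : R3 → R3) (ψ : R3 → Spinor) (x : R3) : Spinor :=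
  sigmaSum fun k => covShift C w A ψ k x

theorem covShift_zero (A : R3 → R3) (ψ : R3 → Spinor) (k : Fin 3) :
    covShift C 0 A ψ k = covDeriv C A ψ k := by
  funext x; simp [covShift]

theorem pauliShift_zero (A : R3 → R3) (ψ : R3 → Spinor) :
    pauliShift C 0 A ψ = pauliDeriv C A ψ := by
  funext x; simp only [pauliShift, covShift_zero, sigmaSum, pauliDeriv]

theorem covShift_eq (w : R3) (A : R3 → R3) (ψ : R3 → Spinor) (k : Fin 3) (x : R3) :
    covShift C w A ψ k x = (Complex.I * (C.hbar : ℂ)) • weakPartial k ψ x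
      + ((C.Q / C.c * A x k + w k : ℝ) : ℂ) • ψ x := by
  rw [covShift, covDeriv, Complex.ofReal_add, add_smul, add_assoc]

theorem covShift_eq_add (w : R3) (A : R3 → R3) (ψ : R3 → Spinor) (k : Fin 3) :
    covShift C w A ψ k = (Complex.I * (C.hbar : ℂ)) • weakPartial k ψ
      + ((C.Q / C.c : ℝ) : ℂ) • (fun x => ((A x k : ℝ) : ℂ) • ψ x) + ((w k : ℝ) : ℂ) • ψ := by
  funext x
  simp only [covShift, covDeriv, Pi.add_apply, Pi.smul_apply, Complex.ofReal_mul, mul_smul]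

variable {C} {A : R3 → R3}

theorem memLp_potential_smul (hA : MemD1 A) {ψ : R3 → Spinor} (hψ : MemLp ψ 3 volume)
    (k : Fin 3) : MemLp (fun x => ((A x k : ℝ) : ℂ) • ψ x) 2 volume := by
  have h1 : MemLp (fun x => ((A x k : ℝ) : ℂ)) 6 volume :=
    (memLp_apply hA.memLp_six k).ofReal
  exact hψ.smul h1

theorem memLp_covShift (hA : MemD1 A) {ψ : R3 → Spinor} (hψ : MemH1 ψ) (w : R3) (k : Fin 3) :
    MemLp (covShift C w A ψ k) 2 volume := by
  have h1 := (hψ.memLp_weakPartial k).const_smul (Complex.I * (C.hbar : ℂ))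
  have h2 := (memLp_potential_smul hA hψ.memLp_three k).const_smul ((C.Q / C.c : ℝ) : ℂ)
  have h3 := hψ.1.const_smul ((w k : ℝ) : ℂ)
  rw [covShift_eq_add]
  exact (h1.add h2).add h3

theorem memLp_pauliShift (hA : MemD1 A) {ψ : R3 → Spinor} (hψ : MemH1 ψ) (w : R3) :
    MemLp (pauliShift C w A ψ) 2 volume := by
  have hs : MemLp (fun x => ∑ k, ‖covShift C w A ψ k x‖) 2 volume :=
    memLp_finsetSum _ fun k _ => (memLp_covShift hA hψ w k).norm
  refine hs.of_le ?_ (Eventually.of_forall fun x => ?_)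
  · refine continuous_sigmaSum.comp_aestronglyMeasurable ?_
    exact (aemeasurable_pi_lambda _ fun k =>
      (memLp_covShift hA hψ w k).1.aemeasurable).aestronglyMeasurable
  · rw [Real.norm_of_nonneg (Finset.sum_nonneg fun _ _ => norm_nonneg _)]
    exact norm_sigmaSum_le _

/-- Hölder with exponents 6 and 3 handles the product `A ψ`. For fixed `A` this makes the covariant
derivative continuous in `ψ` for the H¹ and L³ norms, so that identities pass from smooth spinors to
H¹. -/
theorem eLpNorm_covShift_le (hA : MemD1 A) {ψ : R3 → Spinor} (hψ : MemH1 ψ) (w : R3)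
    (k : Fin 3) : eLpNorm (covShift C w A ψ k) 2 volume
      ≤ ‖C.hbar‖ₑ * eLpNorm (weakPartial k ψ) 2 volume
        + ‖C.Q / C.c‖ₑ * (eLpNorm A 6 volume * eLpNorm ψ 3 volume)
        + ‖w k‖ₑ * eLpNorm ψ 2 volume := by
  have h1 := (hψ.memLp_weakPartial k).const_smul (Complex.I * (C.hbar : ℂ))
  have h2 := (memLp_potential_smul hA hψ.memLp_three k).const_smul ((C.Q / C.c : ℝ) : ℂ)
  have h3 := hψ.1.const_smul ((w k : ℝ) : ℂ)
  rw [covShift_eq_add]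
  refine (eLpNorm_add_le (h1.add h2).1 h3.1 (by norm_num)).trans ?_
  refine (add_le_add_left (eLpNorm_add_le h1.1 h2.1 (by norm_num)) _).trans ?_
  rw [eLpNorm_const_smul, eLpNorm_const_smul, eLpNorm_const_smul]
  have hn : ∀ r : ℝ, ‖(r : ℂ)‖ₑ = ‖r‖ₑ := fun r => by
    rw [← ofReal_norm, Complex.norm_real, ofReal_norm]
  rw [enorm_mul, hn, hn, hn]
  have hI : ‖Complex.I‖ₑ = 1 := by rw [← ofReal_norm]; simp
  rw [hI, one_mul]
  gcongr
  have m1 : AEStronglyMeasurable (fun x => ((A x k : ℝ) : ℂ)) volume :=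
    ((memLp_apply hA.memLp_six k).ofReal (K := ℂ)).1
  refine (eLpNorm_smul_le_mul_eLpNorm (p := 6) (q := 3) hψ.1.1 m1).trans ?_
  gcongr
  refine eLpNorm_mono fun x => ?_
  rw [Complex.norm_real]
  exact PiLp.norm_apply_le (A x) k

theorem covShift_sub (w : R3) {φ ψ : R3 → Spinor} (hφ : MemH1 φ) (hψ : MemH1 ψ)
    (k : Fin 3) : covShift C w A (φ - ψ) k =ᵐ[volume] covShift C w A φ k - covShift C w A ψ k := by
  filter_upwards [((hφ.hasWeakPartial k).sub (hψ.hasWeakPartial k)).weakPartial_ae_eq] with x hx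
  have hx' : weakPartial k (φ - ψ) x = weakPartial k φ x - weakPartial k ψ x := hx
  simp only [covShift, covDeriv, hx', Pi.sub_apply, smul_sub]
  abel

theorem tendsto_covShift (hA : MemD1 A) {ψ : R3 → Spinor} (hψ : MemH1 ψ) {u : ℕ → R3 → Spinor}
    (hu : ∀ n, MemH1 (u n)) (h2 : Tendsto (fun n => eLpNorm (u n - ψ) 2 volume) atTop (𝓝 0))
    (h3 : Tendsto (fun n => eLpNorm (u n - ψ) 3 volume) atTop (𝓝 0))
    (hk : ∀ k, Tendsto (fun n => eLpNorm (weakPartial k (u n - ψ)) 2 volume) atTop (𝓝 0))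
    (w : R3) (k : Fin 3) :
    Tendsto (fun n => eLpNorm (covShift C w A (u n) k - covShift C w A ψ k) 2 volume) atTop
      (𝓝 0) := by
  have t := ((ENNReal.Tendsto.const_mul (a := ‖C.hbar‖ₑ) (hk k) (Or.inr (by simp))).add
    (ENNReal.Tendsto.const_mul (a := ‖C.Q / C.c‖ₑ) (ENNReal.Tendsto.const_mul
      (a := eLpNorm A 6 volume) h3 (Or.inr hA.memLp_six.2.ne)) (Or.inr (by simp)))).add
    (ENNReal.Tendsto.const_mul (a := ‖w k‖ₑ) h2 (Or.inr (by simp)))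
  simp only [mul_zero, add_zero] at t
  refine tendsto_of_tendsto_of_tendsto_of_le_of_le tendsto_const_nhds t (fun _ => zero_le) ?_
  intro n
  dsimp only
  rw [← eLpNorm_congr_ae (covShift_sub w (hu n) hψ k)]
  exact eLpNorm_covShift_le hA ((hu n).sub hψ) w k

theorem tendsto_pauliShift (hA : MemD1 A) {ψ : R3 → Spinor} (hψ : MemH1 ψ)
    {u : ℕ → R3 → Spinor} (hu : ∀ n, MemH1 (u n)) (w : R3)
    (h : ∀ k, Tendsto (fun n => eLpNorm (covShift C w A (u n) k - covShift C w A ψ k) 2 volume)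
      atTop (𝓝 0)) :
    Tendsto (fun n => eLpNorm (pauliShift C w A (u n) - pauliShift C w A ψ) 2 volume) atTop
      (𝓝 0) := by
  have t := tendsto_finsetSum Finset.univ fun k _ => h k
  simp only [Finset.sum_const_zero] at t
  refine tendsto_of_tendsto_of_tendsto_of_le_of_le tendsto_const_nhds t (fun _ => zero_le) ?_
  intro n
  have m : ∀ k, AEStronglyMeasurable
      (fun x => ‖(covShift C w A (u n) k - covShift C w A ψ k) x‖) volume := fun k =>
    ((memLp_covShift hA (hu n) w k).1.sub (memLp_covShift hA hψ w k).1).norm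
  calc eLpNorm (pauliShift C w A (u n) - pauliShift C w A ψ) 2 volume
      ≤ eLpNorm (∑ k, fun x => ‖(covShift C w A (u n) k - covShift C w A ψ k) x‖) 2 volume := by
        refine eLpNorm_mono_real fun x => ?_
        rw [Finset.sum_apply, Pi.sub_apply, pauliShift, pauliShift, ← sigmaSum_sub]
        exact norm_sigmaSum_le _
    _ ≤ ∑ k, eLpNorm (fun x => ‖(covShift C w A (u n) k - covShift C w A ψ k) x‖) 2 volume :=
        eLpNorm_sum_le (fun k _ => m k) (by norm_num)
    _ = _ := by simp only [eLpNorm_norm]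

end CovariantDerivative

/-! ### Real components of smooth spinors and their null forms. -/

section Components

/-- The real part of a spinor component as a real linear map. -/
def reComp (i : Fin 2) : Spinor →L[ℝ] ℝ :=
  Complex.reCLM.comp ((EuclideanSpace.proj i : Spinor →L[ℂ] ℂ).restrictScalars ℝ)

/-- The imaginary part of a spinor component as a real linear map. -/
def imComp (i : Fin 2) : Spinor →L[ℝ] ℝ :=
  Complex.imCLM.comp ((EuclideanSpace.proj i : Spinor →L[ℂ] ℂ).restrictScalars ℝ)

theorem reComp_apply (i : Fin 2) (z : Spinor) : reComp i z = (z i).re := rfl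

theorem imComp_apply (i : Fin 2) (z : Spinor) : imComp i z = (z i).im := rfl

variable {u : R3 → Spinor}

theorem hasFDerivAt_clm_comp (hu : ContDiff ℝ ∞ u) (L : Spinor →L[ℝ] ℝ) (x : R3) :
    HasFDerivAt (fun y => L (u y)) (L.comp (fderiv ℝ u x)) x :=
  L.hasFDerivAt.comp x (hu.differentiable (by simp) x).hasFDerivAt

theorem contDiff_spin_apply (hu : ContDiff ℝ ∞ u) (m : Fin 3) :
    ContDiff ℝ ∞ fun x => spin (u x) m := by
  have hr : ∀ i, ContDiff ℝ ∞ fun x => (u x i).re := fun i => (reComp i).contDiff.comp hu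
  have hi : ∀ i, ContDiff ℝ ∞ fun x => (u x i).im := fun i => (imComp i).contDiff.comp hu
  fin_cases m
  · exact contDiff_const.mul (((hr 0).mul (hr 1)).add ((hi 0).mul (hi 1)))
  · exact contDiff_const.mul (((hr 0).mul (hi 1)).sub ((hi 0).mul (hr 1)))
  · exact (((hr 0).pow 2).add ((hi 0).pow 2)).sub (((hr 1).pow 2).add ((hi 1).pow 2))

theorem hasCompactSupport_spin_apply (hc : HasCompactSupport u) (m : Fin 3) :
    HasCompactSupport fun x => spin (u x) m :=
  hc.comp_left (g := fun z => spin z m) (by fin_cases m <;> simp [spin])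

theorem fderiv_spin_apply (hu : ContDiff ℝ ∞ u) (m : Fin 3) (x e : R3) :
    fderiv ℝ (fun y => spin (u y) m) x e = spinPolar (fderiv ℝ u x e) (u x) m := by
  have hr := fun i => hasFDerivAt_clm_comp hu (reComp i) x
  have hi := fun i => hasFDerivAt_clm_comp hu (imComp i) x
  fin_cases m
  · have h := (((hr 0).mul (hr 1)).add ((hi 0).mul (hi 1))).const_mul 2
    refine (congrArg (fun L : R3 →L[ℝ] ℝ => L e) h.fderiv).trans ?_
    simp [spinPolar, reComp_apply, imComp_apply]
    ring
  · have h := (((hr 0).mul (hi 1)).sub ((hi 0).mul (hr 1))).const_mul 2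
    refine (congrArg (fun L : R3 →L[ℝ] ℝ => L e) h.fderiv).trans ?_
    simp [spinPolar, reComp_apply, imComp_apply]
    ring
  · have h := (((hr 0).pow 2).add ((hi 0).pow 2)).sub (((hr 1).pow 2).add ((hi 1).pow 2))
    refine (congrArg (fun L : R3 →L[ℝ] ℝ => L e) h.fderiv).trans ?_
    simp [spinPolar, reComp_apply, imComp_apply]
    ring

theorem integral_null (hu : ContDiff ℝ ∞ u) (hc : HasCompactSupport u) (L M : Spinor →L[ℝ] ℝ)
    (k l : Fin 3) :
    Integrable (fun x => L (fderiv ℝ u x (EuclideanSpace.single k 1)) *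
        M (fderiv ℝ u x (EuclideanSpace.single l 1))
      - M (fderiv ℝ u x (EuclideanSpace.single k 1)) *
        L (fderiv ℝ u x (EuclideanSpace.single l 1))) volume ∧
    ∫ x, (L (fderiv ℝ u x (EuclideanSpace.single k 1)) *
        M (fderiv ℝ u x (EuclideanSpace.single l 1))
      - M (fderiv ℝ u x (EuclideanSpace.single k 1)) *
        L (fderiv ℝ u x (EuclideanSpace.single l 1))) = 0 := by
  have hd : ∀ (L : Spinor →L[ℝ] ℝ) (x e : R3), fderiv ℝ (fun y => L (u y)) x e
      = L (fderiv ℝ u x e) := fun L x e => by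
    rw [(hasFDerivAt_clm_comp hu L x).fderiv]; rfl
  have hL : ContDiff ℝ ∞ fun y => L (u y) := L.contDiff.comp hu
  have hM : ContDiff ℝ ∞ fun y => M (u y) := M.contDiff.comp hu
  have h := integral_mul_fderiv_swap_of_contDiff (hasWeakPartial_of_smooth hL l)
    (hasWeakPartial_of_smooth hL k) hM (hc.comp_left (map_zero M))
  simp only [hd] at h
  have hi : ∀ (L M : Spinor →L[ℝ] ℝ) k l, Integrable (fun x =>
      L (fderiv ℝ u x (EuclideanSpace.single k 1)) *
        M (fderiv ℝ u x (EuclideanSpace.single l 1))) volume := fun L M k l =>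
    integrable_mul_of_two (L.comp_memLp' (memLp_fderiv_of_smooth hu hc k))
      (M.comp_memLp' (memLp_fderiv_of_smooth hu hc l))
  refine ⟨(hi L M k l).sub (hi M L k l), ?_⟩
  rw [integral_sub (hi L M k l) (hi M L k l)]
  simp only [mul_comm (M (fderiv ℝ u _ (EuclideanSpace.single k 1)))]
  rw [h, sub_self]

/-- Each `spinArea` is a combination of two-by-two minors formed from the gradients of the four real
components of the spinor. -/
theorem integral_spinArea (hu : ContDiff ℝ ∞ u) (hc : HasCompactSupport u) (k l m : Fin 3) :
    Integrable (fun x => spinArea (fderiv ℝ u x (EuclideanSpace.single k 1))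
      (fderiv ℝ u x (EuclideanSpace.single l 1)) m) volume ∧
    ∫ x, spinArea (fderiv ℝ u x (EuclideanSpace.single k 1))
      (fderiv ℝ u x (EuclideanSpace.single l 1)) m = 0 := by
  have key := fun L M => integral_null hu hc L M k l
  fin_cases m
  · obtain ⟨i1, e1⟩ := key (imComp 0) (reComp 1)
    obtain ⟨i2, e2⟩ := key (imComp 1) (reComp 0)
    refine ⟨(i1.add i2).const_mul 2, ?_⟩
    have := integral_add i1 i2
    rw [e1, e2, add_zero] at this
    exact (integral_const_mul 2 _).trans (mul_eq_zero_of_right 2 this)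
  · obtain ⟨i1, e1⟩ := key (reComp 0) (reComp 1)
    obtain ⟨i2, e2⟩ := key (imComp 0) (imComp 1)
    refine ⟨(i1.add i2).const_mul 2, ?_⟩
    have := integral_add i1 i2
    rw [e1, e2, add_zero] at this
    exact (integral_const_mul 2 _).trans (mul_eq_zero_of_right 2 this)
  · obtain ⟨i1, e1⟩ := key (imComp 0) (reComp 0)
    obtain ⟨i2, e2⟩ := key (imComp 1) (reComp 1)
    refine ⟨(i1.sub i2).const_mul 2, ?_⟩
    have := integral_sub i1 i2
    rw [e1, e2, sub_zero] at this
    exact (integral_const_mul 2 _).trans (mul_eq_zero_of_right 2 this)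

end Components

/-! ### The Lichnerowicz formula and the bound on the Zeeman term. -/

section Lichnerowicz

variable {C : Constants} {A : R3 → R3} {u : R3 → Spinor}

theorem hasWeakPartial_potential (hA : MemD1 A) (w : R3) (k l : Fin 3) :
    HasWeakPartial k (fun x => C.Q / C.c * A x l + w l)
      (fun x => C.Q / C.c * weakPartial k A x l) := by
  have h1 := ((hA.hasWeakPartial k).apply l).const_smul (C.Q / C.c)
  have h2 := hasWeakPartial_of_contDiff (contDiff_const (c := w l) (𝕜 := ℝ) (E := R3) (n := 1)) k
  simpa using h1.add h2

/-- `spinPolar` is the derivative of the spin density, which is a test function when `u` is.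
Integrating by parts moves the derivative onto the potential and removes the constant shift `w`. -/
theorem integral_potential_spinPolar (hA : MemD1 A) (w : R3) (hu : ContDiff ℝ ∞ u)
    (hc : HasCompactSupport u) (k l m : Fin 3) :
    Integrable (fun x => (C.Q / C.c * A x l + w l) *
      spinPolar (fderiv ℝ u x (EuclideanSpace.single k 1)) (u x) m) volume ∧
    ∫ x, (C.Q / C.c * A x l + w l) *
      spinPolar (fderiv ℝ u x (EuclideanSpace.single k 1)) (u x) m
      = - (C.Q / C.c) * ∫ x, weakPartial k A x l * spin (u x) m := by
  have hs := contDiff_spin_apply hu m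
  have hsc := hasCompactSupport_spin_apply hc m
  have hw := hasWeakPartial_potential (C := C) hA w k l
  have h := hw.2.2 _ hs hsc
  have hi := integrable_fderiv_test_smul (hs.of_le (by simp)) hsc hw.1 (EuclideanSpace.single k 1)
  simp only [fderiv_spin_apply hu, smul_eq_mul] at h hi
  simp only [mul_comm (spinPolar _ _ _)] at h hi
  refine ⟨hi, h.trans ?_⟩
  rw [neg_mul, ← integral_const_mul]
  congr 2
  funext x
  ring

theorem integrable_weakPartial_mul_spin (hA : MemD1 A) (hu : ContDiff ℝ ∞ u)
    (hc : HasCompactSupport u) (k l m : Fin 3) :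
    Integrable (fun x => weakPartial k A x l * spin (u x) m) volume :=
  integrable_mul_of_two (memLp_apply (hA.memLp_weakPartial k) l)
    ((contDiff_spin_apply hu m).continuous.memLp_of_hasCompactSupport
      (hasCompactSupport_spin_apply hc m))

/-- The Lichnerowicz formula for smooth compactly supported spinors. -/
theorem lichnerowicz_smooth (hA : MemD1 A) (w : R3) (hu : ContDiff ℝ ∞ u)
    (hc : HasCompactSupport u) :
    normL 2 (pauliShift C w A u) ^ 2 = ∑ k, normL 2 (covShift C w A u k) ^ 2
      - C.hbar * (C.Q / C.c) * ∫ x, inner ℝ (curl A x) (spin (u x)) := by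
  have hH := memH1_of_smooth hu hc
  have hS := fun k => memLp_covShift (C := C) hA hH w k
  rw [normL_two_sq (memLp_pauliShift hA hH w).1]
  simp only [normL_two_sq (hS _).1]
  set p : Fin 3 → R3 → Spinor := fun k x => fderiv ℝ u x (EuclideanSpace.single k 1) with hp
  set a : Fin 3 → R3 → ℝ := fun k x => C.Q / C.c * A x k + w k with ha
  -- `T` collects the potential times derivatives of the spin density, `W` the null forms, and `B`
  -- what `T` becomes after integration by parts. The antisymmetric combination of the `B` is the
  -- curl paired with the spin density.
  set T : Fin 3 → Fin 3 → Fin 3 → R3 → ℝ := fun k l m x => a l x * spinPolar (p k x) (u x) m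
    with hT
  set W : Fin 3 → Fin 3 → Fin 3 → R3 → ℝ := fun k l m x => spinArea (p k x) (p l x) m with hW
  set B : Fin 3 → Fin 3 → Fin 3 → R3 → ℝ := fun k l m x => weakPartial k A x l * spin (u x) m
    with hB
  have hae : ∀ᵐ x, ∀ k, weakPartial k u x = p k x :=
    ae_all_iff.2 fun k => weakPartial_of_smooth hu k
  have hpt : ∀ᵐ x, ‖pauliShift C w A u x‖ ^ 2 = ∑ k, ‖covShift C w A u k x‖ ^ 2
      + C.hbar * ((T 1 2 0 x - T 2 1 0 x) + (T 2 0 1 x - T 0 2 1 x) + (T 0 1 2 x - T 1 0 2 x))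
      + C.hbar ^ 2 * (W 1 2 0 x + W 2 0 1 x + W 0 1 2 x) := by
    filter_upwards [hae] with x hx
    simp only [pauliShift, covShift_eq, hx]
    exact norm_sigmaSum_sq C.hbar (fun k => a k x) (u x) (fun k => p k x)
  have iT : ∀ k l m, Integrable (T k l m) volume := fun k l m =>
    (integral_potential_spinPolar hA w hu hc k l m).1
  have eT : ∀ k l m, ∫ x, T k l m x = - (C.Q / C.c) * ∫ x, B k l m x := fun k l m =>
    (integral_potential_spinPolar hA w hu hc k l m).2
  have iW : ∀ k l m, Integrable (W k l m) volume := fun k l m => (integral_spinArea hu hc k l m).1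
  have eW : ∀ k l m, ∫ x, W k l m x = 0 := fun k l m => (integral_spinArea hu hc k l m).2
  have iB : ∀ k l m, Integrable (B k l m) volume := integrable_weakPartial_mul_spin hA hu hc
  have iS : Integrable (fun x => ∑ k, ‖covShift C w A u k x‖ ^ 2) volume :=
    integrable_finsetSum _ fun k _ => integrable_norm_sq (hS k)
  have iTd : ∀ k l m, Integrable (fun x => T k l m x - T l k m x) volume := fun k l m =>
    (iT _ _ _).sub (iT _ _ _)
  have iT2 : Integrable (fun x => (T 1 2 0 x - T 2 1 0 x) + (T 2 0 1 x - T 0 2 1 x)) volume :=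
    (iTd _ _ _).add (iTd _ _ _)
  have iT3 : Integrable (fun x => (T 1 2 0 x - T 2 1 0 x) + (T 2 0 1 x - T 0 2 1 x)
      + (T 0 1 2 x - T 1 0 2 x)) volume := iT2.add (iTd _ _ _)
  have iW2 : Integrable (fun x => W 1 2 0 x + W 2 0 1 x) volume := (iW _ _ _).add (iW _ _ _)
  have iW3 : Integrable (fun x => W 1 2 0 x + W 2 0 1 x + W 0 1 2 x) volume :=
    iW2.add (iW _ _ _)
  have iST : Integrable (fun x => ∑ k, ‖covShift C w A u k x‖ ^ 2
      + C.hbar * ((T 1 2 0 x - T 2 1 0 x) + (T 2 0 1 x - T 0 2 1 x) + (T 0 1 2 x - T 1 0 2 x)))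
      volume := iS.add (iT3.const_mul _)
  have hcurl : ∀ x, inner ℝ (curl A x) (spin (u x)) = (B 1 2 0 x - B 2 1 0 x)
      + (B 2 0 1 x - B 0 2 1 x) + (B 0 1 2 x - B 1 0 2 x) := fun x => by
    simp [PiLp.inner_apply, Fin.sum_univ_three, curl, hB]
    ring
  have iBd : ∀ k l m, Integrable (fun x => B k l m x - B l k m x) volume := fun k l m =>
    (iB _ _ _).sub (iB _ _ _)
  have iB2 : Integrable (fun x => (B 1 2 0 x - B 2 1 0 x) + (B 2 0 1 x - B 0 2 1 x)) volume :=
    (iBd _ _ _).add (iBd _ _ _)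
  rw [integral_congr_ae hpt, integral_add iST (iW3.const_mul _),
    integral_add iS (iT3.const_mul _), integral_const_mul, integral_const_mul,
    integral_add iW2 (iW _ _ _), integral_add (iW _ _ _) (iW _ _ _),
    integral_add iT2 (iTd _ _ _), integral_add (iTd _ _ _) (iTd _ _ _),
    integral_finsetSum _ fun k _ => integrable_norm_sq (hS k)]
  simp only [hcurl]
  rw [integral_add iB2 (iBd _ _ _), integral_add (iBd _ _ _) (iBd _ _ _)]
  simp only [integral_sub (iT _ _ _) (iT _ _ _), integral_sub (iB _ _ _) (iB _ _ _), eT, eW]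
  ring

theorem normL_norm_sq_le {ψ : R3 → Spinor} (h3 : MemLp ψ 3 volume) (h6 : MemLp ψ 6 volume) :
    MemLp (fun x => ‖ψ x‖ ^ 2) 2 volume ∧
      normL 2 (fun x => ‖ψ x‖ ^ 2) ≤ normL 3 ψ * normL 6 ψ := by
  have e : (fun x => ‖ψ x‖ ^ 2) = (fun x => ‖ψ x‖) • fun x => ‖ψ x‖ := by
    funext x; simp [sq]
  have h := eLpNorm_smul_le_mul_eLpNorm (p := 3) (q := 6) (r := 2) h6.1.norm h3.1.norm
  rw [← e, eLpNorm_norm, eLpNorm_norm] at h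
  have hm : MemLp (fun x => ‖ψ x‖ ^ 2) 2 volume := by
    rw [e]; exact h6.norm.smul h3.norm
  refine ⟨hm, ?_⟩
  rw [normL, normL, normL, ← ENNReal.toReal_mul]
  exact ENNReal.toReal_mono (ENNReal.mul_ne_top h3.2.ne h6.2.ne) h

theorem integral_mul_le_normL {f g : R3 → ℝ} (hf : MemLp f 2 volume) (hg : MemLp g 2 volume) :
    |∫ x, f x * g x| ≤ normL 2 f * normL 2 g := by
  have := ENNReal.toReal_mono (ENNReal.mul_ne_top hf.2.ne hg.2.ne)
    (enorm_integral_mul_le hf.1 hg.1)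
  rwa [toReal_enorm, Real.norm_eq_abs, ENNReal.toReal_mul] at this

theorem normL_norm {F : Type*} [NormedAddCommGroup F] [NormedSpace ℝ F] (p : ℝ≥0∞) (f : R3 → F) :
    normL p (fun x => ‖f x‖) = normL p f := by
  rw [normL, normL, eLpNorm_norm]

/-- The spin density has length exactly |u|², which Hölder places in L² between L³ and L⁶; the curl
costs no constant. -/
theorem abs_integral_curl_spin_le (hA : MemD1 A) (hu : ContDiff ℝ ∞ u)
    (hc : HasCompactSupport u) :
    |∫ x, inner ℝ (curl A x) (spin (u x))|
      ≤ normL 2 (gradTensor A) * (normL 3 u * normL 6 u) := by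
  have hH := memH1_of_smooth hu hc
  obtain ⟨h1, h2⟩ := normL_norm_sq_le hH.memLp_three hH.memLp_six
  have hcl := memLp_curl hA
  calc |∫ x, inner ℝ (curl A x) (spin (u x))| ≤ ∫ x, ‖curl A x‖ * ‖u x‖ ^ 2 := by
        rw [← Real.norm_eq_abs]
        refine norm_integral_le_of_norm_le (integrable_mul_of_two hcl.norm h1)
          (Eventually.of_forall fun x => ?_)
        have h := norm_inner_le_norm (𝕜 := ℝ) (curl A x) (spin (u x))
        rwa [norm_spin] at h
    _ ≤ |∫ x, ‖curl A x‖ * ‖u x‖ ^ 2| := le_abs_self _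
    _ ≤ normL 2 (fun x => ‖curl A x‖) * normL 2 (fun x => ‖u x‖ ^ 2) :=
        integral_mul_le_normL hcl.norm h1
    _ ≤ normL 2 (gradTensor A) * (normL 3 u * normL 6 u) := by
        rw [normL_norm 2 (curl A)]
        exact mul_le_mul (normL_curl_le hA) h2 (normL_nonneg _ _) (normL_nonneg _ _)

end Lichnerowicz

/-! ### The diamagnetic inequality combined with Sobolev. -/

section Diamagnetic

variable {C : Constants} {A : R3 → R3} {u : R3 → Spinor}

/-- A smooth regularisation of the modulus of a spinor field. -/
def regNorm (δ : ℝ) (u : R3 → Spinor) (x : R3) : ℝ := √(‖u x‖ ^ 2 + δ ^ 2) - δ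

theorem contDiff_regNorm {δ : ℝ} (hδ : 0 < δ) (hu : ContDiff ℝ ∞ u) :
    ContDiff ℝ ∞ (regNorm δ u) := by
  have h : ContDiff ℝ ∞ fun x => ‖u x‖ ^ 2 + δ ^ 2 := (hu.norm_sq ℂ).add contDiff_const
  exact (h.sqrt fun x => by positivity).sub contDiff_const

/-- Subtracting δ makes the regularised modulus vanish wherever `u` does. -/
theorem hasCompactSupport_regNorm {δ : ℝ} (hδ : 0 < δ) (hc : HasCompactSupport u) :
    HasCompactSupport (regNorm δ u) :=
  hc.comp_left (g := fun z : Spinor => √(‖z‖ ^ 2 + δ ^ 2) - δ) (by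
    simp [Real.sqrt_sq hδ.le])

theorem fderiv_norm_sq_apply (hu : ContDiff ℝ ∞ u) (x e : R3) :
    HasFDerivAt (fun y => ‖u y‖ ^ 2) (fderiv ℝ (fun y => ‖u y‖ ^ 2) x) x ∧
      fderiv ℝ (fun y => ‖u y‖ ^ 2) x e = 2 * (inner ℂ (u x) (fderiv ℝ u x e)).re := by
  have hr := fun i => hasFDerivAt_clm_comp hu (reComp i) x
  have hi := fun i => hasFDerivAt_clm_comp hu (imComp i) x
  have h := (((hr 0).pow 2).add ((hi 0).pow 2)).add (((hr 1).pow 2).add ((hi 1).pow 2))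
  have h' : HasFDerivAt (fun y => ‖u y‖ ^ 2) _ x := h.congr_of_eventuallyEq
    (Eventually.of_forall fun y => norm_spinor_sq (u y))
  refine ⟨h'.differentiableAt.hasFDerivAt, ?_⟩
  rw [h'.fderiv]
  simp [PiLp.inner_apply, Fin.sum_univ_two, reComp_apply, imComp_apply]
  ring

/-- The pointwise diamagnetic inequality. -/
theorem abs_re_inner_le (h : ℝ) (a : ℝ) (z p : Spinor) :
    |h * (inner ℂ z p).re| ≤ ‖z‖ * ‖(Complex.I * (h : ℂ)) • p + (a : ℂ) • z‖ := by
  -- After multiplication by -i the potential contributes -ia|z|², which has no real part because a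
  -- is real. This is why the inequality does not see the potential or the shift.
  have e : h * (inner ℂ z p).re
      = (inner ℂ z (-Complex.I • ((Complex.I * (h : ℂ)) • p + (a : ℂ) • z))).re := by
    have hzz : ((‖z‖ : ℂ) ^ 2).im = 0 := by
      rw [← Complex.ofReal_pow]; exact Complex.ofReal_im _
    rw [inner_smul_right, inner_add_right, inner_smul_right, inner_smul_right]
    simp [hzz]
  rw [e]
  refine (Complex.abs_re_le_norm _).trans ((norm_inner_le_norm _ _).trans (le_of_eq ?_))
  rw [norm_smul]
  simp

/-- The derivative is Re⟨u, ∂u⟩/√(|u|² + δ²), and the denominator dominates the factor |u| left by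
Cauchy–Schwarz. -/
theorem hbar_mul_abs_fderiv_regNorm_le {δ : ℝ} (hδ : 0 < δ) (hu : ContDiff ℝ ∞ u) (h : ℝ)
    (a : ℝ) (x e : R3) :
    |h * fderiv ℝ (regNorm δ u) x e|
      ≤ ‖(Complex.I * (h : ℂ)) • fderiv ℝ u x e + (a : ℂ) • u x‖ := by
  obtain ⟨h1, h2⟩ := fderiv_norm_sq_apply hu x e
  have hpos : 0 < ‖u x‖ ^ 2 + δ ^ 2 := by positivity
  have h3 := ((h1.add_const (δ ^ 2)).sqrt hpos.ne').sub_const δ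
  have h4 : fderiv ℝ (regNorm δ u) x e
      = (inner ℂ (u x) (fderiv ℝ u x e)).re / √(‖u x‖ ^ 2 + δ ^ 2) := by
    refine (congrArg (fun L : R3 →L[ℝ] ℝ => L e) h3.fderiv).trans ?_
    simp only [smul_apply, h2, smul_eq_mul]
    have := (Real.sqrt_pos.2 hpos).ne'
    field_simp
  have hs : ‖u x‖ ≤ √(‖u x‖ ^ 2 + δ ^ 2) := by
    refine Real.le_sqrt_of_sq_le ?_
    nlinarith [sq_nonneg δ]
  rw [h4, ← mul_div_assoc, abs_div, abs_of_pos (Real.sqrt_pos.2 hpos),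
    div_le_iff₀ (Real.sqrt_pos.2 hpos), mul_comm ‖_ + _‖]
  exact (abs_re_inner_le h a (u x) _).trans (by gcongr)

theorem normL_grad_regNorm_sq_le {δ : ℝ} (hδ : 0 < δ) (hA : MemD1 A) (w : R3)
    (hu : ContDiff ℝ ∞ u) (hc : HasCompactSupport u) :
    MemLp (grad (regNorm δ u)) 2 volume ∧
    C.hbar ^ 2 * normL 2 (grad (regNorm δ u)) ^ 2 ≤ ∑ k, normL 2 (covShift C w A u k) ^ 2 := by
  have hH := memH1_of_smooth hu hc
  have hS := fun k => memLp_covShift (C := C) hA hH w k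
  have hrs := contDiff_regNorm hδ hu
  have hrc := hasCompactSupport_regNorm hδ hc
  have hD := (memD1_of_smooth hrs hrc).memLp_weakPartial
  have hpt : ∀ᵐ x, C.hbar ^ 2 * ‖grad (regNorm δ u) x‖ ^ 2
      ≤ ∑ k, ‖covShift C w A u k x‖ ^ 2 := by
    filter_upwards [ae_all_iff.2 fun k => weakPartial_of_smooth hu k,
      ae_all_iff.2 fun k => weakPartial_of_smooth hrs k] with x hx hx'
    rw [EuclideanSpace.norm_sq_eq, Finset.mul_sum]
    refine Finset.sum_le_sum fun k _ => ?_
    rw [covShift_eq, hx, grad]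
    simp only [hx', Real.norm_eq_abs]
    rw [sq_abs, ← mul_pow, ← sq_abs]
    have := hbar_mul_abs_fderiv_regNorm_le hδ hu C.hbar (C.Q / C.c * A x k + w k) x
      (EuclideanSpace.single k 1)
    gcongr
  have iS : Integrable (fun x => ∑ k, ‖covShift C w A u k x‖ ^ 2) volume :=
    integrable_finsetSum _ fun k _ => integrable_norm_sq (hS k)
  have hm : AEStronglyMeasurable (grad (regNorm δ u)) volume := by
    refine (PiLp.continuous_toLp 2 _).comp_aestronglyMeasurable ?_
    exact (aemeasurable_pi_lambda _ fun k => (hD k).1.aemeasurable).aestronglyMeasurable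
  have hL : MemLp (grad (regNorm δ u)) 2 volume := by
    have hs : MemLp (fun x => ∑ k, ‖weakPartial k (regNorm δ u) x‖) 2 volume :=
      memLp_finsetSum _ fun k _ => (hD k).norm
    refine hs.of_le hm (Eventually.of_forall fun x => ?_)
    have h0 : 0 ≤ ∑ k, ‖weakPartial k (regNorm δ u) x‖ := Finset.sum_nonneg fun _ _ => norm_nonneg _
    rw [Real.norm_of_nonneg h0]
    refine abs_le_of_sq_le_sq' ?_ h0 |>.2
    rw [EuclideanSpace.norm_sq_eq]
    exact Finset.sum_sq_le_sq_sum_of_nonneg fun _ _ => norm_nonneg _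
  refine ⟨hL, ?_⟩
  rw [normL_two_sq hm]
  simp only [normL_two_sq (hS _).1]
  rw [← integral_finsetSum _ fun k _ => integrable_norm_sq (hS k), ← integral_const_mul]
  exact integral_mono_ae ((integrable_norm_sq hL).const_mul _) iS hpt

/-- The scalar Sobolev inequality is applied to the regularised modulus, a smooth compactly
supported real function. The bound is uniform in δ, and Fatou takes δ = 1/(n+1) to zero. -/
theorem diamagnetic_smooth {K : ℝ} (hK : IsSobolevConstant K) (hA : MemD1 A) (w : R3)
    (hu : ContDiff ℝ ∞ u) (hc : HasCompactSupport u) :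
    C.hbar * normL 6 u ≤ K * √(∑ k, normL 2 (covShift C w A u k) ^ 2) := by
  set S := ∑ k, normL 2 (covShift C w A u k) ^ 2 with hS
  have hb := C.hbar_pos
  have hK0 := hK.1
  have hreg : ∀ n : ℕ, eLpNorm (regNorm (1 / (n + 1)) u) 6 volume
      ≤ ENNReal.ofReal (K * (√S / C.hbar)) := fun n => by
    have hδ : (0 : ℝ) < 1 / (n + 1) := by positivity
    obtain ⟨hL, hle⟩ := normL_grad_regNorm_sq_le (C := C) hδ hA w hu hc
    refine (hK.2 _ (memD1_of_smooth (contDiff_regNorm hδ hu)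
      (hasCompactSupport_regNorm hδ hc))).trans ?_
    rw [ENNReal.ofReal_mul hK0.le]
    gcongr
    rw [← ENNReal.ofReal_toReal hL.2.ne]
    refine ENNReal.ofReal_le_ofReal ?_
    rw [le_div_iff₀ hb]
    refine Real.le_sqrt_of_sq_le ?_
    rw [mul_pow, mul_comm]
    exact hle
  have hlim : ∀ x, Tendsto (fun n : ℕ => regNorm (1 / (n + 1)) u x) atTop (𝓝 ‖u x‖) := fun x => by
    have h1 := tendsto_one_div_add_atTop_nhds_zero_nat (𝕜 := ℝ)
    have h2 := (Real.continuous_sqrt.continuousAt.tendsto.comp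
      ((h1.pow 2).const_add (‖u x‖ ^ 2))).sub h1
    simpa [Function.comp_def, Real.sqrt_sq (norm_nonneg (u x)), regNorm] using h2
  have h := Lp.eLpNorm_lim_le_liminf_eLpNorm (p := 6) (μ := volume)
    (fun n : ℕ => (contDiff_regNorm (by positivity : (0 : ℝ) < 1 / (n + 1))
      hu).continuous.aestronglyMeasurable) _ (Eventually.of_forall hlim)
  have h' : eLpNorm (fun x => ‖u x‖) 6 volume ≤ ENNReal.ofReal (K * (√S / C.hbar)) := by
    refine h.trans (liminf_le_of_le (by isBoundedDefault) fun b hb => ?_)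
    obtain ⟨n, hn⟩ := hb.exists
    exact hn.trans (hreg n)
  rw [eLpNorm_norm] at h'
  have h'' := ENNReal.toReal_mono ENNReal.ofReal_ne_top h'
  rw [ENNReal.toReal_ofReal (by positivity)] at h''
  calc C.hbar * normL 6 u ≤ C.hbar * (K * (√S / C.hbar)) := by
        exact mul_le_mul_of_nonneg_left h'' hb.le
    _ = K * √S := by field_simp

/-- The diamagnetic inequality combined with the Sobolev inequality. -/
theorem diamagnetic {K : ℝ} (hK : IsSobolevConstant K) (hA : MemD1 A) (w : R3)
    {ψ : R3 → Spinor} (hψ : MemH1 ψ) :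
    C.hbar ^ 2 * normL 6 ψ ^ 2 ≤ K ^ 2 * ∑ k, normL 2 (covShift C w A ψ k) ^ 2 := by
  obtain ⟨u, hus, huc, h2, h3, h6, hk⟩ := hψ.exists_smooth_seq
  have hu : ∀ n, MemH1 (u n) := fun n => memH1_of_smooth (hus n) (huc n)
  have t1 := tendsto_normL (by norm_num) (fun n => (hu n).memLp_six) hψ.memLp_six h6
  have t2 := fun k => tendsto_normL (by norm_num) (fun n => memLp_covShift (C := C) hA (hu n) w k)
    (memLp_covShift hA hψ w k) (tendsto_covShift hA hψ hu h2 h3 hk w k)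
  have t3 := tendsto_finsetSum Finset.univ fun k _ => (t2 k).pow 2
  refine le_of_tendsto_of_tendsto ((t1.pow 2).const_mul _) (t3.const_mul _)
    (Eventually.of_forall fun n => ?_)
  have h := diamagnetic_smooth (C := C) hK hA w (hus n) (huc n)
  have h0 : 0 ≤ C.hbar * normL 6 (u n) := mul_nonneg C.hbar_pos.le (normL_nonneg _ _)
  have hS : 0 ≤ ∑ k, normL 2 (covShift C w A (u n) k) ^ 2 :=
    Finset.sum_nonneg fun _ _ => sq_nonneg _
  calc C.hbar ^ 2 * normL 6 (u n) ^ 2 = (C.hbar * normL 6 (u n)) ^ 2 := by ring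
    _ ≤ (K * √(∑ k, normL 2 (covShift C w A (u n) k) ^ 2)) ^ 2 := by gcongr
    _ = _ := by rw [mul_pow, Real.sq_sqrt hS]

end Diamagnetic

/-! ### The Zeeman term on H¹. -/

section LichnerowiczH1

variable {C : Constants} {A : R3 → R3} {ψ : R3 → Spinor}

/-- The difference between the Pauli and the Schrödinger kinetic energies does not depend on a
constant shift of the vector potential, and is controlled by the magnetic field. -/
theorem pauli_sub_schroedinger (hA : MemD1 A) (hψ : MemH1 ψ) (w : R3) :
    normL 2 (pauliShift C w A ψ) ^ 2 - ∑ k, normL 2 (covShift C w A ψ k) ^ 2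
        = normL 2 (pauliDeriv C A ψ) ^ 2 - ∑ k, normL 2 (covDeriv C A ψ k) ^ 2 ∧
    |normL 2 (pauliDeriv C A ψ) ^ 2 - ∑ k, normL 2 (covDeriv C A ψ k) ^ 2|
      ≤ C.hbar * (|C.Q| / C.c) * (normL 2 (gradTensor A) * (normL 3 ψ * normL 6 ψ)) := by
  obtain ⟨u, hus, huc, h2, h3, h6, hk⟩ := hψ.exists_smooth_seq
  have hu : ∀ n, MemH1 (u n) := fun n => memH1_of_smooth (hus n) (huc n)
  have tS := fun w k => tendsto_normL (by norm_num)
    (fun n => memLp_covShift (C := C) hA (hu n) w k)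
    (memLp_covShift hA hψ w k) (tendsto_covShift hA hψ hu h2 h3 hk w k)
  have tP := fun w => tendsto_normL (by norm_num)
    (fun n => memLp_pauliShift (C := C) hA (hu n) w) (memLp_pauliShift hA hψ w)
    (tendsto_pauliShift hA hψ hu w fun k => tendsto_covShift hA hψ hu h2 h3 hk w k)
  have t := fun w => ((tP w).pow 2).sub (tendsto_finsetSum Finset.univ fun k _ => (tS w k).pow 2)
  -- The right side does not contain w, so for every shift the approximations have the same limit.
  have key : ∀ w n, normL 2 (pauliShift C w A (u n)) ^ 2
      - ∑ k, normL 2 (covShift C w A (u n) k) ^ 2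
      = -(C.hbar * (C.Q / C.c) * ∫ x, inner ℝ (curl A x) (spin (u n x))) := fun w n => by
    rw [lichnerowicz_smooth hA w (hus n) (huc n)]; ring
  simp only [key] at t
  have e0 := tendsto_nhds_unique (t w) (t 0)
  simp only [covShift_zero, pauliShift_zero] at e0
  refine ⟨e0, ?_⟩
  have t0 := (t 0).abs
  simp only [covShift_zero, pauliShift_zero] at t0
  have t3 := tendsto_normL (by norm_num) (fun n => (hu n).memLp_three) hψ.memLp_three h3
  have t6 := tendsto_normL (by norm_num) (fun n => (hu n).memLp_six) hψ.memLp_six h6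
  refine le_of_tendsto_of_tendsto t0 (((t3.mul t6).const_mul _).const_mul _)
    (Eventually.of_forall fun n => ?_)
  dsimp only
  rw [abs_neg, abs_mul, abs_mul, abs_div, abs_of_pos C.hbar_pos, abs_of_pos C.c_pos]
  have hn : 0 ≤ C.hbar * (|C.Q| / C.c) :=
    mul_nonneg C.hbar_pos.le (div_nonneg (abs_nonneg _) C.c_pos.le)
  exact mul_le_mul_of_nonneg_left (abs_integral_curl_spin_le hA (hus n) (huc n)) hn

end LichnerowiczH1

/-! ### Completion of the square in the energy. -/

section Energy

variable {C : Constants} {A : R3 → R3} {ψ : R3 → Spinor}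

theorem normL_three_sq_le (hψ : MemH1 ψ) : normL 3 ψ ^ 2 ≤ normL 2 ψ * normL 6 ψ := by
  rw [normL, normL, normL, ← ENNReal.toReal_pow, ← ENNReal.toReal_mul]
  exact ENNReal.toReal_mono (ENNReal.mul_ne_top hψ.1.2.ne hψ.memLp_six.2.ne)
    (eLpNorm_three_sq_le hψ.1.1)

theorem memLp_norm_mul_norm (hA : MemD1 A) (hψ : MemH1 ψ) :
    MemLp (fun x => ‖A x‖ * ‖ψ x‖) 2 volume ∧
      normL 2 (fun x => ‖A x‖ * ‖ψ x‖) ≤ normL 6 A * normL 3 ψ := by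
  have h6 := hA.memLp_six
  have h3 := hψ.memLp_three
  have h := eLpNorm_smul_le_mul_eLpNorm (p := 6) (q := 3) (r := 2) h3.1.norm h6.1.norm
  rw [eLpNorm_norm, eLpNorm_norm] at h
  have hm : MemLp ((fun x => ‖A x‖) • fun x => ‖ψ x‖) 2 volume := h3.norm.smul h6.norm
  refine ⟨hm, ?_⟩
  rw [normL, normL, normL, ← ENNReal.toReal_mul]
  exact ENNReal.toReal_mono (ENNReal.mul_ne_top h6.2.ne h3.2.ne) h

theorem integral_current_le (hA : MemD1 A) (hψ : MemH1 ψ) (v : R3) :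
    Integrable (fun x => inner ℝ v (A x) * ‖ψ x‖ ^ 2) volume ∧
    |∫ x, inner ℝ v (A x) * ‖ψ x‖ ^ 2|
      ≤ ‖v‖ * (normL 6 A * normL 3 ψ * normL 2 ψ) := by
  obtain ⟨h1, h2⟩ := memLp_norm_mul_norm hA hψ
  have hi : Integrable (fun x => ‖A x‖ * ‖ψ x‖ * ‖ψ x‖) volume :=
    integrable_mul_of_two h1 hψ.1.norm
  have hle : ∀ x, ‖inner ℝ v (A x) * ‖ψ x‖ ^ 2‖ ≤ ‖v‖ * (‖A x‖ * ‖ψ x‖ * ‖ψ x‖) := fun x => by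
    rw [norm_mul, norm_pow, norm_norm]
    calc ‖inner ℝ v (A x)‖ * ‖ψ x‖ ^ 2 ≤ (‖v‖ * ‖A x‖) * ‖ψ x‖ ^ 2 := by
          gcongr; exact norm_inner_le_norm _ _
      _ = _ := by ring
  have hm : AEStronglyMeasurable (fun x => inner ℝ v (A x) * ‖ψ x‖ ^ 2) volume :=
    (aestronglyMeasurable_const.inner hA.1.aestronglyMeasurable).mul (hψ.1.1.norm.pow 2)
  refine ⟨(hi.const_mul ‖v‖).mono' hm (Eventually.of_forall hle), ?_⟩
  calc |∫ x, inner ℝ v (A x) * ‖ψ x‖ ^ 2| ≤ ∫ x, ‖v‖ * (‖A x‖ * ‖ψ x‖ * ‖ψ x‖) := by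
        rw [← Real.norm_eq_abs]
        exact norm_integral_le_of_norm_le (hi.const_mul ‖v‖) (Eventually.of_forall hle)
    _ = ‖v‖ * ∫ x, ‖A x‖ * ‖ψ x‖ * ‖ψ x‖ := integral_const_mul _ _
    _ ≤ ‖v‖ * (normL 2 (fun x => ‖A x‖ * ‖ψ x‖) * normL 2 (fun x => ‖ψ x‖)) := by
        gcongr
        exact (le_abs_self _).trans (integral_mul_le_normL h1 hψ.1.norm)
    _ ≤ _ := by
        rw [normL_norm 2 ψ]
        exact mul_le_mul_of_nonneg_left
          (mul_le_mul_of_nonneg_right h2 (normL_nonneg _ _)) (norm_nonneg _)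

theorem integrable_inner_of_two {f g : R3 → Spinor} (hf : MemLp f 2 volume)
    (hg : MemLp g 2 volume) : Integrable (fun x => inner ℂ (f x) (g x)) volume :=
  (integrable_mul_of_two hf.norm hg.norm).mono' (hf.1.inner hg.1)
    (Eventually.of_forall fun _ => norm_inner_le_norm _ _)

theorem norm_add_real_smul_sq (D z : Spinor) (t : ℝ) :
    ‖D + (t : ℂ) • z‖ ^ 2 = ‖D‖ ^ 2 + 2 * t * (inner ℂ z D).re + t ^ 2 * ‖z‖ ^ 2 := by
  rw [norm_add_sq (𝕜 := ℂ), inner_smul_right, norm_smul, mul_pow, Complex.norm_real,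
    Real.norm_eq_abs, sq_abs]
  have h : (inner ℂ D z).re = (inner ℂ z D).re := inner_re_symm (𝕜 := ℂ) D z
  simp [h]
  ring

/-- The cross term of the covariant derivative with mvψ splits into the transport density and the
current density, since the potential part is a real multiple of |ψ|². -/
theorem sum_norm_covShift_sq (v : R3) (x : R3) :
    ∑ k, ‖covShift C (C.m • v) A ψ k x‖ ^ 2 = ∑ k, ‖covDeriv C A ψ k x‖ ^ 2
      + 2 * C.m * (inner ℂ (ψ x) ((Complex.I * (C.hbar : ℂ)) • dirDeriv v ψ x)).re
      + 2 * C.m * (C.Q / C.c) * (inner ℝ v (A x) * ‖ψ x‖ ^ 2)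
      + C.m ^ 2 * ‖v‖ ^ 2 * ‖ψ x‖ ^ 2 := by
  have h1 : ∀ k, (inner ℂ (ψ x) (covDeriv C A ψ k x)).re
      = (inner ℂ (ψ x) ((Complex.I * (C.hbar : ℂ)) • weakPartial k ψ x)).re
        + C.Q / C.c * A x k * ‖ψ x‖ ^ 2 := fun k => by
    rw [covDeriv, inner_add_right, Complex.add_re, inner_smul_right (𝕜 := ℂ) (ψ x) (ψ x),
      Complex.re_ofReal_mul]
    congr 2
    exact inner_self_eq_norm_sq (𝕜 := ℂ) (ψ x)
  have h2 : (inner ℂ (ψ x) ((Complex.I * (C.hbar : ℂ)) • dirDeriv v ψ x)).re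
      = ∑ k, v k * (inner ℂ (ψ x) ((Complex.I * (C.hbar : ℂ)) • weakPartial k ψ x)).re := by
    rw [dirDeriv, Finset.smul_sum, inner_sum, Complex.re_sum]
    refine Finset.sum_congr rfl fun k _ => ?_
    rw [smul_comm, ← Complex.coe_smul, inner_smul_right, Complex.re_ofReal_mul]
  have h3 : inner ℝ v (A x) = ∑ k, v k * A x k := by
    simp [PiLp.inner_apply, mul_comm]
  have h4 : ‖v‖ ^ 2 = ∑ k, v k ^ 2 := by simp [EuclideanSpace.norm_sq_eq]
  rw [h2, h3, h4]
  simp only [covShift, norm_add_real_smul_sq, h1, Fin.sum_univ_three]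
  simp
  ring

/-- Completion of the square in the Schrödinger kinetic energy. -/
theorem sum_normL_covShift_sq (hA : MemD1 A) (hψ : MemH1 ψ) (v : R3) :
    ∑ k, normL 2 (covShift C (C.m • v) A ψ k) ^ 2 = ∑ k, normL 2 (covDeriv C A ψ k) ^ 2
      + 2 * C.m * (∫ x, inner ℂ (ψ x) ((Complex.I * (C.hbar : ℂ)) • dirDeriv v ψ x)).re
      + 2 * C.m * (C.Q / C.c) * (∫ x, inner ℝ v (A x) * ‖ψ x‖ ^ 2)
      + C.m ^ 2 * ‖v‖ ^ 2 * normL 2 ψ ^ 2 := by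
  have hS := fun w k => memLp_covShift (C := C) hA hψ w k
  have hS0 : ∀ k, MemLp (covDeriv C A ψ k) 2 volume := fun k => by
    rw [← covShift_zero]; exact hS 0 k
  have hI := integrable_inner_of_two hψ.1
    ((memLp_dirDeriv hψ.memLp_weakPartial v).const_smul (Complex.I * (C.hbar : ℂ)))
  have hIr : Integrable (fun x => (inner ℂ (ψ x)
      ((Complex.I * (C.hbar : ℂ)) • dirDeriv v ψ x)).re) volume := hI.re
  have hre : (∫ x, inner ℂ (ψ x) ((Complex.I * (C.hbar : ℂ)) • dirDeriv v ψ x)).re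
      = ∫ x, (inner ℂ (ψ x) ((Complex.I * (C.hbar : ℂ)) • dirDeriv v ψ x)).re :=
    (integral_re hI).symm
  have hJ := (integral_current_le hA hψ v).1
  rw [hre]
  simp only [normL_two_sq (hS _ _).1, normL_two_sq (hS0 _).1, normL_two_sq hψ.1.1]
  rw [← integral_finsetSum _ fun k _ => integrable_norm_sq (hS _ k),
    ← integral_finsetSum _ fun k _ => integrable_norm_sq (hS0 k)]
  have i1 : Integrable (fun x => ∑ k, ‖covDeriv C A ψ k x‖ ^ 2) volume :=
    integrable_finsetSum _ fun k _ => integrable_norm_sq (hS0 k)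
  have i2 : Integrable (fun x => ∑ k, ‖covDeriv C A ψ k x‖ ^ 2 + 2 * C.m *
      (inner ℂ (ψ x) ((Complex.I * (C.hbar : ℂ)) • dirDeriv v ψ x)).re) volume :=
    i1.add (hIr.const_mul _)
  have i3 : Integrable (fun x => ∑ k, ‖covDeriv C A ψ k x‖ ^ 2 + 2 * C.m *
      (inner ℂ (ψ x) ((Complex.I * (C.hbar : ℂ)) • dirDeriv v ψ x)).re
      + 2 * C.m * (C.Q / C.c) * (inner ℝ v (A x) * ‖ψ x‖ ^ 2)) volume :=
    i2.add (hJ.const_mul _)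
  simp only [sum_norm_covShift_sq]
  rw [integral_add i3 ((integrable_norm_sq hψ.1).const_mul _), integral_add i2 (hJ.const_mul _),
    integral_add i1 (hIr.const_mul _), integral_const_mul, integral_const_mul, integral_const_mul]

/-- The kinetic energy after completion of the square. -/
def kineticShift (C : Constants) (j : Model) (w : R3) (A : R3 → R3) (ψ : R3 → Spinor) : ℝ :=
  match j with
  | Model.S => ∑ k, normL 2 (covShift C w A ψ k) ^ 2
  | Model.P => normL 2 (pauliShift C w A ψ) ^ 2

theorem kineticShift_nonneg (j : Model) (w : R3) : 0 ≤ kineticShift C j w A ψ := by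
  cases j
  · exact Finset.sum_nonneg fun _ _ => sq_nonneg _
  · exact sq_nonneg _

/-- In the Pauli model the square is completed in the Schrödinger energy, and the Zeeman difference,
which ignores the constant shift, is carried along. -/
theorem energy_eq (hA : MemD1 A) (hψ : MemH1 ψ) (j : Model) (v : R3) :
    energy C j v ψ A = 1 / (2 * C.m) * kineticShift C j (C.m • v) A ψ
      + 1 / (8 * Real.pi) * (normL 2 (gradTensor A) ^ 2 - normL 2 (dirDeriv (C.c⁻¹ • v) A) ^ 2)
      - C.Q / C.c * (∫ x, inner ℝ v (A x) * ‖ψ x‖ ^ 2)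
      - C.m * ‖v‖ ^ 2 / 2 * normL 2 ψ ^ 2 := by
  have h := sum_normL_covShift_sq (C := C) hA hψ v
  have hm := C.m_pos.ne'
  cases j
  · simp only [energy, kinetic, kineticShift]
    rw [h]
    field_simp
    ring
  · have hp := (pauli_sub_schroedinger (C := C) hA hψ (C.m • v)).1
    have e : normL 2 (pauliShift C (C.m • v) A ψ) ^ 2 = normL 2 (pauliDeriv C A ψ) ^ 2
      + 2 * C.m * (∫ x, inner ℂ (ψ x) ((Complex.I * (C.hbar : ℂ)) • dirDeriv v ψ x)).re
      + 2 * C.m * (C.Q / C.c) * (∫ x, inner ℝ v (A x) * ‖ψ x‖ ^ 2)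
      + C.m ^ 2 * ‖v‖ ^ 2 * normL 2 ψ ^ 2 := by linarith
    simp only [energy, kinetic, kineticShift]
    rw [e]
    field_simp
    ring

/-- Cauchy–Schwarz bounds the directional derivative of A by |v|/c times its gradient; Hölder with
exponents 6, 3, 2 and Sobolev for A bound the current. -/
theorem energy_ge {K : ℝ} (hK : IsSobolevConstant K) (hA : MemD1 A) (hψ : MemH1 ψ) (j : Model)
    (v : R3) :
    1 / (2 * C.m) * kineticShift C j (C.m • v) A ψ
      + 1 / (8 * Real.pi) * (1 - ‖v‖ ^ 2 / C.c ^ 2) * normL 2 (gradTensor A) ^ 2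
      - |C.Q| / C.c * (‖v‖ * (K * normL 2 (gradTensor A) * normL 3 ψ * normL 2 ψ))
      - C.m * ‖v‖ ^ 2 / 2 * normL 2 ψ ^ 2 ≤ energy C j v ψ A := by
  rw [energy_eq hA hψ]
  have hc := C.c_pos
  have h1 := normL_dirDeriv_sq_le hA (C.c⁻¹ • v)
  rw [norm_smul, norm_inv, Real.norm_of_nonneg hc.le, mul_pow] at h1
  have h2 := (integral_current_le hA hψ v).2
  have h3 : |C.Q / C.c * (∫ x, inner ℝ v (A x) * ‖ψ x‖ ^ 2)|
      ≤ |C.Q| / C.c * (‖v‖ * (K * normL 2 (gradTensor A) * normL 3 ψ * normL 2 ψ)) := by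
    rw [abs_mul, abs_div, abs_of_pos hc]
    refine mul_le_mul_of_nonneg_left (h2.trans ?_) (by positivity)
    refine mul_le_mul_of_nonneg_left ?_ (norm_nonneg _)
    refine mul_le_mul_of_nonneg_right ?_ (normL_nonneg _ _)
    exact mul_le_mul_of_nonneg_right (hK.normL_le hA) (normL_nonneg _ _)
  have h4 := (le_abs_self _).trans h3
  have h5 : 1 / (8 * Real.pi) * (1 - ‖v‖ ^ 2 / C.c ^ 2) * normL 2 (gradTensor A) ^ 2
      ≤ 1 / (8 * Real.pi) * (normL 2 (gradTensor A) ^ 2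
        - normL 2 (dirDeriv (C.c⁻¹ • v) A) ^ 2) := by
    rw [mul_assoc]
    refine mul_le_mul_of_nonneg_left ?_ (by positivity)
    have : C.c⁻¹ ^ 2 * ‖v‖ ^ 2 = ‖v‖ ^ 2 / C.c ^ 2 := by
      rw [inv_pow, div_eq_inv_mul]
    rw [this] at h1
    linarith
  linarith

/-- Lower bound on the shifted kinetic energy by the `L⁶` norm. -/
theorem kineticShift_ge {K : ℝ} (hK : IsSobolevConstant K) (hA : MemD1 A) (hψ : MemH1 ψ)
    (j : Model) (w : R3) :
    C.hbar ^ 2 / K ^ 2 * normL 6 ψ ^ 2 - (match j with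
      | Model.S => 0
      | Model.P => C.hbar * (|C.Q| / C.c) *
          (normL 2 (gradTensor A) * (normL 3 ψ * normL 6 ψ))) ≤ kineticShift C j w A ψ := by
  have h1 := diamagnetic (C := C) hK hA w hψ
  have hK2 : 0 < K ^ 2 := pow_pos hK.1 2
  have h2 : C.hbar ^ 2 / K ^ 2 * normL 6 ψ ^ 2 ≤ ∑ k, normL 2 (covShift C w A ψ k) ^ 2 := by
    rw [div_mul_eq_mul_div, div_le_iff₀ hK2, mul_comm _ (K ^ 2)]
    exact h1
  cases j
  · simpa [kineticShift] using h2
  · obtain ⟨h3, h4⟩ := pauli_sub_schroedinger (C := C) hA hψ w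
    have := (abs_le.1 h4).1
    simp only [kineticShift]
    linarith

end Energy

/-! ### Critical speeds and the explicit lower bounds. -/

section LowerBound

/-- The lower bound obtained by completing two squares. -/
theorem quadratic_lower_bound {m h c K q l s X y D T κ : ℝ} (hm : 0 < m) (hh : 0 < h) (hc : 0 < c)
    (hK : 0 < K) (hD : 0 < D) (hT : 0 < T) (hDc : D = c ^ 2 - s ^ 2)
    (hκ : h ^ 2 / K ^ 2 * (T / D) * y ^ 4 ≤ κ) :
    h ^ 2 / (4 * m * K ^ 2) * (T / D) * y ^ 4
        + 1 / (16 * Real.pi) * (1 - s ^ 2 / c ^ 2) * X ^ 2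
        - (4 * Real.pi) ^ 2 * K ^ 6 * q ^ 4 * m * l ^ 12 / h ^ 2 * (s ^ 4 / (D * T))
      ≤ 1 / (2 * m) * κ + 1 / (8 * Real.pi) * (1 - s ^ 2 / c ^ 2) * X ^ 2
        - q / c * (s * (K * X * (l * y) * l ^ 2)) := by
  have hpi := Real.pi_pos
  have h1 : 1 / (2 * m) * (h ^ 2 / K ^ 2 * (T / D) * y ^ 4) ≤ 1 / (2 * m) * κ :=
    mul_le_mul_of_nonneg_left hκ (by positivity)
  -- Here X = ‖∇⊗A‖, y² = ‖ψ‖₆, l⁴ = λ and s = |v|. Half of the field energy absorbs the current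
  -- into a square in X, leaving a multiple of y². Half of the kinetic energy then absorbs that into
  -- a square in y², leaving the negative constant.
  have h2 : 0 ≤ D / (16 * Real.pi * c ^ 2)
      * (X - 8 * Real.pi * c * q * s * K * l ^ 3 * y / D) ^ 2 := by positivity
  have h3 : 0 ≤ h ^ 2 * T / (4 * m * K ^ 2 * D)
      * (y ^ 2 - 8 * Real.pi * m * q ^ 2 * s ^ 2 * K ^ 4 * l ^ 6 / (h ^ 2 * T)) ^ 2 := by
    positivity
  have e : 1 - s ^ 2 / c ^ 2 = D / c ^ 2 := by
    rw [hDc]; field_simp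
  rw [e]
  have key : 1 / (2 * m) * (h ^ 2 / K ^ 2 * (T / D) * y ^ 4) + 1 / (8 * Real.pi) * (D / c ^ 2) * X ^ 2
        - q / c * (s * (K * X * (l * y) * l ^ 2))
      = h ^ 2 / (4 * m * K ^ 2) * (T / D) * y ^ 4
        + 1 / (16 * Real.pi) * (D / c ^ 2) * X ^ 2
        - (4 * Real.pi) ^ 2 * K ^ 6 * q ^ 4 * m * l ^ 12 / h ^ 2 * (s ^ 4 / (D * T))
        + D / (16 * Real.pi * c ^ 2)
          * (X - 8 * Real.pi * c * q * s * K * l ^ 3 * y / D) ^ 2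
        + h ^ 2 * T / (4 * m * K ^ 2 * D)
          * (y ^ 2 - 8 * Real.pi * m * q ^ 2 * s ^ 2 * K ^ 4 * l ^ 6 / (h ^ 2 * T)) ^ 2 := by
    field_simp
    ring
  linarith

variable {C : Constants} {K lam : ℝ}

/-- The shift `8πK³Q²λ/ħ` of the critical velocity caused by the spin. -/
def thetaShift (C : Constants) (K : ℝ) (j : Model) (lam : ℝ) : ℝ :=
  match j with
  | Model.S => 0
  | Model.P => 8 * Real.pi * K ^ 3 * C.Q ^ 2 * lam / C.hbar

theorem thetaShift_nonneg (hK : 0 < K) (hlam : 0 < lam) (j : Model) :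
    0 ≤ thetaShift C K j lam := by
  have := C.hbar_pos
  cases j
  · exact le_rfl
  · simp only [thetaShift]; positivity

/-- With β = `thetaShift` both models obey Θ± = -β ± √(β² + c²), so the critical speeds are treated
at once. -/
theorem theta_eq (j : Model) :
    thetaPlus C K j lam = -thetaShift C K j lam + √(thetaShift C K j lam ^ 2 + C.c ^ 2) ∧
    thetaMinus C K j lam = -thetaShift C K j lam - √(thetaShift C K j lam ^ 2 + C.c ^ 2) := by
  cases j
  · simp [thetaPlus, thetaMinus, thetaShift, Real.sqrt_sq C.c_pos.le]
  · have : (8 * Real.pi * K ^ 3 * C.Q ^ 2 * lam / C.hbar) ^ 2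
        = (8 * Real.pi) ^ 2 * K ^ 6 * C.Q ^ 4 * lam ^ 2 / C.hbar ^ 2 := by ring
    simp only [thetaPlus, thetaMinus, thetaShift, this, and_self]

/-- The critical speeds are the roots in s of c² - s² - 2βs, which is D minus the loss caused by the
Zeeman term. -/
theorem theta_mul (j : Model) (s : ℝ) :
    (thetaPlus C K j lam - s) * (s - thetaMinus C K j lam)
      = C.c ^ 2 - s ^ 2 - 2 * thetaShift C K j lam * s := by
  obtain ⟨h1, h2⟩ := theta_eq (C := C) (K := K) (lam := lam) j
  have h3 : √(thetaShift C K j lam ^ 2 + C.c ^ 2) ^ 2 = thetaShift C K j lam ^ 2 + C.c ^ 2 :=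
    Real.sq_sqrt (by positivity)
  rw [h1, h2]
  linear_combination h3

theorem theta_bounds (hK : 0 < K) (hlam : 0 < lam) (j : Model) :
    thetaPlus C K j lam ≤ C.c ∧ thetaMinus C K j lam < 0 := by
  obtain ⟨h1, h2⟩ := theta_eq (C := C) (K := K) (lam := lam) j
  have hβ := thetaShift_nonneg (C := C) hK hlam j
  have hc := C.c_pos
  rw [h1, h2]
  constructor
  · have : √(thetaShift C K j lam ^ 2 + C.c ^ 2) ≤ thetaShift C K j lam + C.c :=
      Real.sqrt_le_iff.2 ⟨by positivity, by nlinarith⟩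
    linarith
  · have : 0 < √(thetaShift C K j lam ^ 2 + C.c ^ 2) := Real.sqrt_pos.2 (by positivity)
    linarith

variable {A : R3 → R3} {ψ : R3 → Spinor}

/-- Working with λ^{1/4} turns all fractional powers of λ in the estimates into natural powers. -/
theorem normL_two_eq (hlam : 0 < lam) (h : normL 2 ψ ^ 2 = lam) :
    normL 2 ψ = (lam ^ (1 / 4 : ℝ)) ^ 2 := by
  rw [← Real.rpow_natCast, ← Real.rpow_mul hlam.le, ← Real.sqrt_sq (normL_nonneg 2 ψ), h,
    Real.sqrt_eq_rpow]
  norm_num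

theorem normL_three_le (hψ : MemH1 ψ) (hlam : 0 < lam) (h : normL 2 ψ ^ 2 = lam) :
    normL 3 ψ ≤ lam ^ (1 / 4 : ℝ) * normL 6 ψ ^ (1 / 2 : ℝ) := by
  have h6 := normL_nonneg 6 ψ
  refine abs_le_of_sq_le_sq' ?_ (by positivity) |>.2
  rw [mul_pow, ← normL_two_eq hlam h, ← Real.sqrt_eq_rpow, Real.sq_sqrt h6]
  exact normL_three_sq_le hψ

/-- The magnetic field energy dominates the current term if the field is strong. -/
theorem energy_ge_of_strong_field (hK : IsSobolevConstant K) (hlam : 0 < lam) {v : R3}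
    (hvc : ‖v‖ < C.c) (j : Model) (hq : (ψ, A) ∈ admissible lam)
    (hX : 16 * Real.pi * K * C.c * |C.Q| * lam ^ (3 / 4 : ℝ) * (‖v‖ / (C.c ^ 2 - ‖v‖ ^ 2))
      * normL 6 ψ ^ (1 / 2 : ℝ) ≤ normL 2 (gradTensor A)) :
    1 / (16 * Real.pi) * (1 - ‖v‖ ^ 2 / C.c ^ 2) * normL 2 (gradTensor A) ^ 2
      - C.m * ‖v‖ ^ 2 / 2 * lam ≤ energy C j v ψ A := by
  obtain ⟨hψ, hA, hn, -⟩ := hq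
  simp only at hψ hA hn
  have hE := energy_ge (C := C) hK hA hψ j v
  rw [hn] at hE
  have h3 := normL_three_le hψ hlam hn
  rw [normL_two_eq hlam hn] at hE
  have hl3 : lam ^ (3 / 4 : ℝ) = (lam ^ (1 / 4 : ℝ)) ^ 3 := by
    rw [← Real.rpow_natCast, ← Real.rpow_mul hlam.le]; norm_num
  rw [hl3] at hX
  have hc := C.c_pos
  have hK0 := hK.1
  have hD : 0 < C.c ^ 2 - ‖v‖ ^ 2 := by nlinarith [norm_nonneg v]
  have hkin : 0 ≤ 1 / (2 * C.m) * kineticShift C j (C.m • v) A ψ :=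
    mul_nonneg (by have := C.m_pos; positivity) (kineticShift_nonneg j _)
  set X := normL 2 (gradTensor A) with hXd
  set y := normL 6 ψ ^ (1 / 2 : ℝ) with hy
  set l := lam ^ (1 / 4 : ℝ) with hl
  set s := ‖v‖ with hs
  have hX0 : 0 ≤ X := normL_nonneg _ _
  have hy0 : 0 ≤ y := Real.rpow_nonneg (normL_nonneg _ _) _
  have hl0 : 0 < l := Real.rpow_pos_of_pos hlam _
  have hs0 : 0 ≤ s := norm_nonneg v
  have hpi := Real.pi_pos
  -- The reverse of (**) bounds ‖ψ‖₆^{1/2} by X, so the current costs at most half of the field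
  -- energy; the kinetic energy is simply dropped.
  have hG : |C.Q| / C.c * (s * (K * X * normL 3 ψ * l ^ 2))
      ≤ 1 / (16 * Real.pi) * (1 - s ^ 2 / C.c ^ 2) * X ^ 2 := by
    calc |C.Q| / C.c * (s * (K * X * normL 3 ψ * l ^ 2))
        ≤ |C.Q| / C.c * (s * (K * X * (l * y) * l ^ 2)) := by gcongr
      _ = (C.c ^ 2 - s ^ 2) / (16 * Real.pi * C.c ^ 2) * X
          * (16 * Real.pi * K * C.c * |C.Q| * l ^ 3 * (s / (C.c ^ 2 - s ^ 2)) * y) := by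
          field_simp
      _ ≤ (C.c ^ 2 - s ^ 2) / (16 * Real.pi * C.c ^ 2) * X * X := by gcongr
      _ = _ := by field_simp
  have e : 1 / (8 * Real.pi) * (1 - s ^ 2 / C.c ^ 2) * X ^ 2
      = 2 * (1 / (16 * Real.pi) * (1 - s ^ 2 / C.c ^ 2) * X ^ 2) := by ring
  linarith

theorem energy_ge_of_weak_field (hK : IsSobolevConstant K) (hlam : 0 < lam) {v : R3} (j : Model)
    (hv : ‖v‖ < thetaPlus C K j lam) (hq : (ψ, A) ∈ admissible lam)
    (hX : normL 2 (gradTensor A) <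
      16 * Real.pi * K * C.c * |C.Q| * lam ^ (3 / 4 : ℝ) * (‖v‖ / (C.c ^ 2 - ‖v‖ ^ 2))
      * normL 6 ψ ^ (1 / 2 : ℝ)) :
    C.hbar ^ 2 / (4 * C.m * K ^ 2)
        * ((thetaPlus C K j lam - ‖v‖) * (‖v‖ - thetaMinus C K j lam)
          / (C.c ^ 2 - ‖v‖ ^ 2)) * normL 6 ψ ^ 2
      + 1 / (16 * Real.pi) * (1 - ‖v‖ ^ 2 / C.c ^ 2) * normL 2 (gradTensor A) ^ 2
      - (4 * Real.pi) ^ 2 * K ^ 6 * C.Q ^ 4 * C.m * lam ^ 3 / C.hbar ^ 2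
        * (‖v‖ ^ 4 / ((C.c ^ 2 - ‖v‖ ^ 2)
          * (thetaPlus C K j lam - ‖v‖) * (‖v‖ - thetaMinus C K j lam)))
      - C.m * ‖v‖ ^ 2 / 2 * lam ≤ energy C j v ψ A := by
  obtain ⟨hψ, hA, hn, -⟩ := hq
  simp only at hψ hA hn
  obtain ⟨hΘ1, hΘ2⟩ := theta_bounds (C := C) hK.1 hlam j
  have hvc : ‖v‖ < C.c := hv.trans_le hΘ1
  have hT : 0 < (thetaPlus C K j lam - ‖v‖) * (‖v‖ - thetaMinus C K j lam) :=
    mul_pos (by linarith) (by linarith [norm_nonneg v])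
  have hTe := theta_mul (C := C) (K := K) (lam := lam) j ‖v‖
  have hE := energy_ge (C := C) hK hA hψ j v
  have hkin := kineticShift_ge (C := C) hK hA hψ j (C.m • v)
  rw [hn] at hE
  have h3 := normL_three_le hψ hlam hn
  rw [normL_two_eq hlam hn] at hE
  have hl3 : lam ^ (3 / 4 : ℝ) = (lam ^ (1 / 4 : ℝ)) ^ 3 := by
    rw [← Real.rpow_natCast, ← Real.rpow_mul hlam.le]; norm_num
  have hl4 : lam = (lam ^ (1 / 4 : ℝ)) ^ 4 := by
    rw [← Real.rpow_natCast, ← Real.rpow_mul hlam.le]; norm_num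
  have hl12 : lam ^ 3 = (lam ^ (1 / 4 : ℝ)) ^ 12 := by
    conv_lhs => rw [hl4]
    ring
  have hyY : normL 6 ψ = (normL 6 ψ ^ (1 / 2 : ℝ)) ^ 2 := by
    rw [← Real.sqrt_eq_rpow, Real.sq_sqrt (normL_nonneg _ _)]
  have hyY2 : normL 6 ψ ^ 2 = (normL 6 ψ ^ (1 / 2 : ℝ)) ^ 4 := by
    conv_lhs => rw [hyY]
    ring
  rw [hl3] at hX
  have hc := C.c_pos
  have hK0 := hK.1
  have hb := C.hbar_pos
  have hm := C.m_pos
  have hD : 0 < C.c ^ 2 - ‖v‖ ^ 2 := by nlinarith [norm_nonneg v]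
  have hQ4 : C.Q ^ 4 = |C.Q| ^ 4 := by rw [← abs_pow, abs_of_nonneg (by positivity)]
  have hQ2 : C.Q ^ 2 = |C.Q| ^ 2 := (sq_abs _).symm
  rw [mul_assoc (C.c ^ 2 - ‖v‖ ^ 2), hl12, hQ4, hyY2]
  rw [hyY2] at hkin
  set X := normL 2 (gradTensor A) with hXd
  set y := normL 6 ψ ^ (1 / 2 : ℝ) with hy
  set l := lam ^ (1 / 4 : ℝ) with hl
  set s := ‖v‖ with hs
  set T := (thetaPlus C K j lam - s) * (s - thetaMinus C K j lam) with hTd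
  set D := C.c ^ 2 - s ^ 2 with hDd
  set κ := kineticShift C j (C.m • v) A ψ with hκd
  have hX0 : 0 ≤ X := normL_nonneg _ _
  have hy0 : 0 ≤ y := Real.rpow_nonneg (normL_nonneg _ _) _
  have hl0 : 0 < l := Real.rpow_pos_of_pos hlam _
  have hs0 : 0 ≤ s := norm_nonneg v
  have hpi := Real.pi_pos
  have hκ : C.hbar ^ 2 / K ^ 2 * (T / D) * y ^ 4 ≤ κ := by
    cases j with
    | S =>
      have : T = D := by rw [hTe]; simp [thetaShift]
      rw [this, div_self hD.ne', mul_one]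
      simpa using hkin
    | P =>
      have hTe' : T = D - 16 * Real.pi * K ^ 3 * |C.Q| ^ 2 * l ^ 4 * s / C.hbar := by
        rw [hTe, ← hl4, ← hQ2]
        simp only [thetaShift]
        ring
      refine le_trans ?_ hkin
      -- The factor X in the Zeeman bound is replaced by the right side of (**). The result is a
      -- multiple of y⁴, exactly the amount by which T/D falls short of 1.
      have h5 : C.hbar * (|C.Q| / C.c) * (X * (normL 3 ψ * normL 6 ψ))
          ≤ C.hbar * (|C.Q| / C.c) * ((16 * Real.pi * K * C.c * |C.Q| * l ^ 3 * (s / D) * y)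
            * ((l * y) * y ^ 2)) := by
        rw [hyY]
        gcongr
        exact mul_nonneg (normL_nonneg _ _) (by positivity)
      have h6 : C.hbar ^ 2 / K ^ 2 * (T / D) * y ^ 4 = C.hbar ^ 2 / K ^ 2 * y ^ 4
          - C.hbar * (|C.Q| / C.c) * ((16 * Real.pi * K * C.c * |C.Q| * l ^ 3 * (s / D) * y)
            * ((l * y) * y ^ 2)) := by
        rw [hTe']
        field_simp
      rw [h6]
      linarith
  have hmain := quadratic_lower_bound (q := |C.Q|) (l := l) (s := s) (X := X) hm hb hc hK0 hD hT
    rfl hκ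
  have hG : |C.Q| / C.c * (s * (K * X * normL 3 ψ * l ^ 2))
      ≤ |C.Q| / C.c * (s * (K * X * (l * y) * l ^ 2)) := by gcongr
  linarith

theorem bddBelow_energy (hK : IsSobolevConstant K) (hlam : 0 < lam) {v : R3} (j : Model)
    (hv : ‖v‖ < thetaPlus C K j lam) :
    BddBelow ((fun q : (R3 → Spinor) × (R3 → R3) => energy C j v q.1 q.2) '' admissible lam) := by
  obtain ⟨hΘ1, hΘ2⟩ := theta_bounds (C := C) hK.1 hlam j
  have hvc : ‖v‖ < C.c := hv.trans_le hΘ1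
  have h1 : 0 < thetaPlus C K j lam - ‖v‖ := by linarith
  have h2 : 0 < ‖v‖ - thetaMinus C K j lam := by linarith [norm_nonneg v]
  have hc := C.c_pos
  have hm := C.m_pos
  have hD : 0 < C.c ^ 2 - ‖v‖ ^ 2 := by nlinarith [norm_nonneg v]
  have hf : 0 ≤ 1 - ‖v‖ ^ 2 / C.c ^ 2 := by
    rw [sub_nonneg, div_le_one (by positivity)]; linarith
  set r := (4 * Real.pi) ^ 2 * K ^ 6 * C.Q ^ 4 * C.m * lam ^ 3 / C.hbar ^ 2
        * (‖v‖ ^ 4 / ((C.c ^ 2 - ‖v‖ ^ 2)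
          * (thetaPlus C K j lam - ‖v‖) * (‖v‖ - thetaMinus C K j lam))) with hr
  have hr0 : 0 ≤ r := by positivity
  -- The constant `r` is subtracted in the weak-field bound only, but being nonnegative it serves
  -- both cases; the remaining terms of the bounds are nonnegative.
  refine ⟨-r - C.m * ‖v‖ ^ 2 / 2 * lam, ?_⟩
  rintro _ ⟨⟨ψ, A⟩, hq, rfl⟩
  have hX2 : 0 ≤ 1 / (16 * Real.pi) * (1 - ‖v‖ ^ 2 / C.c ^ 2) * normL 2 (gradTensor A) ^ 2 := by
    have := Real.pi_pos
    positivity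
  rcases lt_or_ge (normL 2 (gradTensor A)) (16 * Real.pi * K * C.c * |C.Q| * lam ^ (3 / 4 : ℝ)
    * (‖v‖ / (C.c ^ 2 - ‖v‖ ^ 2)) * normL 6 ψ ^ (1 / 2 : ℝ)) with hX | hX
  · have h := energy_ge_of_weak_field hK hlam j hv hq hX
    have hY : 0 ≤ C.hbar ^ 2 / (4 * C.m * K ^ 2)
        * ((thetaPlus C K j lam - ‖v‖) * (‖v‖ - thetaMinus C K j lam)
          / (C.c ^ 2 - ‖v‖ ^ 2)) * normL 6 ψ ^ 2 := by positivity
    dsimp only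
    linarith
  · have h := energy_ge_of_strong_field hK hlam hvc j hq hX
    dsimp only
    linarith

end LowerBound

/-! ### Behaviour of norms and D¹ under dilations and scalar multiples. -/

section Scaling

variable {F : Type*} [NormedAddCommGroup F]

theorem map_inv_smul_volume {R : ℝ} (hR : 0 < R) :
    Measure.map (fun x : R3 => R⁻¹ • x) volume
      = ENNReal.ofReal (R ^ 3) • (volume : Measure R3) := by
  have := Measure.map_addHaar_smul (volume : Measure R3) (inv_ne_zero hR.ne')
  simpa [abs_of_pos hR] using this

theorem quasiMeasurePreserving_inv_smul {R : ℝ} (hR : 0 < R) :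
    Measure.QuasiMeasurePreserving (fun x : R3 => R⁻¹ • x) volume volume :=
  ⟨measurable_const_smul _, by
    rw [map_inv_smul_volume hR]; exact Measure.smul_absolutelyContinuous⟩

theorem eLpNorm_comp_inv_smul {R : ℝ} (hR : 0 < R) (f : R3 → F) :
    eLpNorm (fun x => f (R⁻¹ • x)) 2 volume
      = ENNReal.ofReal (R ^ (3 / 2 : ℝ)) * eLpNorm f 2 volume := by
  have he : MeasurableEmbedding (fun x : R3 => R⁻¹ • x) :=
    (Homeomorph.smulOfNeZero R⁻¹ (inv_ne_zero hR.ne') : R3 ≃ₜ R3).measurableEmbedding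
  have h := he.eLpNorm_map_measure (g := f) (p := 2) (μ := volume)
  rw [map_inv_smul_volume hR, eLpNorm_smul_measure_of_ne_top (by simp)] at h
  rw [show (fun x => f (R⁻¹ • x)) = f ∘ fun x => R⁻¹ • x from rfl, ← h, smul_eq_mul,
    ENNReal.ofReal_rpow_of_pos (by positivity)]
  congr 2
  rw [← Real.rpow_natCast, ← Real.rpow_mul hR.le]
  norm_num

theorem memLp_comp_inv_smul {R : ℝ} (hR : 0 < R) {f : R3 → F} (hf : MemLp f 2 volume) :
    MemLp (fun x => f (R⁻¹ • x)) 2 volume := by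
  refine ⟨hf.1.comp_quasiMeasurePreserving (quasiMeasurePreserving_inv_smul hR), ?_⟩
  rw [eLpNorm_comp_inv_smul hR]
  exact ENNReal.mul_lt_top ENNReal.ofReal_lt_top hf.2

theorem normL_comp_inv_smul_sq [NormedSpace ℝ F] {R : ℝ} (hR : 0 < R) (f : R3 → F) :
    normL 2 (fun x => f (R⁻¹ • x)) ^ 2 = R ^ 3 * normL 2 f ^ 2 := by
  rw [normL, eLpNorm_comp_inv_smul hR, ENNReal.toReal_mul,
    ENNReal.toReal_ofReal (by positivity), mul_pow, normL]
  congr 1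
  rw [← Real.rpow_natCast, ← Real.rpow_mul hR.le, ← Real.rpow_natCast]
  norm_num

theorem normL_const_smul [NormedSpace ℝ F] {𝕜 : Type*} [NormedField 𝕜] [NormedSpace 𝕜 F] (a : 𝕜) (p : ℝ≥0∞)
    (f : R3 → F) : normL p (fun x => a • f x) = ‖a‖ * normL p f := by
  rw [normL, show (fun x => a • f x) = a • f from rfl, eLpNorm_const_smul, ENNReal.toReal_mul,
    toReal_enorm, normL]

theorem normL_add_le [NormedSpace ℝ F] {f g : R3 → F} (hf : MemLp f 2 volume) (hg : MemLp g 2 volume) :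
    normL 2 (fun x => f x + g x) ≤ normL 2 f + normL 2 g := by
  have h := ENNReal.toReal_mono (ENNReal.add_ne_top.2 ⟨hf.2.ne, hg.2.ne⟩)
    (eLpNorm_add_le hf.1 hg.1 one_le_two)
  rwa [ENNReal.toReal_add hf.2.ne hg.2.ne] at h

theorem MemD1.comp_inv_smul [NormedSpace ℝ F] {f : R3 → F} (hf : MemD1 f) {R : ℝ} (hR : 0 < R) :
    MemD1 fun x => f (R⁻¹ • x) := by
  refine ⟨locallyIntegrable_comp_inv_smul hf.1 hR, fun k => ?_, fun t ht => ?_⟩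
  · obtain ⟨g, hg, hL⟩ := hf.2.1 k
    exact ⟨_, hg.comp_inv_smul hR, (memLp_comp_inv_smul hR hL).const_smul R⁻¹⟩
  · have := Measure.addHaar_preimage_smul (volume : Measure R3) (inv_ne_zero hR.ne')
      {x | t < ‖f x‖}
    rw [show {x : R3 | t < ‖f (R⁻¹ • x)‖} = (R⁻¹ • ·) ⁻¹' {x | t < ‖f x‖} from rfl, this]
    exact ENNReal.mul_lt_top ENNReal.ofReal_lt_top (hf.2.2 t ht)

theorem MemD1.const_smul [NormedSpace ℝ F] {f : R3 → F} (hf : MemD1 f) (a : ℝ) : MemD1 fun x => a • f x := by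
  refine ⟨hf.1.smul a, fun k => ?_, fun t ht => ?_⟩
  · obtain ⟨g, hg, hL⟩ := hf.2.1 k
    exact ⟨_, hg.const_smul a, hL.const_smul a⟩
  -- The level t/(|a| + 1) avoids dividing by |a|, which may be zero.
  · refine (measure_mono fun x hx => ?_).trans_lt (hf.2.2 (t / (|a| + 1)) (by positivity))
    have hx' : t < |a| * ‖f x‖ := by simpa [norm_smul] using hx
    have : |a| * ‖f x‖ ≤ ‖f x‖ * (|a| + 1) := by nlinarith [norm_nonneg (f x)]
    exact (div_lt_iff₀ (by positivity)).2 (hx'.trans_le this)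

end Scaling

/-! ### Energy of the modulated and dilated trial states. -/

section TrialStates

variable {C : Constants} {v : R3} {R : ℝ}

theorem HasWeakPartial.exp_smul {k : Fin 3} {f g : R3 → Spinor} (h : HasWeakPartial k f g)
    (b : ℝ) (v : R3) :
    HasWeakPartial k
      (fun x => Complex.exp (Complex.I * ((b * inner ℝ v x : ℝ) : ℂ)) • f x)
      (fun x => Complex.exp (Complex.I * ((b * inner ℝ v x : ℝ) : ℂ)) •
        (g x + (Complex.I * ((b * v k : ℝ) : ℂ)) • f x)) := by
  have hlin : ContDiff ℝ ∞ fun x : R3 => b * inner ℝ v x :=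
    contDiff_const.mul (contDiff_const.inner ℝ contDiff_id)
  have hd : ∀ x : R3, HasFDerivAt (fun x : R3 => b * inner ℝ v x) (b • innerSL ℝ v) x :=
    fun x => (innerSL ℝ v).hasFDerivAt.const_mul b
  have hcos : ∀ x : R3, fderiv ℝ (fun x : R3 => Real.cos (b * inner ℝ v x)) x
      (EuclideanSpace.single k 1) = -(Real.sin (b * inner ℝ v x) * (b * v k)) := fun x => by
    rw [(hd x).cos.fderiv]
    simp [EuclideanSpace.inner_single_right]
  have hsin : ∀ x : R3, fderiv ℝ (fun x : R3 => Real.sin (b * inner ℝ v x)) x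
      (EuclideanSpace.single k 1) = Real.cos (b * inner ℝ v x) * (b * v k) := fun x => by
    rw [(hd x).sin.fderiv]
    simp [EuclideanSpace.inner_single_right]
  have h1 := h.smooth_smul (Real.contDiff_cos.comp hlin)
  have h2 := (h.smooth_smul (Real.contDiff_sin.comp hlin)).const_smul Complex.I
  have he : ∀ x : R3, Complex.exp (Complex.I * ((b * inner ℝ v x : ℝ) : ℂ))
      = (Real.cos (b * inner ℝ v x) : ℂ) + Complex.I * (Real.sin (b * inner ℝ v x) : ℂ) :=
    fun x => by
      rw [mul_comm, Complex.exp_mul_I, Complex.ofReal_cos, Complex.ofReal_sin, mul_comm Complex.I]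
  refine (h1.add h2).congr (Eventually.of_forall fun x => ?_) (Eventually.of_forall fun x => ?_)
  · simp only [he, Function.comp_apply, ← Complex.coe_smul]
    module
  · have hc' := hcos x
    have hs' := hsin x
    simp only [Function.comp_def, he, hc', hs', ← Complex.coe_smul]
    push_cast
    have hI := Complex.I_mul_I
    -- With cosine and sine treated as independent symbols the identity is polynomial and needs only
    -- i² = -1.
    generalize (Complex.cos _) = c₀
    generalize (Complex.sin _) = s₀
    match_scalars
    · ring_nf
      simp only [Complex.I_sq]
      ring
    · ring

theorem norm_trialPsi (f : R3 → Spinor) (x : R3) :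
    ‖trialPsi C v f R x‖ = ‖(R ^ (-(3 / 2) : ℝ)) • f (R⁻¹ • x)‖ := by
  rw [trialPsi, norm_smul, norm_smul, norm_mul, mul_comm Complex.I, Complex.norm_exp_ofReal_mul_I,
    mul_one, Complex.norm_real]

theorem memLp_trialPsi (hR : 0 < R) {f : R3 → Spinor} (hf : MemLp f 2 volume) :
    MemLp (trialPsi C v f R) 2 volume := by
  refine ((memLp_comp_inv_smul hR hf).const_smul (R ^ (-(3 / 2) : ℝ))).of_le ?_
    (Eventually.of_forall fun x => (norm_trialPsi f x).le)
  have hu : Continuous fun x : R3 => ((R ^ (-(3 / 2) : ℝ) : ℝ) : ℂ) *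
      Complex.exp (Complex.I * ((C.m / C.hbar * inner ℝ v x : ℝ) : ℂ)) := by fun_prop
  exact hu.aestronglyMeasurable.smul (memLp_comp_inv_smul hR hf).1

theorem normL_trialPsi (hR : 0 < R) (f : R3 → Spinor) :
    normL 2 (trialPsi C v f R) = normL 2 f := by
  have h1 : eLpNorm (trialPsi C v f R) 2 volume
      = eLpNorm (fun x => (R ^ (-(3 / 2) : ℝ)) • f (R⁻¹ • x)) 2 volume :=
    eLpNorm_congr_norm_ae (Eventually.of_forall fun x => norm_trialPsi f x)
  have h2 : normL 2 (trialPsi C v f R)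
      = normL 2 fun x => (R ^ (-(3 / 2) : ℝ)) • f (R⁻¹ • x) := by rw [normL, normL, h1]
  rw [h2, normL_const_smul, Real.norm_of_nonneg (by positivity), normL,
    eLpNorm_comp_inv_smul hR, ENNReal.toReal_mul, ENNReal.toReal_ofReal (by positivity),
    ← mul_assoc, ← Real.rpow_add hR]
  simp [normL]

theorem hasWeakPartial_trialPsi (hR : 0 < R) {k : Fin 3} {f g : R3 → Spinor}
    (h : HasWeakPartial k f g) :
    HasWeakPartial k (trialPsi C v f R) (trialPsi C v
      (fun x => R⁻¹ • g x + (Complex.I * ((C.m / C.hbar * v k : ℝ) : ℂ)) • f x) R) := by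
  refine (((h.comp_inv_smul hR).exp_smul (C.m / C.hbar) v).const_smul
    ((R ^ (-(3 / 2) : ℝ) : ℝ) : ℂ)).congr (Eventually.of_forall fun x => ?_)
    (Eventually.of_forall fun x => ?_)
  · simp only [trialPsi, mul_smul]
  · simp only [trialPsi, mul_smul]

theorem weakPartial_trialPsi (hR : 0 < R) {ψ : R3 → Spinor} (hψ : MemH1 ψ) (k : Fin 3) :
    weakPartial k (trialPsi C v ψ R) =ᵐ[volume] trialPsi C v (fun x => R⁻¹ • weakPartial k ψ x
      + (Complex.I * ((C.m / C.hbar * v k : ℝ) : ℂ)) • ψ x) R :=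
  (hasWeakPartial_trialPsi hR (hψ.hasWeakPartial k)).weakPartial_ae_eq

theorem memH1_trialPsi (hR : 0 < R) {ψ : R3 → Spinor} (hψ : MemH1 ψ) :
    MemH1 (trialPsi C v ψ R) :=
  ⟨memLp_trialPsi hR hψ.1, fun k => ⟨_, hasWeakPartial_trialPsi hR (hψ.hasWeakPartial k),
    memLp_trialPsi hR (((hψ.memLp_weakPartial k).const_smul R⁻¹).add 
      (hψ.1.const_smul (Complex.I * ((C.m / C.hbar * v k : ℝ) : ℂ))))⟩⟩

variable {A : R3 → R3} {a : ℝ}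

theorem memD1_trialA (hA : MemD1 A) (hR : 0 < R) : MemD1 (trialA C A a R) :=
  (hA.comp_inv_smul hR).const_smul _

theorem weakPartial_trialA (hA : MemD1 A) (hR : 0 < R) (k : Fin 3) :
    weakPartial k (trialA C A a R) =ᵐ[volume]
      fun x => (a * C.c / C.Q * R⁻¹) • weakPartial k A (R⁻¹ • x) := by
  refine (((hA.hasWeakPartial k).comp_inv_smul hR).const_smul
    (a * C.c / C.Q)).weakPartial_ae_eq.trans (Eventually.of_forall fun x => ?_)
  simp only [smul_smul]

theorem divergence_trialA (hA : MemD1 A) (hdiv : divergence A =ᵐ[volume] 0) (hR : 0 < R) :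
    divergence (trialA C A a R) =ᵐ[volume] 0 := by
  have h := ae_all_iff.2 fun k => weakPartial_trialA (C := C) (a := a) hA hR k
  filter_upwards [h, (quasiMeasurePreserving_inv_smul hR).ae_eq_comp hdiv] with x hx hd
  have hd' : ∑ k, weakPartial k A (R⁻¹ • x) k = 0 := hd
  simp [divergence, hx, ← Finset.mul_sum, hd']

theorem normL_gradTensor_trialA_sq (hA : MemD1 A) (hR : 0 < R) :
    normL 2 (gradTensor (trialA C A a R)) ^ 2
      = (a * C.c / C.Q) ^ 2 * R * normL 2 (gradTensor A) ^ 2 := by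
  have h := ae_all_iff.2 fun k => weakPartial_trialA (C := C) (a := a) hA hR k
  have h' : gradTensor (trialA C A a R) =ᵐ[volume]
      fun x => (a * C.c / C.Q * R⁻¹) • gradTensor A (R⁻¹ • x) := by
    filter_upwards [h] with x hx
    ext p
    simp [gradTensor, hx]
  rw [normL_congr h', normL_const_smul, mul_pow, normL_comp_inv_smul_sq hR, Real.norm_eq_abs,
    sq_abs]
  field_simp

theorem normL_dirDeriv_trialA_sq (hA : MemD1 A) (hR : 0 < R) (w : R3) :
    normL 2 (dirDeriv w (trialA C A a R)) ^ 2
      = (a * C.c / C.Q) ^ 2 * R * normL 2 (dirDeriv w A) ^ 2 := by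
  have h := ae_all_iff.2 fun k => weakPartial_trialA (C := C) (a := a) hA hR k
  have h' : dirDeriv w (trialA C A a R) =ᵐ[volume]
      fun x => (a * C.c / C.Q * R⁻¹) • dirDeriv w A (R⁻¹ • x) := by
    filter_upwards [h] with x hx
    simp only [dirDeriv, hx, Finset.smul_sum]
    exact Finset.sum_congr rfl fun k _ => smul_comm _ _ _
  rw [normL_congr h', normL_const_smul, mul_pow, normL_comp_inv_smul_sq hR, Real.norm_eq_abs,
    sq_abs]
  field_simp

theorem trial_mem_admissible {lam : ℝ} {ψ : R3 → Spinor} (h : (ψ, A) ∈ admissible lam)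
    (a : ℝ) (hR : 0 < R) : (trialPsi C v ψ R, trialA C A a R) ∈ admissible lam :=
  ⟨memH1_trialPsi hR h.1, memD1_trialA h.2.1 hR, by
    show normL 2 (trialPsi C v ψ R) ^ 2 = lam
    rw [normL_trialPsi hR]; exact h.2.2.1, divergence_trialA h.2.1 h.2.2.2 hR⟩

theorem normL_inv_smul_add_le {f g : R3 → Spinor} (hf : MemLp f 2 volume)
    (hg : MemLp g 2 volume) (hR : 1 ≤ R) :
    normL 2 (fun x => R⁻¹ • f x + g x) ≤ normL 2 f + normL 2 g := by
  refine (normL_add_le (hf.const_smul R⁻¹) hg).trans (add_le_add_left ?_ _)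
  have := normL_const_smul R⁻¹ 2 f
  rw [show (R⁻¹ • f) = fun x => R⁻¹ • f x from rfl, this]
  refine mul_le_of_le_one_left (normL_nonneg _ _) ?_
  rw [Real.norm_of_nonneg (by positivity)]
  exact inv_le_one_of_one_le₀ hR

/-- The phase turns iħ∂ₖ into the extra term -mvₖ, and the amplitude ac/Q cancels the coupling Q/c,
leaving aAψ. Apart from the outer isometry, R occurs only as the factor 1/R in front of the
derivative. -/
theorem covDeriv_trial (hR : 0 < R) {ψ : R3 → Spinor} (hψ : MemH1 ψ) (k : Fin 3) :
    covDeriv C (trialA C A a R) (trialPsi C v ψ R) k =ᵐ[volume]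
      trialPsi C v (fun x => R⁻¹ • ((Complex.I * (C.hbar : ℂ)) • weakPartial k ψ x)
        + ((a : ℂ) • (((A x k : ℝ) : ℂ) • ψ x) - ((C.m * v k : ℝ) : ℂ) • ψ x)) R := by
  filter_upwards [weakPartial_trialPsi (C := C) (v := v) hR hψ k] with x hx
  have hQ : (C.Q : ℂ) ≠ 0 := Complex.ofReal_ne_zero.2 C.Q_ne_zero
  have hc : (C.c : ℂ) ≠ 0 := Complex.ofReal_ne_zero.2 C.c_pos.ne'
  have hh : (C.hbar : ℂ) ≠ 0 := Complex.ofReal_ne_zero.2 C.hbar_pos.ne'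
  rw [covDeriv, hx]
  simp only [trialPsi, trialA, PiLp.smul_apply, smul_eq_mul, ← Complex.coe_smul]
  push_cast
  match_scalars
  · ring
  · field_simp
    ring_nf
    simp only [Complex.I_sq]
    ring

theorem exists_normL_covDeriv_trial_le {ψ : R3 → Spinor} (hψ : MemH1 ψ) (hA : MemD1 A) (v : R3)
    (a : ℝ) (k : Fin 3) : ∃ B : ℝ, ∀ R : ℝ, 1 ≤ R →
      normL 2 (covDeriv C (trialA C A a R) (trialPsi C v ψ R) k) ≤ B := by
  refine ⟨normL 2 ((Complex.I * (C.hbar : ℂ)) • weakPartial k ψ)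
    + normL 2 (((a : ℂ) • fun x => ((A x k : ℝ) : ℂ) • ψ x) - ((C.m * v k : ℝ) : ℂ) • ψ),
    fun R hR => ?_⟩
  have hR0 : 0 < R := by linarith
  rw [normL_congr (covDeriv_trial hR0 hψ k), normL_trialPsi hR0]
  exact normL_inv_smul_add_le ((hψ.memLp_weakPartial k).const_smul (Complex.I * (C.hbar : ℂ)))
    (((memLp_potential_smul hA hψ.memLp_three k).const_smul (a : ℂ)).sub
      (hψ.1.const_smul ((C.m * v k : ℝ) : ℂ))) hR

theorem normL_pauliDeriv_le {ψ : R3 → Spinor} (hψ : MemH1 ψ) (hA : MemD1 A) :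
    normL 2 (pauliDeriv C A ψ) ≤ ∑ k, normL 2 (covDeriv C A ψ k) := by
  have hm : ∀ k, MemLp (covDeriv C A ψ k) 2 volume := fun k => by
    have := memLp_covShift (C := C) hA hψ 0 k
    rwa [covShift_zero] at this
  have h1 : eLpNorm (pauliDeriv C A ψ) 2 volume ≤ ∑ k, eLpNorm (covDeriv C A ψ k) 2 volume := by
    calc eLpNorm (pauliDeriv C A ψ) 2 volume
        ≤ eLpNorm (∑ k, fun x => ‖covDeriv C A ψ k x‖) 2 volume := by
          refine eLpNorm_mono_real fun x => ?_
          rw [Finset.sum_apply]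
          exact norm_sigmaSum_le fun k => covDeriv C A ψ k x
      _ ≤ ∑ k, eLpNorm (fun x => ‖covDeriv C A ψ k x‖) 2 volume :=
          eLpNorm_sum_le (fun k _ => (hm k).1.norm) one_le_two
      _ = _ := by simp only [eLpNorm_norm]
  have h2 := ENNReal.toReal_mono (ENNReal.sum_ne_top.2 fun k _ => (hm k).2.ne) h1
  rwa [ENNReal.toReal_sum fun k _ => (hm k).2.ne] at h2

theorem exists_kinetic_trial_le {ψ : R3 → Spinor} (hψ : MemH1 ψ) (hA : MemD1 A) (j : Model)
    (v : R3) (a : ℝ) : ∃ B : ℝ, ∀ R : ℝ, 1 ≤ R →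
      kinetic C j (trialA C A a R) (trialPsi C v ψ R) ≤ B := by
  choose B hB using fun k => exists_normL_covDeriv_trial_le (C := C) hψ hA v a k
  cases j with
  | S => exact ⟨∑ k, B k ^ 2, fun R hR => Finset.sum_le_sum fun k _ =>
      pow_le_pow_left₀ (normL_nonneg _ _) (hB k R hR) 2⟩
  | P => exact ⟨(∑ k, B k) ^ 2, fun R hR => pow_le_pow_left₀ (normL_nonneg _ _)
      ((normL_pauliDeriv_le (memH1_trialPsi (by linarith) hψ)
        (memD1_trialA hA (by linarith))).trans (Finset.sum_le_sum fun k _ => hB k R hR)) 2⟩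

theorem re_integral_inner_le {f g : R3 → Spinor} (hf : MemLp f 2 volume) (hg : MemLp g 2 volume) :
    (∫ x, inner ℂ (f x) (g x)).re ≤ normL 2 f * normL 2 g := by
  calc (∫ x, inner ℂ (f x) (g x)).re ≤ ‖∫ x, inner ℂ (f x) (g x)‖ := Complex.re_le_norm _
    _ ≤ ∫ x, ‖f x‖ * ‖g x‖ :=
        norm_integral_le_of_norm_le (integrable_mul_of_two hf.norm hg.norm)
          (Eventually.of_forall fun _ => norm_inner_le_norm _ _)
    _ ≤ normL 2 f * normL 2 g := by
        rw [← normL_norm 2 f, ← normL_norm 2 g]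
        exact (le_abs_self _).trans (integral_mul_le_normL hf.norm hg.norm)

/-- The part of the derivative that does not decay with R comes from the phase and is a constant
multiple of the state, so the coupling energy stays bounded. -/
theorem dirDeriv_trialPsi (hR : 0 < R) {ψ : R3 → Spinor} (hψ : MemH1 ψ) :
    dirDeriv v (trialPsi C v ψ R) =ᵐ[volume] trialPsi C v (fun x => R⁻¹ • dirDeriv v ψ x
      + (∑ k, Complex.I * ((v k * (C.m / C.hbar * v k) : ℝ) : ℂ)) • ψ x) R := by
  have h := ae_all_iff.2 fun k => weakPartial_trialPsi (C := C) (v := v) hR hψ k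
  filter_upwards [h] with x hx
  simp only [dirDeriv, hx, trialPsi, Fin.sum_univ_three, ← Complex.coe_smul]
  push_cast
  module

theorem exists_coupling_trial_le {ψ : R3 → Spinor} (hψ : MemH1 ψ) (v : R3) :
    ∃ B : ℝ, ∀ R : ℝ, 1 ≤ R → (∫ x, inner ℂ (trialPsi C v ψ R x)
      ((Complex.I * (C.hbar : ℂ)) • dirDeriv v (trialPsi C v ψ R) x)).re ≤ B := by
  refine ⟨normL 2 ψ * (‖Complex.I * (C.hbar : ℂ)‖ * (normL 2 (dirDeriv v ψ)
    + normL 2 ((∑ k, Complex.I * ((v k * (C.m / C.hbar * v k) : ℝ) : ℂ)) • ψ))),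
    fun R hR => ?_⟩
  have hR0 : 0 < R := by linarith
  have hm := memH1_trialPsi (C := C) (v := v) hR0 hψ
  refine (re_integral_inner_le hm.1 ((memLp_dirDeriv hm.memLp_weakPartial v).const_smul
    (Complex.I * (C.hbar : ℂ)))).trans ?_
  have e := normL_const_smul (Complex.I * (C.hbar : ℂ)) 2 (dirDeriv v (trialPsi C v ψ R))
  rw [show ((Complex.I * (C.hbar : ℂ)) • dirDeriv v (trialPsi C v ψ R))
    = fun x => (Complex.I * (C.hbar : ℂ)) • dirDeriv v (trialPsi C v ψ R) x from rfl, e,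
    normL_trialPsi hR0, normL_congr (dirDeriv_trialPsi hR0 hψ), normL_trialPsi hR0]
  exact mul_le_mul_of_nonneg_left (mul_le_mul_of_nonneg_left (normL_inv_smul_add_le
    (memLp_dirDeriv hψ.memLp_weakPartial v) (hψ.1.const_smul
      (∑ k, Complex.I * ((v k * (C.m / C.hbar * v k) : ℝ) : ℂ))) hR) (norm_nonneg _))
    (normL_nonneg _ _)

theorem normL_dirDeriv_smul {F : Type*} [NormedAddCommGroup F] [NormedSpace ℝ F] (t : ℝ) (w : R3)
    (f : R3 → F) : normL 2 (dirDeriv (t • w) f) = |t| * normL 2 (dirDeriv w f) := by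
  have e : dirDeriv (t • w) f = fun x => t • dirDeriv w f x := by
    funext x
    simp [dirDeriv, Finset.smul_sum, mul_smul]
  rw [e, normL_const_smul, Real.norm_eq_abs]

/-- The energy of the dilated states tends to `-∞`. -/
theorem tendsto_energy_trial {lam : ℝ} {ψ : R3 → Spinor} (h : (ψ, A) ∈ admissible lam)
    (j : Model) (v : R3)
    (hneg : C.c ^ 2 * normL 2 (gradTensor A) ^ 2 - normL 2 (dirDeriv v A) ^ 2 < 0)
    (ha : 0 < a) :
    Tendsto (fun R : ℝ => energy C j v (trialPsi C v ψ R) (trialA C A a R)) atTop atBot := by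
  obtain ⟨B, hB⟩ := exists_kinetic_trial_le (C := C) h.1 h.2.1 j v a
  obtain ⟨B', hB'⟩ := exists_coupling_trial_le (C := C) h.1 v
  set δ := C.c ^ 2 * normL 2 (gradTensor A) ^ 2 - normL 2 (dirDeriv v A) ^ 2 with hδ
  have hκ : 0 < 1 / (8 * Real.pi) * (a / C.Q) ^ 2 := by
    have : a / C.Q ≠ 0 := div_ne_zero ha.ne' C.Q_ne_zero
    positivity
  have hlim : Tendsto (fun R : ℝ => (1 / (2 * C.m) * B + B')
      + (1 / (8 * Real.pi) * (a / C.Q) ^ 2 * δ) * R) atTop atBot :=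
    tendsto_atBot_add_const_left _ _
      (tendsto_id.const_mul_atTop_of_neg (mul_neg_of_pos_of_neg hκ hneg))
  refine tendsto_atBot_mono' _ ?_ hlim
  filter_upwards [eventually_ge_atTop 1] with R hR
  have hR0 : 0 < R := by linarith
  have hm := C.m_pos
  have h1 := mul_le_mul_of_nonneg_left (hB R hR) (by positivity : 0 ≤ 1 / (2 * C.m))
  have h2 := hB' R hR
  have hc := C.c_pos.ne'
  have hQ := C.Q_ne_zero
  -- Two derivatives contribute R⁻² and the volume R³, so the field energy is exactly linear in R;
  -- its slope has the sign of `δ`.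
  have h3 : 1 / (8 * Real.pi) * (normL 2 (gradTensor (trialA C A a R)) ^ 2
      - normL 2 (dirDeriv (C.c⁻¹ • v) (trialA C A a R)) ^ 2)
      = (1 / (8 * Real.pi) * (a / C.Q) ^ 2 * δ) * R := by
    rw [normL_gradTensor_trialA_sq h.2.1 hR0, normL_dirDeriv_trialA_sq h.2.1 hR0,
      normL_dirDeriv_smul, mul_pow, sq_abs, hδ]
    field_simp
  rw [energy, h3]
  linarith

theorem not_bddBelow_energy {lam : ℝ} {ψ : R3 → Spinor} (h : (ψ, A) ∈ admissible lam)
    (j : Model) (v : R3)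
    (hneg : C.c ^ 2 * normL 2 (gradTensor A) ^ 2 - normL 2 (dirDeriv v A) ^ 2 < 0) :
    ¬ BddBelow ((fun q => energy C j v q.1 q.2) '' admissible lam) := by
  rintro ⟨b, hb⟩
  obtain ⟨R, hR, hlt⟩ := ((eventually_gt_atTop 0).and
    ((tendsto_energy_trial h j v hneg one_pos).eventually_lt_atBot b)).exists
  exact absurd (hb ⟨_, trial_mem_admissible (C := C) (v := v) h 1 hR, rfl⟩) (not_le.2 hlt)

end TrialStates

/-! ### A directional Poincaré inequality and states satisfying (*) at large speed. -/

section LargeSpeed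

theorem normL_two_pos {u : R3 → ℝ} (hu : Continuous u) (hc : HasCompactSupport u) (h0 : u ≠ 0) :
    0 < normL 2 u := by
  have hL : MemLp u 2 volume := hu.memLp_of_hasCompactSupport hc
  refine ENNReal.toReal_pos (fun h => h0 ?_) hL.2.ne
  rw [eLpNorm_eq_zero_iff hL.1 two_ne_zero] at h
  exact (hu.ae_eq_iff_eq volume continuous_zero).1 h

theorem memLp_fderiv_apply {u : R3 → ℝ} (hu : ContDiff ℝ ∞ u) (hc : HasCompactSupport u)
    (w : R3) : MemLp (fun x => fderiv ℝ u x w) 2 volume :=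
  (continuous_fderiv_apply_of_contDiff (hu.of_le (by simp)) w).memLp_of_hasCompactSupport
    (hc.fderiv_apply (𝕜 := ℝ) w)

/-- The Poincaré inequality in a direction. -/
theorem exists_poincare {u : R3 → ℝ} (hu : ContDiff ℝ ∞ u) (hc : HasCompactSupport u) :
    ∃ M : ℝ, 0 < M ∧ ∀ w : R3, ‖w‖ * normL 2 u ≤ M * normL 2 (fun x => fderiv ℝ u x w) := by
  obtain ⟨r, hr⟩ := hc.isCompact.isBounded.exists_norm_le
  refine ⟨2 * (|r| + 1), by positivity, fun w => ?_⟩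
  set D : R3 → ℝ := fun x => fderiv ℝ u x w with hD
  have hDc : Continuous D := continuous_fderiv_apply_of_contDiff (hu.of_le (by simp)) w
  have hu2 : MemLp u 2 volume := hu.continuous.memLp_of_hasCompactSupport hc
  have hD2 : MemLp D 2 volume := memLp_fderiv_apply hu hc w
  have hdu : Differentiable ℝ u := hu.differentiable (by simp)
  have hl : Continuous fun x : R3 => inner ℝ w x := by fun_prop
  have hcint : ∀ f : R3 → ℝ, Continuous f → Integrable (fun x => u x * f x) volume :=
    fun f hf => (hu.continuous.mul hf).integrable_of_hasCompactSupport hc.mul_right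
  have hf' : ∀ x, HasFDerivAt (fun x : R3 => inner ℝ w x * u x)
      ((inner ℝ w x : ℝ) • fderiv ℝ u x + u x • innerSL ℝ w) x := fun x =>
    (innerSL ℝ w).hasFDerivAt.mul (hdu x).hasFDerivAt
  have hfd : ∀ x, fderiv ℝ (fun x : R3 => inner ℝ w x * u x) x w
      = inner ℝ w x * D x + u x * ‖w‖ ^ 2 := fun x => by
    rw [(hf' x).fderiv]
    simp [hD]
  have i1 : Integrable (fun x => u x * (inner ℝ w x * D x)) volume := hcint _ (hl.mul hDc)
  have i2 := hcint _ hu.continuous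
  -- The function (w·x)u is paired with the w-derivative of u. Differentiating w·x along w produces
  -- |w|², hence |w|²‖u‖² = -2∫ (w·x) u ∂_w u, and x is bounded on the support.
  have key := integral_mul_fderiv_eq_neg_fderiv_mul_of_integrable (μ := (volume : Measure R3))
    (f := fun x : R3 => inner ℝ w x * u x) (g := u) (v := w) ?_ ?_ ?_
    (fun x _ => (hf' x).differentiableAt) (fun x _ => hdu x)
  · have e1 : ∫ x, inner ℝ w x * u x * fderiv ℝ u x w = ∫ x, u x * (inner ℝ w x * D x) :=
      integral_congr_ae (Eventually.of_forall fun x => by simp only [hD]; ring)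
    have e2 : ∫ x, fderiv ℝ (fun x : R3 => inner ℝ w x * u x) x w * u x
        = (∫ x, u x * (inner ℝ w x * D x)) + ‖w‖ ^ 2 * ∫ x, u x * u x := by
      rw [← integral_const_mul, ← integral_add i1 (i2.const_mul _)]
      exact integral_congr_ae (Eventually.of_forall fun x => by simp only [hfd]; ring)
    rw [e1, e2] at key
    have hn : normL 2 u ^ 2 = ∫ x, u x * u x := by
      rw [normL_two_sq hu2.1]
      exact integral_congr_ae (Eventually.of_forall fun x => by simp [sq])
    have hb : |∫ x, u x * (inner ℝ w x * D x)| ≤ ‖w‖ * (|r| + 1) * (normL 2 u * normL 2 D) := by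
      calc |∫ x, u x * (inner ℝ w x * D x)|
          ≤ ∫ x, ‖w‖ * (|r| + 1) * (|u x| * |D x|) := by
            refine norm_integral_le_of_norm_le (f := fun x => u x * (inner ℝ w x * D x))
              ((integrable_mul_of_two hu2.norm hD2.norm).const_mul _)
              (Eventually.of_forall fun x => ?_)
            by_cases hx : u x = 0
            · simp [hx]
            have hxr : ‖x‖ ≤ |r| + 1 :=
              (hr x (subset_tsupport u hx)).trans ((le_abs_self r).trans (by linarith))
            have := (abs_real_inner_le_norm w x).trans
              (mul_le_mul_of_nonneg_left hxr (norm_nonneg w))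
            rw [Real.norm_eq_abs, abs_mul, abs_mul]
            calc |u x| * (|inner ℝ w x| * |D x|) = |inner ℝ w x| * (|u x| * |D x|) := by ring
              _ ≤ _ := mul_le_mul_of_nonneg_right this (by positivity)
        _ ≤ _ := by
            rw [integral_const_mul, ← normL_norm 2 u, ← normL_norm 2 D]
            exact mul_le_mul_of_nonneg_left
              ((le_abs_self _).trans (integral_mul_le_normL hu2.norm hD2.norm)) (by positivity)
    rw [← hn] at key
    have h1 := (neg_le_abs _).trans hb
    have h2 : ‖w‖ ^ 2 * normL 2 u ^ 2 ≤ 2 * (‖w‖ * (|r| + 1) * (normL 2 u * normL 2 D)) := by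
      linarith
    -- One factor |w|‖u‖ is cancelled; if it vanishes the claim is trivial.
    have hX := mul_nonneg (norm_nonneg w) (normL_nonneg 2 u)
    rcases hX.eq_or_lt with h0 | hpos
    · rw [← h0]
      exact mul_nonneg (by positivity) (normL_nonneg _ _)
    · refine le_of_mul_le_mul_left ?_ hpos
      linarith
  · refine (i1.add (i2.const_mul (‖w‖ ^ 2))).congr (Eventually.of_forall fun x => ?_)
    simp only [hfd, Pi.add_apply]; ring
  · refine i1.congr (Eventually.of_forall fun x => ?_)
    simp only [hD]; ring
  · refine (hcint _ (hl.mul hu.continuous)).congr (Eventually.of_forall fun x => ?_)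
    simp only [Pi.mul_apply]; ring

/-- A standard smooth bump. -/
def bump : R3 → ℝ := (⟨1, 2, one_pos, one_lt_two⟩ : ContDiffBump (0 : R3))

theorem contDiff_bump : ContDiff ℝ ∞ bump := ContDiffBump.contDiff _

theorem hasCompactSupport_bump : HasCompactSupport bump := ContDiffBump.hasCompactSupport _

theorem bump_ne_zero : bump ≠ 0 := fun h => by
  have h1 : bump 0 = 1 := ContDiffBump.one_of_mem_closedBall _ (by simp)
  simp [h] at h1

/-- The derivative of the bump in the direction of the `k`-th basis vector. -/
def bumpPartial (k : Fin 3) (x : R3) : ℝ := fderiv ℝ bump x (EuclideanSpace.single k 1)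

theorem contDiff_bumpPartial (k : Fin 3) : ContDiff ℝ ∞ (bumpPartial k) :=
  (contDiff_bump.fderiv_right (m := ∞) (by simp)).clm_apply contDiff_const

theorem hasCompactSupport_bumpPartial (k : Fin 3) : HasCompactSupport (bumpPartial k) :=
  hasCompactSupport_bump.fderiv_apply (𝕜 := ℝ) _

/-- A vanishing derivative in one direction would, by the Poincaré inequality, force the bump itself
to vanish. -/
theorem bumpPartial_ne_zero (k : Fin 3) : bumpPartial k ≠ 0 := fun h => by
  obtain ⟨M, hM, hP⟩ := exists_poincare contDiff_bump hasCompactSupport_bump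
  have h1 := hP (EuclideanSpace.single k 1)
  have h2 : (fun x => fderiv ℝ bump x (EuclideanSpace.single k 1)) = 0 := h
  have h3 := normL_two_pos contDiff_bump.continuous hasCompactSupport_bump bump_ne_zero
  rw [h2] at h1
  simp [normL] at h1 h3
  linarith

theorem fderiv_bumpPartial_comm (k l : Fin 3) (x : R3) :
    fderiv ℝ (bumpPartial k) x (EuclideanSpace.single l 1)
      = fderiv ℝ (bumpPartial l) x (EuclideanSpace.single k 1) := by
  have hd : DifferentiableAt ℝ (fderiv ℝ bump) x :=
    ((contDiff_bump.fderiv_right (m := ∞) (by simp)).differentiable (by simp)) x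
  have hs : IsSymmSndFDerivAt ℝ bump x :=
    contDiff_bump.contDiffAt.isSymmSndFDerivAt (by
      simpa using WithTop.coe_le_coe.2 (le_top : (2 : ℕ∞) ≤ ⊤))
  have h : ∀ i j : Fin 3, fderiv ℝ (bumpPartial i) x (EuclideanSpace.single j 1)
      = fderiv ℝ (fderiv ℝ bump) x (EuclideanSpace.single j 1) (EuclideanSpace.single i 1) := by
    intro i j
    unfold bumpPartial
    rw [fderiv_clm_apply hd (differentiableAt_const _)]
    simp
  rw [h, h]
  exact hs _ _

/-- A smooth solenoidal vector potential with compact support. -/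
def bumpField (x : R3) : R3 := WithLp.toLp 2 ![-bumpPartial 1 x, bumpPartial 0 x, 0]

theorem contDiff_bumpField : ContDiff ℝ ∞ bumpField := by
  refine (contDiff_euclidean).2 fun i => ?_
  fin_cases i
  · exact (contDiff_bumpPartial 1).neg
  · exact contDiff_bumpPartial 0
  · exact contDiff_const

theorem hasCompactSupport_bumpField : HasCompactSupport bumpField := by
  refine hasCompactSupport_bump.fderiv (𝕜 := ℝ) |>.mono fun x hx h0 => hx ?_
  ext i
  fin_cases i <;> simp [bumpField, bumpPartial, h0]

theorem fderiv_bumpField_apply (x w : R3) (i : Fin 3) :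
    fderiv ℝ bumpField x w i = fderiv ℝ (fun y => bumpField y i) x w := by
  have hd : DifferentiableAt ℝ bumpField x := contDiff_bumpField.differentiable (by simp) x
  have := ((EuclideanSpace.proj i : R3 →L[ℝ] ℝ).hasFDerivAt.comp x hd.hasFDerivAt).fderiv
  exact (congrArg (fun L : R3 →L[ℝ] ℝ => L w) this).symm

theorem divergence_bumpField : divergence bumpField =ᵐ[volume] 0 := by
  have h := ae_all_iff.2 fun k => weakPartial_of_smooth contDiff_bumpField k
  filter_upwards [h] with x hx
  simp only [divergence, hx, fderiv_bumpField_apply, Fin.sum_univ_three, Pi.zero_apply]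
  have e0 : (fun y => bumpField y 0) = fun y => -bumpPartial 1 y := rfl
  have e1 : (fun y => bumpField y 1) = bumpPartial 0 := rfl
  have e2 : (fun y => bumpField y 2) = fun _ => 0 := rfl
  rw [e0, e1, e2, fderiv_fun_neg, fderiv_fun_const, fderiv_bumpPartial_comm 0 1]
  simp

/-- One component suffices: the second component of the field is `bumpPartial 0`, and its Poincaré
constant is the same for all directions of v. -/
theorem exists_normL_dirDeriv_bumpField_ge :
    ∃ κ : ℝ, 0 < κ ∧ ∀ v : R3, κ * ‖v‖ ≤ normL 2 (dirDeriv v bumpField) := by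
  obtain ⟨M, hM, hP⟩ := exists_poincare (contDiff_bumpPartial 0) (hasCompactSupport_bumpPartial 0)
  have hpos := normL_two_pos (contDiff_bumpPartial 0).continuous (hasCompactSupport_bumpPartial 0)
    (bumpPartial_ne_zero 0)
  refine ⟨normL 2 (bumpPartial 0) / M, by positivity, fun v => ?_⟩
  have hD1 := memD1_of_smooth contDiff_bumpField hasCompactSupport_bumpField
  have hle : normL 2 (fun x => fderiv ℝ (bumpPartial 0) x v)
      ≤ normL 2 (dirDeriv v bumpField) := by
    refine ENNReal.toReal_mono (memLp_dirDeriv hD1.memLp_weakPartial v).2.ne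
      (eLpNorm_mono_ae ?_)
    have h := ae_all_iff.2 fun k => weakPartial_of_smooth contDiff_bumpField k
    filter_upwards [h] with x hx
    have e : dirDeriv v bumpField x = fderiv ℝ bumpField x v := by
      have hv : v = ∑ k, v k • EuclideanSpace.single k (1 : ℝ) := by
        simpa using ((EuclideanSpace.basisFun (Fin 3) ℝ).sum_repr v).symm
      conv_rhs => rw [hv]
      simp only [dirDeriv, hx, map_sum, map_smul]
    have e1 : fderiv ℝ (bumpPartial 0) x v = dirDeriv v bumpField x 1 := by
      rw [e, fderiv_bumpField_apply]
      rfl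
    rw [e1]
    exact PiLp.norm_apply_le _ _
  rw [div_mul_eq_mul_div, div_le_iff₀ hM]
  nlinarith [hP v]

theorem exists_real_state {lam : ℝ} (hlam : 0 < lam) :
    ∃ ψ : R3 → Spinor, MemH1 ψ ∧ normL 2 ψ ^ 2 = lam ∧ IsRealValued ψ := by
  have hpos := normL_two_pos contDiff_bump.continuous hasCompactSupport_bump bump_ne_zero
  set s : ℝ := √lam / normL 2 bump with hs
  have hcd : ContDiff ℝ ∞ fun x : R3 =>
      ((s * bump x : ℝ) : ℂ) • (EuclideanSpace.single 0 1 : Spinor) :=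
    (Complex.ofRealCLM.contDiff.comp (contDiff_const.mul contDiff_bump)).smul contDiff_const
  refine ⟨fun x => ((s * bump x : ℝ) : ℂ) • (EuclideanSpace.single 0 1 : Spinor),
    memH1_of_smooth hcd ?_, ?_, fun x i => ?_⟩
  · refine hasCompactSupport_bump.mono fun x hx h0 => hx ?_
    simp [h0]
  · have e : normL 2 (fun x : R3 => ((s * bump x : ℝ) : ℂ) • (EuclideanSpace.single 0 1 : Spinor))
        = normL 2 fun x => s • bump x := by
      rw [normL, normL]
      congr 1
      refine eLpNorm_congr_norm_ae (Eventually.of_forall fun x => ?_)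
      rw [norm_smul, Complex.norm_real]
      simp
    rw [e, normL_const_smul, Real.norm_of_nonneg (by positivity), hs,
      div_mul_cancel₀ _ hpos.ne', Real.sq_sqrt hlam.le]
  · fin_cases i <;> simp

/-- The field is fixed once and for all, so c‖∇⊗A‖ is a constant while the derivative along v grows
at least like κ|v|. The threshold is the speed at which the second overtakes the first. -/
theorem exists_speed (C : Constants) {lam : ℝ} (hlam : 0 < lam) : ∃ V : ℝ, ∀ v : R3, V < ‖v‖ →
    ∃ (ψ : R3 → Spinor) (A : R3 → R3), (ψ, A) ∈ admissible lam ∧ IsRealValued ψ ∧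
      C.c ^ 2 * normL 2 (gradTensor A) ^ 2 - normL 2 (dirDeriv v A) ^ 2 < 0 := by
  obtain ⟨κ, hκ, h⟩ := exists_normL_dirDeriv_bumpField_ge
  obtain ⟨ψ, hψ, hn, hre⟩ := exists_real_state hlam
  refine ⟨C.c * normL 2 (gradTensor bumpField) / κ, fun v hv => ⟨ψ, bumpField,
    ⟨hψ, memD1_of_smooth contDiff_bumpField hasCompactSupport_bumpField, hn,
      divergence_bumpField⟩, hre, ?_⟩⟩
  rw [div_lt_iff₀ hκ] at hv
  have h1 : C.c * normL 2 (gradTensor bumpField) < normL 2 (dirDeriv v bumpField) :=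
    hv.trans_le (by linarith [h v])
  have h2 := pow_lt_pow_left₀ h1 (mul_nonneg C.c_pos.le (normL_nonneg _ _)) two_ne_zero
  rw [mul_pow] at h2
  linarith

end LargeSpeed

end TravellingWave

end

open TravellingWave in
theorem mainTheorem3 (C : Constants) :
    -- unboundedness from below at large speed
    (∀ (j : Model) (lam : ℝ), 0 < lam → ∃ V : ℝ, ∀ v : R3, V < ‖v‖ →
      ¬ BddBelow ((fun q => energy C j v q.1 q.2) '' admissible lam) ∧
      ∃ (ψ₀ : R3 → Spinor) (A₀ : R3 → R3), (ψ₀, A₀) ∈ admissible lam ∧ IsRealValued ψ₀ ∧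
        C.c ^ 2 * normL 2 (gradTensor A₀) ^ 2 - normL 2 (dirDeriv v A₀) ^ 2 < 0) ∧
    -- the energy of the scaled trial states tends to `-∞`
    (∀ (j : Model) (lam : ℝ), 0 < lam → ∀ (v : R3) (ψ₀ : R3 → Spinor) (A₀ : R3 → R3),
      (ψ₀, A₀) ∈ admissible lam → IsRealValued ψ₀ →
      C.c ^ 2 * normL 2 (gradTensor A₀) ^ 2 - normL 2 (dirDeriv v A₀) ^ 2 < 0 →
      ∀ a : ℝ, 0 < a →
        (∀ R : ℝ, 0 < R → (trialPsi C v ψ₀ R, trialA C A₀ a R) ∈ admissible lam) ∧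
        Filter.Tendsto (fun R : ℝ => energy C j v (trialPsi C v ψ₀ R) (trialA C A₀ a R))
          Filter.atTop Filter.atBot) ∧
    -- boundedness from below at small speed, with explicit lower bounds
    (∃ K : ℝ, IsSobolevConstant K) ∧
    (∀ K : ℝ, IsSobolevConstant K → ∀ (j : Model) (lam : ℝ), 0 < lam →
      ∀ v : R3, 0 < ‖v‖ → ‖v‖ < thetaPlus C K j lam →
      BddBelow ((fun q => energy C j v q.1 q.2) '' admissible lam) ∧
      ∀ (ψ : R3 → Spinor) (A : R3 → R3), (ψ, A) ∈ admissible lam →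
        (normL 2 (gradTensor A) <
            16 * Real.pi * K * C.c * |C.Q| * lam ^ (3 / 4 : ℝ) * (‖v‖ / (C.c ^ 2 - ‖v‖ ^ 2))
              * normL 6 ψ ^ (1 / 2 : ℝ) →
          C.hbar ^ 2 / (4 * C.m * K ^ 2)
              * ((thetaPlus C K j lam - ‖v‖) * (‖v‖ - thetaMinus C K j lam)
                / (C.c ^ 2 - ‖v‖ ^ 2)) * normL 6 ψ ^ 2
            + 1 / (16 * Real.pi) * (1 - ‖v‖ ^ 2 / C.c ^ 2) * normL 2 (gradTensor A) ^ 2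
            - (4 * Real.pi) ^ 2 * K ^ 6 * C.Q ^ 4 * C.m * lam ^ 3 / C.hbar ^ 2
              * (‖v‖ ^ 4 / ((C.c ^ 2 - ‖v‖ ^ 2)
                * (thetaPlus C K j lam - ‖v‖) * (‖v‖ - thetaMinus C K j lam)))
            - C.m * ‖v‖ ^ 2 / 2 * lam
          ≤ energy C j v ψ A) ∧
        (16 * Real.pi * K * C.c * |C.Q| * lam ^ (3 / 4 : ℝ) * (‖v‖ / (C.c ^ 2 - ‖v‖ ^ 2))
              * normL 6 ψ ^ (1 / 2 : ℝ) ≤ normL 2 (gradTensor A) →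
          1 / (16 * Real.pi) * (1 - ‖v‖ ^ 2 / C.c ^ 2) * normL 2 (gradTensor A) ^ 2
            - C.m * ‖v‖ ^ 2 / 2 * lam
          ≤ energy C j v ψ A)) := by
  refine ⟨fun j lam hlam => ?_, fun j lam _ v ψ₀ A₀ h _ hneg a ha =>
    ⟨fun R hR => trial_mem_admissible h a hR, tendsto_energy_trial h j v hneg ha⟩,
    exists_isSobolevConstant, fun K hK j lam hlam v _ hv =>
    ⟨bddBelow_energy hK hlam j hv, fun ψ A hq =>
      ⟨energy_ge_of_weak_field hK hlam j hv hq, energy_ge_of_strong_field hK hlam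
        (hv.trans_le (theta_bounds hK.1 hlam j).1) j hq⟩⟩⟩
  obtain ⟨V, hV⟩ := exists_speed C hlam
  refine ⟨V, fun v hv => ?_⟩
  obtain ⟨ψ₀, A₀, h, hre, hneg⟩ := hV v hv
  exact ⟨not_bddBelow_energy h j v hneg, ψ₀, A₀, h, hre, hneg⟩
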